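/- **Setting.** Let $\Omega\subset\mathbb R^3$ be a bounded open set (for instance a bounded Lipschitz domain), $0<a<1/2$, and $\gamma\in C^2(\mathbb R)$ with $0\le\gamma\le\pi$. Let $E_1,E_2$ be constant fourth-order tensors on $\mathbb R^3$ with $E_{m,ijkl}=E_{m,klij}=E_{m,jikl}=E_{m,ijlk}$ for which there are $\alpha,\beta>0$ with $E_1\xi:\xi\ge\alpha|\xi|^2$ and $E_2\xi:\xi\ge\beta|\xi|^2$ for all symmetric $\xi\in\mathbb R^{3\times3}$; here $(E\xi)_{ij}=\sum_{k,l}E_{ijkl}\xi_{kl}$. Let $G\in L^2(\Omega;\mathbb R^3)$ and $g\in H^1(\Omega;\mathbb R^3)$. Write $e_{ij}(u)=\frac12(\partial_ju_i+\partial_iu_j)$, $$R(\alpha)=\begin{pmatrix}\cos\alpha&\sin\alpha&0\\-\sin\alpha&\cos\alpha&0\\0&0&1\end{pmatrix},\qquad \hat R_{x_3}=\begin{pmatrix}-\sin\gamma(x_3)&\cos\gamma(x_3)&0\\0&0&1\end{pmatrix}.$$ Let $\tilde\eta(y)$, $y\in\mathbb R^3$, depend only on $\hat y=(y_2,y_3)$,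 be $1$ if $|\hat y-(\frac12,\frac12)|\le a$ and $0$ otherwise for $\hat y\in\hat Y=[0,1]^2$, and be extended $\hat Y$-periodically in $\hat y$; put $\tilde A(\hat y)=E_1\tilde\eta(\hat y)+E_2(1-\tilde\eta(\hat y))$. For $0<r<1$, $\varepsilon>0$ and $k\in\mathbb Z$ let $L_k^\varepsilon=\mathbb R^2\times((k-1)\varepsilon^r,k\varepsilon^r)$, let $x_k^\varepsilon\in L_k^\varepsilon$ be an arbitrary point, and set $$\chi^\varepsilon(x)=\chi_\Omega(x)\sum_{k\in\mathbb Z}\tilde\eta\big(R(\gamma(x^\varepsilon_{k,3}))\,x/\varepsilon\big)\,\chi_{L_k^\varepsilon}(x),\qquad E^\varepsilon=E_1\chi^\varepsilon+E_2(1-\chi^\varepsilon).$$ The microscopic problem is $-\operatorname{div}(E^\varepsilon e(u^\varepsilon))=G$ in $\Omega$, $u^\varepsilon=g$ on $\partial\Omega$. For a tensor field $C$ on $\Omega$, a weak solution of $-\operatorname{div}(C\,e(u))=G$ in $\Omega$, $u=g$ on $\partial\Omega$, is a function $u\in H^1(\Omega;\mathbb R^3)$ with $u-g\in H^1_0(\Omega;\mathbb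 R^3)$ and $\int_\Omega C\,e(u):e(\psi)\,dx=\int_\Omega G\cdot\psi\,dx$ for all $\psi\in H^1_0(\Omega;\mathbb R^3)$. For $v:\mathbb R^2\to\mathbb R^3$ let $\hat e^R_{kl}(v)=\frac12\big[(\hat R_{x_3}^T\nabla_{\hat y}v_l)_k+(\hat R_{x_3}^T\nabla_{\hat y}v_k)_l\big]$, and let $l_{ij}=\frac12(l_i\otimes l_j+l_j\otimes l_i)$ with $(l_i)$ the canonical basis of $\mathbb R^3$. The cell problem at $x_3\in\mathbb R$ is to find $\tilde\omega_{ij}=\tilde\omega_{ij}(x_3,\cdot)\in H^1_{\rm per}(\hat Y;\mathbb R^3)$ that solves weakly $$-\nabla_{\hat y}\cdot\big(\hat R_{x_3}\tilde A\,\hat e^R(\tilde\omega_{ij})\big)=\nabla_{\hat y}\cdot\big(\hat R_{x_3}\tilde A\,l_{ij}\big)\ \text{ in }\hat Y,$$ that is, $\int_{\hat Y}\tilde A\big(l_{ij}+\hat e^R(\tilde\omega_{ij})\big):\hat e^R(v)\,d\hat y=0$ for all $v\in H^1_{\rm per}(\hat Y;\mathbb R^3)$. **Theorem.** For all $x_3\in\mathbb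 R$ and $i,j\in\{1,2,3\}$ the cell problem has a solution. For any choice of solutions $\tilde\omega_{ij}(x_3,\cdot)$ set $$A^{\rm hom}_{ijkl}(x_3)=\frac1{|\hat Y|}\int_{\hat Y}\Big(\tilde A_{ijkl}(\hat y)+\big(\tilde A(\hat y)\,\hat e^R(\tilde\omega_{ij})\big)_{kl}\Big)d\hat y .$$ Then the macroscopic problem $$-\operatorname{div}\big(A^{\rm hom}(x_3)\,e(u)\big)=G\ \text{ in }\Omega,\qquad u=g\ \text{ on }\partial\Omega,$$ has a unique weak solution $u$. For every $r\in(0,1)$ and every choice of the points $x_k^\varepsilon$, the microscopic problem has a weak solution for each $\varepsilon>0$, and every family $\{u^\varepsilon\}_{\varepsilon>0}$ of weak solutions satisfies $u^\varepsilon\rightharpoonup u$ weakly in $H^1(\Omega;\mathbb R^3)$ as $\varepsilon\to0$. -/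

import Mathlib

open MeasureTheory Filter Topology Set
open scoped ContDiff Matrix BigOperators

noncomputable section

/-! ### Sobolev spaces of vector fields -/

/-- Points of `ℝⁿ` (Euclidean norm, Lebesgue measure). -/
abbrev Pt (n : ℕ) := EuclideanSpace ℝ (Fin n)

/-- Vector fields on `ℝⁿ` with values in `ℝ³`. -/
abbrev Field3 (n : ℕ) := Pt n → Fin 3 → ℝ

/-- Gradient fields: `Du x k j` stands for the `j`-th partial derivative of the
`k`-th component at `x`. -/
abbrev Grad3 (n : ℕ) := Pt n → Fin 3 → Fin n → ℝ

/-- The classical partial derivative. -/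
def pderiv {n : ℕ} (j : Fin n) (φ : Pt n → ℝ) (x : Pt n) : ℝ :=
  fderiv ℝ φ x (EuclideanSpace.single j 1)

/-- Scalar test functions, `φ ∈ C_c^∞(Ω)`. -/
structure IsTestFunction {n : ℕ} (Ω : Set (Pt n)) (φ : Pt n → ℝ) : Prop where
  smooth : ContDiff ℝ ∞ φ
  compact : HasCompactSupport φ
  support : tsupport φ ⊆ Ω

/-- `f'` is the weak `j`-th partial derivative of `f` in the open set `Ω`. -/
structure IsWeakPartial {n : ℕ} (Ω : Set (Pt n)) (j : Fin n) (f f' : Pt n → ℝ) : Prop where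
  locInt : LocallyIntegrableOn f Ω volume
  locInt' : LocallyIntegrableOn f' Ω volume
  byParts : ∀ φ : Pt n → ℝ, IsTestFunction Ω φ →
    ∫ x in Ω, f x * pderiv j φ x = - ∫ x in Ω, f' x * φ x

/-- `u ∈ H¹(Ω; ℝ³)` with weak gradient `Du`. -/
structure IsH1 {n : ℕ} (Ω : Set (Pt n)) (u : Field3 n) (Du : Grad3 n) : Prop where
  memLp : ∀ k, MemLp (fun x => u x k) 2 (volume.restrict Ω)
  memLp_grad : ∀ k j, MemLp (fun x => Du x k j) 2 (volume.restrict Ω)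
  weak : ∀ k j, IsWeakPartial Ω j (fun x => u x k) (fun x => Du x k j)

/-- `u ∈ H¹₀(Ω; ℝ³)` with weak gradient `Du`: `u` is the `H¹(Ω)`-limit of a sequence in
`C_c^∞(Ω; ℝ³)`. -/
structure IsH10 {n : ℕ} (Ω : Set (Pt n)) (u : Field3 n) (Du : Grad3 n) : Prop where
  isH1 : IsH1 Ω u Du
  approx : ∃ φ : ℕ → Field3 n,
    (∀ m k, IsTestFunction Ω (fun x => φ m x k)) ∧
    (∀ k, Tendsto (fun m => eLpNorm (fun x => φ m x k - u x k) 2 (volume.restrict Ω))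
      atTop (𝓝 0)) ∧
    (∀ k j, Tendsto (fun m => eLpNorm
        (fun x => pderiv j (fun z => φ m z k) x - Du x k j) 2 (volume.restrict Ω))
      atTop (𝓝 0))

/-- Weak convergence in `H¹(Ω; ℝ³)` of `(u ε, Du ε)` to `(u₀, Du₀)` as `ε → 0`, `ε > 0`. -/
def WeakH1Tendsto {n : ℕ} (Ω : Set (Pt n)) (u : ℝ → Field3 n) (Du : ℝ → Grad3 n)
    (u₀ : Field3 n) (Du₀ : Grad3 n) : Prop :=
  ∀ v : Pt n → ℝ, MemLp v 2 (volume.restrict Ω) →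
    (∀ k, Tendsto (fun ε => ∫ x in Ω, u ε x k * v x) (𝓝[>] (0 : ℝ))
      (𝓝 (∫ x in Ω, u₀ x k * v x))) ∧
    (∀ k j, Tendsto (fun ε => ∫ x in Ω, Du ε x k j * v x) (𝓝[>] (0 : ℝ))
      (𝓝 (∫ x in Ω, Du₀ x k j * v x)))

/-! ### Linear elasticity -/

/-- Fourth-order tensors on `ℝ³`. -/
abbrev Tensor4 := Fin 3 → Fin 3 → Fin 3 → Fin 3 → ℝ

/-- The action `(E ξ)_{ij} = ∑_{kl} E_{ijkl} ξ_{kl}`. -/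
def Tensor4.app (E : Tensor4) (ξ : Matrix (Fin 3) (Fin 3) ℝ) : Matrix (Fin 3) (Fin 3) ℝ :=
  Matrix.of fun i j => ∑ k, ∑ l, E i j k l * ξ k l

/-- The product `ξ : ζ = ∑_{ij} ξ_{ij} ζ_{ij}`. -/
def ddot (ξ ζ : Matrix (Fin 3) (Fin 3) ℝ) : ℝ := ∑ i, ∑ j, ξ i j * ζ i j

/-- Symmetric and positive definite stiffness tensors. -/
structure IsStiffness (E : Tensor4) : Prop where
  major : ∀ i j k l, E i j k l = E k l i j
  minor_left : ∀ i j k l, E i j k l = E j i k l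
  minor_right : ∀ i j k l, E i j k l = E i j l k
  posDef : ∃ α : ℝ, 0 < α ∧ ∀ ξ : Matrix (Fin 3) (Fin 3) ℝ, ξ.IsSymm →
    α * ddot ξ ξ ≤ ddot (E.app ξ) ξ

/-- The strain `e_{ij}(u) = (∂_j u_i + ∂_i u_j) / 2`, from the value `d` of the gradient
of `u` at a point. -/
def strain (d : Fin 3 → Fin 3 → ℝ) : Matrix (Fin 3) (Fin 3) ℝ :=
  Matrix.of fun i j => (d i j + d j i) / 2

/-- `u` (with weak gradient `Du`) is a weak solution of `-div (C(x) e(u)) = G` in `Ω`,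
`u = g` on `∂Ω`. -/
structure IsWeakSolution (Ω : Set (Pt 3)) (C : Pt 3 → Tensor4) (G : Field3 3)
    (g : Field3 3) (Dg : Grad3 3) (u : Field3 3) (Du : Grad3 3) : Prop where
  isH1 : IsH1 Ω u Du
  boundary : IsH10 Ω (u - g) (Du - Dg)
  weak : ∀ (ψ : Field3 3) (Dψ : Grad3 3), IsH10 Ω ψ Dψ →
    ∫ x in Ω, ddot ((C x).app (strain (Du x))) (strain (Dψ x)) =
      ∫ x in Ω, ∑ k, G x k * ψ x k

/-! ### The locally periodic plywood structure -/

/-- The matrix `R(α)`, the inverse of the rotation by `α` about the `x₃`-axis. -/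
def rot (α : ℝ) : Matrix (Fin 3) (Fin 3) ℝ :=
  !![Real.cos α, Real.sin α, 0; -Real.sin α, Real.cos α, 0; 0, 0, 1]

/-- Characteristic function, in the variables `ŷ = (y₂, y₃)`, of the disc of radius `a` about
the centre of the unit square, extended `[0,1]²`-periodically. -/
def fibreChar (a y₂ y₃ : ℝ) : ℝ :=
  if (Int.fract y₂ - 1 / 2) ^ 2 + (Int.fract y₃ - 1 / 2) ^ 2 ≤ a ^ 2 then 1 else 0

/-- The layer `L_k^ε = ℝ² × ((k-1) ε^r, k ε^r)`. -/
def layer (r ε : ℝ) (k : ℤ) : Set (Pt 3) :=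
  {x | ((k : ℝ) - 1) * ε ^ r < x 2 ∧ x 2 < (k : ℝ) * ε ^ r}

/-- Characteristic function of the part of `Ω` that is occupied by fibres:
`χ_Ω(x) ∑_k η(R(γ(p_{k,3})) x / ε) χ_{L_k^ε}(x)`, where `p k` is the point chosen in the
`k`-th layer. -/
def plywoodChar (Ω : Set (Pt 3)) (a : ℝ) (γ : ℝ → ℝ) (r ε : ℝ) (p : ℤ → Pt 3)
    (x : Pt 3) : ℝ :=
  Ω.indicator (fun _ => (1 : ℝ)) x *
    ∑' k : ℤ,
      fibreChar a ((rot (γ (p k 2)) *ᵥ x.ofLp) 1 / ε) ((rot (γ (p k 2)) *ᵥ x.ofLp) 2 / ε) *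
        (layer r ε k).indicator (fun _ => (1 : ℝ)) x

/-- The mixture `E₁ χ + E₂ (1 - χ)`. -/
def mix (E₁ E₂ : Tensor4) (χ : ℝ) : Tensor4 :=
  fun i j k l => E₁ i j k l * χ + E₂ i j k l * (1 - χ)

/-- The elasticity tensor `E^ε` of the plywood structure. -/
def plywoodTensor (Ω : Set (Pt 3)) (a : ℝ) (γ : ℝ → ℝ) (E₁ E₂ : Tensor4) (r ε : ℝ)
    (p : ℤ → Pt 3) (x : Pt 3) : Tensor4 :=
  mix E₁ E₂ (plywoodChar Ω a γ r ε p x)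

/-! ### Cell problems and the homogenized tensor -/

/-- The unit square `Ŷ = [0,1]²`, with coordinates `(y₂, y₃)` written as `(y 0, y 1)`. -/
def unitSquare : Set (Pt 2) := {y | ∀ b, y b ∈ Icc (0 : ℝ) 1}

/-- `w ∈ H¹_per(Ŷ; ℝ³)` with weak gradient `Dw`: `w` is `Ŷ`-periodic, weakly differentiable in
the whole plane, and square integrable over `Ŷ` with its gradient. -/
structure IsH1Per (w : Field3 2) (Dw : Grad3 2) : Prop where
  periodic : ∀ y b, w (y + EuclideanSpace.single b 1) = w y
  memLp : ∀ k, MemLp (fun y => w y k) 2 (volume.restrict unitSquare)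
  memLp_grad : ∀ k b, MemLp (fun y => Dw y k b) 2 (volume.restrict unitSquare)
  weak : ∀ k b, IsWeakPartial univ b (fun y => w y k) (fun y => Dw y k b)

/-- The matrix `R̂`, made of the last two rows of `R(α)`. -/
def rotHat (α : ℝ) : Matrix (Fin 2) (Fin 3) ℝ :=
  !![-Real.sin α, Real.cos α, 0; 0, 0, 1]

/-- The rotated strain `ê^R_{kl}(v) = ((R̂ᵀ ∇v_l)_k + (R̂ᵀ ∇v_k)_l) / 2`, from the value `d` of
the gradient of `v` at a point. -/
def rotStrain (α : ℝ) (d : Fin 3 → Fin 2 → ℝ) : Matrix (Fin 3) (Fin 3) ℝ :=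
  Matrix.of fun k l => (((rotHat α)ᵀ *ᵥ d l) k + ((rotHat α)ᵀ *ᵥ d k) l) / 2

/-- The tensor `Ã(ŷ) = E₁ η(ŷ) + E₂ (1 - η(ŷ))`. -/
def cellTensor (a : ℝ) (E₁ E₂ : Tensor4) (y : Pt 2) : Tensor4 :=
  mix E₁ E₂ (fibreChar a (y 0) (y 1))

/-- The symmetric matrix `l_{ij} = (l_i ⊗ l_j + l_j ⊗ l_i) / 2`. -/
def symUnit (i j : Fin 3) : Matrix (Fin 3) (Fin 3) ℝ :=
  (1 / 2 : ℝ) • (Matrix.single i j 1 + Matrix.single j i 1)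

/-- `w` (with weak gradient `Dw`) is a weak solution of the periodic cell problem
`-∇·(R̂ Ã ê^R(w)) = ∇·(R̂ Ã l_{ij})` in `Ŷ`, at rotation angle `α`. -/
structure IsCellSolution (a : ℝ) (E₁ E₂ : Tensor4) (α : ℝ) (i j : Fin 3)
    (w : Field3 2) (Dw : Grad3 2) : Prop where
  isH1Per : IsH1Per w Dw
  weak : ∀ (v : Field3 2) (Dv : Grad3 2), IsH1Per v Dv →
    ∫ y in unitSquare,
        ddot ((cellTensor a E₁ E₂ y).app (rotStrain α (Dw y))) (rotStrain α (Dv y)) =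
      - ∫ y in unitSquare,
        ddot ((cellTensor a E₁ E₂ y).app (symUnit i j)) (rotStrain α (Dv y))

/-- The homogenized tensor at rotation angle `α`,
`A_{ijkl} = ⨍_Ŷ (Ã_{ijkl} + (Ã ê^R(w_{ij}))_{kl}) dŷ`, where `Dw i j` is the gradient of the
cell solution `w_{ij}`. -/
def homTensor (a : ℝ) (E₁ E₂ : Tensor4) (α : ℝ) (Dw : Fin 3 → Fin 3 → Grad3 2) : Tensor4 :=
  fun i j k l => ⨍ y in unitSquare,
    (cellTensor a E₁ E₂ y i j k l +
      (cellTensor a E₁ E₂ y).app (rotStrain α (Dw i j y)) k l)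

end

/-!
The proof is Tartar's method of oscillating test functions, carried out on each layer separately.
It needs neither compactness in `L²` nor two-scale convergence, only the bound of the solutions in
`H¹` and their weak equation.

**Solvability.** A function and its gradient are stored together as a jet, an element of a finite
product of `L²` spaces. Then `H¹₀(Ω)` is the closure of the jets of test functions
(`zeroTraceJets`), and the periodic fields of mean zero are the jets whose Fourier coefficients
obey `(∂_b w)^(m) = 2π i m_b ŵ(m)` (`cellJets`). Both are closed subspaces, and the weak problems
are Lax–Milgram problems on them (`exists_mem_form_eq`). On `H¹₀(Ω)` coercivity comes from the
inequalities of Korn and Poincaré (`korn_zeroTrace`, `poincare_zeroTrace`). In the cell, Korn's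
inequality for the rotated strain is an inequality between vectors for each Fourier mode, because
the rows of `R̂` are orthonormal (`korn_cell`). Two solutions of a cell problem have the same
gradient, so the homogenized tensor does not depend on the choice (`homTensor_eq_homA`); as a
function `homA` of the angle it is continuous, and it inherits the coercivity of the two materials
(`continuous_homA`, `homA_coercive`).

**One layer.** In a layer the microscopic tensor is the cell tensor at the point `y = R̂x/ε`. Let
`w` be the corrector for the macroscopic strain `l_{ij}`, and `Φ` a test function supported in the
layer. By the symmetry of the tensor, `Φ` times the `(i, j)` component of the microscopic stress
is the product of `Φ`, the cell stress `Ã(l_{ij} + ê(w))` and the microscopic strain, up to the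
integrand of the weak equation for the test function `ε Φ w(y)` and a term of order `ε`
(`stress_eq_corrected`). The cell stress in turn is its mean, which is the homogenized tensor,
plus a sum of plane waves `c e^{iκ·x}` with `κ·c = 0` and `|κ| ≥ 1/ε`. Such a wave is the
divergence of a skew-symmetric field of size `ε`, so that its pairing with a gradient is of order
`ε` after one integration by parts (`sq_mul_integral_wave_grad`, `abs_integral_wave_grad_le`). To
have smooth test functions and finitely many waves, the Fourier series of `w` and of the cell
stress are cut off at a finite set of modes; as the angles form a compact interval, one set serves
all layers up to an error `η` in `L²` (`exists_norm_cellError_le`). The result is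
`exists_layer_estimate`.

**All layers.** A test function `ζ` on `Ω` is multiplied by cutoffs of the layers. Their
derivatives are of order `ε^{-r}`, so the terms of order `ε` add up to `O(ε^{1-r})`; this is where
`r < 1` enters. What the cutoffs omit costs another `η`, and replacing the angle of the layer by
`γ(x₃)` costs the oscillation of `homA ∘ γ` over a layer, which tends to zero because the layers
become thin (`r > 0`). So the difference between the microscopic stress and `A^hom e(u^ε)` tends
to zero in the sense of distributions (`exists_plywood_estimate`, `tendsto_integral_plywood_sub`).

**Conclusion.** By the two weak equations, `∫ A^hom e(u^ε - u) : e(φ) → 0` for every test function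
`φ`. Since `u^ε - u` is bounded in `H¹₀(Ω)` and every functional on `H¹₀(Ω)` is represented
through the transposed form of `A^hom`, this is weak convergence (`tendsto_apply_of_form`,
`weakH1Tendsto_of_tendsto_stress`).
-/

noncomputable section

/-! ### Square integrable jets and the elastic energy -/

/-- A square integrable jet: three values and `3 n` first derivatives, each of them an element of
`L²(μ)`. The index `(k, none)` is the value of the `k`-th component and `(k, some j)` its `j`-th
partial derivative; no relation between values and derivatives is built in. -/
abbrev Jet (n : ℕ) (μ : Measure (Pt n)) : Type :=
  PiLp 2 (fun _ : Fin 3 × Option (Fin n) => Lp ℝ 2 μ)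

/-- The values and the would-be derivatives are square integrable. -/
structure IsL2Jet {n : ℕ} (μ : Measure (Pt n)) (u : Field3 n) (Du : Grad3 n) : Prop where
  memLp : ∀ k, MemLp (fun x => u x k) 2 μ
  memLp_grad : ∀ k j, MemLp (fun x => Du x k j) 2 μ

variable {n : ℕ} {μ : Measure (Pt n)}

/-- The jet of the classes of a pair of square integrable functions. -/
def IsL2Jet.toJet {u : Field3 n} {Du : Grad3 n} (h : IsL2Jet μ u Du) : Jet n μ :=
  WithLp.toLp 2 fun p => match p with
    | (k, none) => (h.memLp k).toLp _
    | (k, some j) => (h.memLp_grad k j).toLp _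

/-- The values of a jet. -/
def Jet.val (z : Jet n μ) : Field3 n := fun x k => z (k, none) x

/-- The derivatives of a jet. -/
def Jet.grad (z : Jet n μ) : Grad3 n := fun x k j => z (k, some j) x

lemma IsL2Jet.toJet_none {u : Field3 n} {Du : Grad3 n} (h : IsL2Jet μ u Du) (k : Fin 3) :
    h.toJet (k, none) = (h.memLp k).toLp _ := rfl

lemma IsL2Jet.toJet_some {u : Field3 n} {Du : Grad3 n} (h : IsL2Jet μ u Du) (k : Fin 3)
    (j : Fin n) : h.toJet (k, some j) = (h.memLp_grad k j).toLp _ := rfl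

lemma IsL2Jet.val_toJet {u : Field3 n} {Du : Grad3 n} (h : IsL2Jet μ u Du) :
    ∀ᵐ x ∂μ, h.toJet.val x = u x := by
  have : ∀ k, ∀ᵐ x ∂μ, h.toJet.val x k = u x k := fun k => (h.memLp k).coeFn_toLp
  filter_upwards [ae_all_iff.2 this] with x hx using funext hx

lemma IsL2Jet.grad_toJet {u : Field3 n} {Du : Grad3 n} (h : IsL2Jet μ u Du) :
    ∀ᵐ x ∂μ, h.toJet.grad x = Du x := by
  have : ∀ k j, ∀ᵐ x ∂μ, h.toJet.grad x k j = Du x k j :=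
    fun k j => (h.memLp_grad k j).coeFn_toLp
  filter_upwards [ae_all_iff.2 fun k => ae_all_iff.2 (this k)] with x hx
  exact funext fun k => funext (hx k)

lemma Jet.isL2Jet (z : Jet n μ) : IsL2Jet μ z.val z.grad :=
  ⟨fun _ => Lp.memLp _, fun _ _ => Lp.memLp _⟩

lemma Jet.toJet_isL2Jet (z : Jet n μ) : z.isL2Jet.toJet = z := by
  ext p : 1
  rcases p with ⟨k, _ | j⟩
  · exact Lp.toLp_coeFn _ (Lp.memLp _)
  · exact Lp.toLp_coeFn _ (Lp.memLp _)

lemma IsL2Jet.toJet_congr {u u' : Field3 n} {Du Du' : Grad3 n} (h : IsL2Jet μ u Du)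
    (h' : IsL2Jet μ u' Du') (hu : ∀ k, ∀ᵐ x ∂μ, u x k = u' x k)
    (hDu : ∀ k j, ∀ᵐ x ∂μ, Du x k j = Du' x k j) : h.toJet = h'.toJet := by
  ext p : 1
  rcases p with ⟨k, _ | j⟩
  · exact MemLp.toLp_congr (h.memLp k) (h'.memLp k) (hu k)
  · exact MemLp.toLp_congr (h.memLp_grad k j) (h'.memLp_grad k j) (hDu k j)

lemma IsL2Jet.add {u u' : Field3 n} {Du Du' : Grad3 n} (h : IsL2Jet μ u Du)
    (h' : IsL2Jet μ u' Du') : IsL2Jet μ (u + u') (Du + Du') :=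
  ⟨fun k => (h.memLp k).add (h'.memLp k), fun k j => (h.memLp_grad k j).add (h'.memLp_grad k j)⟩

lemma IsL2Jet.sub {u u' : Field3 n} {Du Du' : Grad3 n} (h : IsL2Jet μ u Du)
    (h' : IsL2Jet μ u' Du') : IsL2Jet μ (u - u') (Du - Du') :=
  ⟨fun k => (h.memLp k).sub (h'.memLp k), fun k j => (h.memLp_grad k j).sub (h'.memLp_grad k j)⟩

lemma IsL2Jet.smul {u : Field3 n} {Du : Grad3 n} (h : IsL2Jet μ u Du) (c : ℝ) :
    IsL2Jet μ (c • u) (c • Du) :=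
  ⟨fun k => (h.memLp k).const_mul c, fun k j => (h.memLp_grad k j).const_mul c⟩

lemma IsL2Jet.toJet_add {u u' : Field3 n} {Du Du' : Grad3 n} (h : IsL2Jet μ u Du)
    (h' : IsL2Jet μ u' Du') : (h.add h').toJet = h.toJet + h'.toJet := by
  ext p : 1
  rcases p with ⟨k, _ | j⟩
  · exact MemLp.toLp_add (h.memLp k) (h'.memLp k)
  · exact MemLp.toLp_add (h.memLp_grad k j) (h'.memLp_grad k j)

lemma IsL2Jet.toJet_sub {u u' : Field3 n} {Du Du' : Grad3 n} (h : IsL2Jet μ u Du)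
    (h' : IsL2Jet μ u' Du') : (h.sub h').toJet = h.toJet - h'.toJet := by
  ext p : 1
  rcases p with ⟨k, _ | j⟩
  · exact MemLp.toLp_sub (h.memLp k) (h'.memLp k)
  · exact MemLp.toLp_sub (h.memLp_grad k j) (h'.memLp_grad k j)

lemma IsL2Jet.toJet_smul {u : Field3 n} {Du : Grad3 n} (h : IsL2Jet μ u Du) (c : ℝ) :
    (h.smul c).toJet = c • h.toJet := by
  ext p : 1
  rcases p with ⟨k, _ | j⟩
  · exact MemLp.toLp_const_smul c (h.memLp k)
  · exact MemLp.toLp_const_smul c (h.memLp_grad k j)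

variable (μ) in
/-- Multiplication by an essentially bounded function on `L²`, and zero if the function is not
essentially bounded. -/
def mulL (a : Pt n → ℝ) : Lp ℝ 2 μ →L[ℝ] Lp ℝ 2 μ :=
  open Classical in
  if h : MemLp a ⊤ μ then
    (ContinuousLinearMap.mul ℝ ℝ).holderL μ ⊤ 2 2 (h.toLp a)
  else 0

lemma coeFn_mulL {a : Pt n → ℝ} (h : MemLp a ⊤ μ) (f : Lp ℝ 2 μ) :
    mulL μ a f =ᵐ[μ] fun x => a x * f x := by
  rw [mulL, dif_pos h]
  filter_upwards [(ContinuousLinearMap.mul ℝ ℝ).coeFn_holder (r := 2) (h.toLp a) f,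
    h.coeFn_toLp] with x hx hx'
  rw [← hx']
  exact hx

lemma inner_eq_integral_mul (f g : Lp ℝ 2 μ) : inner ℝ f g = ∫ x, f x * g x ∂μ := by
  rw [L2.inner_def]
  exact integral_congr_ae (Eventually.of_forall fun x => mul_comm _ _)

lemma integrable_coeFn_mul (f g : Lp ℝ 2 μ) : Integrable (fun x => f x * g x) μ :=
  (Lp.memLp f).integrable_mul (Lp.memLp g)

lemma norm_sq_eq_integral (f : Lp ℝ 2 μ) : ‖f‖ ^ 2 = ∫ x, f x ^ 2 ∂μ := by
  rw [← real_inner_self_eq_norm_sq, inner_eq_integral_mul]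
  simp only [sq]

lemma norm_toLp_sq {f : Pt n → ℝ} (h : MemLp f 2 μ) : ‖h.toLp f‖ ^ 2 = ∫ x, f x ^ 2 ∂μ := by
  rw [norm_sq_eq_integral]
  refine integral_congr_ae ?_
  filter_upwards [h.coeFn_toLp] with x hx
  rw [hx]

variable (μ) in
/-- The component `(k, l)` of the symmetric part of the matrix `d R`, where `d` is the gradient
part of a jet. For `R = 1` this is the strain and for `R = rotHat α` the rotated strain. -/
def strainL (R : Matrix (Fin n) (Fin 3) ℝ) (k l : Fin 3) : Jet n μ →L[ℝ] Lp ℝ 2 μ :=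
  ∑ b, (1 / 2 : ℝ) • (R b l • PiLp.proj 2 (fun _ : Fin 3 × Option (Fin n) => Lp ℝ 2 μ) (k, some b)
    + R b k • PiLp.proj 2 (fun _ : Fin 3 × Option (Fin n) => Lp ℝ 2 μ) (l, some b))

lemma strainL_apply (R : Matrix (Fin n) (Fin 3) ℝ) (k l : Fin 3) (z : Jet n μ) :
    strainL μ R k l z =
      ∑ b, (1 / 2 : ℝ) • (R b l • z (k, some b) + R b k • z (l, some b)) := by
  simp [strainL]

lemma coeFn_finsetSum {ι : Type*} (s : Finset ι) (f : ι → Lp ℝ 2 μ) :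
    ((∑ i ∈ s, f i : Lp ℝ 2 μ) : Pt n → ℝ) =ᵐ[μ] fun x => ∑ i ∈ s, f i x := by
  classical
  induction s using Finset.induction_on with
  | empty =>
    filter_upwards [Lp.coeFn_zero ℝ 2 μ] with x hx
    simpa using hx
  | insert i s hi ih =>
    simp only [Finset.sum_insert hi]
    filter_upwards [Lp.coeFn_add (f i) (∑ i ∈ s, f i), ih] with x hx hx'
    rw [hx, Pi.add_apply, hx']

lemma coeFn_strainL (R : Matrix (Fin n) (Fin 3) ℝ) (k l : Fin 3) (z : Jet n μ) :
    strainL μ R k l z =ᵐ[μ] fun x => strain (fun i => Rᵀ *ᵥ z.grad x i) k l := by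
  rw [strainL_apply]
  refine (coeFn_finsetSum _ _).trans ?_
  have : ∀ b : Fin n, ∀ᵐ x ∂μ,
      ((1 / 2 : ℝ) • (R b l • z (k, some b) + R b k • z (l, some b)) : Lp ℝ 2 μ) x =
        (R b l * z.grad x k b + R b k * z.grad x l b) / 2 := by
    intro b
    filter_upwards [Lp.coeFn_smul (1 / 2 : ℝ) (R b l • z (k, some b) + R b k • z (l, some b)),
      Lp.coeFn_add (R b l • z (k, some b)) (R b k • z (l, some b)),
      Lp.coeFn_smul (R b l) (z (k, some b)), Lp.coeFn_smul (R b k) (z (l, some b))]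
      with x h1 h2 h3 h4
    rw [h1, Pi.smul_apply, h2, Pi.add_apply, h3, h4]
    simp only [Pi.smul_apply, smul_eq_mul, Jet.grad]
    ring
  filter_upwards [ae_all_iff.2 this] with x hx
  rw [Finset.sum_congr rfl fun b _ => hx b]
  simp only [strain, Matrix.of_apply, Matrix.mulVec, dotProduct, Matrix.transpose_apply]
  rw [← Finset.sum_add_distrib, Finset.sum_div]

lemma strainL_comm (R : Matrix (Fin n) (Fin 3) ℝ) (k l : Fin 3) :
    strainL μ R k l = strainL μ R l k := by
  simp only [strainL, add_comm]

/-- All entries of the tensor field are essentially bounded. -/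
def IsBddTensor (μ : Measure (Pt n)) (C : Pt n → Tensor4) : Prop :=
  ∀ i j k l, MemLp (fun x => C x i j k l) ⊤ μ

variable (μ) in
/-- The elastic energy form `(u, v) ↦ ∫ C e(u) : e(v)`, with the strain `e` belonging to `R`. -/
def elForm (C : Pt n → Tensor4) (R : Matrix (Fin n) (Fin 3) ℝ) : Jet n μ →L[ℝ] Jet n μ →L[ℝ] ℝ :=
  ∑ i, ∑ j, ∑ k, ∑ l, (innerSL ℝ : Lp ℝ 2 μ →L[ℝ] Lp ℝ 2 μ →L[ℝ] ℝ).bilinearComp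
    (mulL μ (fun x => C x i j k l) ∘L strainL μ R k l) (strainL μ R i j)

lemma elForm_apply (C : Pt n → Tensor4) (R : Matrix (Fin n) (Fin 3) ℝ) (z z' : Jet n μ) :
    elForm μ C R z z' = ∑ i, ∑ j, ∑ k, ∑ l,
      inner ℝ (mulL μ (fun x => C x i j k l) (strainL μ R k l z)) (strainL μ R i j z') := by
  simp [elForm]

lemma inner_mulL {a : Pt n → ℝ} (h : MemLp a ⊤ μ) (f g : Lp ℝ 2 μ) :
    inner ℝ (mulL μ a f) g = ∫ x, a x * f x * g x ∂μ := by
  rw [inner_eq_integral_mul]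
  refine integral_congr_ae ?_
  filter_upwards [coeFn_mulL h f] with x hx
  rw [hx]

lemma integrable_mulL {a : Pt n → ℝ} (h : MemLp a ⊤ μ) (f g : Lp ℝ 2 μ) :
    Integrable (fun x => a x * f x * g x) μ := by
  refine (integrable_coeFn_mul (mulL μ a f) g).congr ?_
  filter_upwards [coeFn_mulL h f] with x hx
  rw [hx]

/-- The form `∑ ∫ C_{ijkl} η_{kl} ζ_{ij}` on matrices of square integrable functions. -/
lemma sum_inner_mulL_eq_integral {C : Pt n → Tensor4} (hC : IsBddTensor μ C)
    (η ζ : Fin 3 → Fin 3 → Lp ℝ 2 μ) :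
    Integrable (fun x => ddot ((C x).app (Matrix.of fun k l => η k l x))
      (Matrix.of fun k l => ζ k l x)) μ ∧
    ∑ i, ∑ j, ∑ k, ∑ l, inner ℝ (mulL μ (fun x => C x i j k l) (η k l)) (ζ i j) =
      ∫ x, ddot ((C x).app (Matrix.of fun k l => η k l x)) (Matrix.of fun k l => ζ k l x) ∂μ := by
  have key : (fun x => ddot ((C x).app (Matrix.of fun k l => η k l x))
      (Matrix.of fun k l => ζ k l x)) = fun x => ∑ i, ∑ j, ∑ k, ∑ l,
        C x i j k l * η k l x * ζ i j x := by
    funext x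
    simp only [ddot, Tensor4.app, Matrix.of_apply, Finset.sum_mul]
  have hi : ∀ i j k l, Integrable
      (fun x => C x i j k l * η k l x * ζ i j x) μ :=
    fun i j k l => integrable_mulL (hC i j k l) _ _
  rw [key]
  refine ⟨integrable_finsetSum _ fun i _ => integrable_finsetSum _ fun j _ =>
    integrable_finsetSum _ fun k _ => integrable_finsetSum _ fun l _ => hi i j k l, ?_⟩
  rw [integral_finsetSum _ fun i _ => integrable_finsetSum _ fun j _ =>
    integrable_finsetSum _ fun k _ => integrable_finsetSum _ fun l _ => hi i j k l]
  refine Finset.sum_congr rfl fun i _ => ?_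
  rw [integral_finsetSum _ fun j _ =>
    integrable_finsetSum _ fun k _ => integrable_finsetSum _ fun l _ => hi i j k l]
  refine Finset.sum_congr rfl fun j _ => ?_
  rw [integral_finsetSum _ fun k _ => integrable_finsetSum _ fun l _ => hi i j k l]
  refine Finset.sum_congr rfl fun k _ => ?_
  rw [integral_finsetSum _ fun l _ => hi i j k l]
  exact Finset.sum_congr rfl fun l _ => inner_mulL (hC i j k l) _ _

lemma ae_strainL_eq (R : Matrix (Fin n) (Fin 3) ℝ) {u : Field3 n} {Du : Grad3 n}
    (h : IsL2Jet μ u Du) :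
    ∀ᵐ x ∂μ, (Matrix.of fun k l => strainL μ R k l h.toJet x) =
      strain (fun i => Rᵀ *ᵥ Du x i) := by
  filter_upwards [ae_all_iff.2 fun k => ae_all_iff.2 fun l => coeFn_strainL R k l h.toJet,
    h.grad_toJet] with x hx hx'
  ext k l
  rw [Matrix.of_apply, hx k l, hx']

lemma elForm_toJet {C : Pt n → Tensor4} (hC : IsBddTensor μ C)
    (R : Matrix (Fin n) (Fin 3) ℝ) {u u' : Field3 n} {Du Du' : Grad3 n}
    (h : IsL2Jet μ u Du) (h' : IsL2Jet μ u' Du') :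
    elForm μ C R h.toJet h'.toJet = ∫ x, ddot ((C x).app (strain fun i => Rᵀ *ᵥ Du x i))
      (strain fun i => Rᵀ *ᵥ Du' x i) ∂μ := by
  rw [elForm_apply, (sum_inner_mulL_eq_integral hC _ _).2]
  refine integral_congr_ae ?_
  filter_upwards [ae_strainL_eq R h, ae_strainL_eq R h'] with x hx hx'
  rw [hx, hx']

/-- A pointwise lower bound of the tensor on symmetric matrices is inherited by the integrated
form. -/
lemma le_sum_inner_mulL {C : Pt n → Tensor4} (hC : IsBddTensor μ C) {c : ℝ}
    (hc : ∀ᵐ x ∂μ, ∀ ξ : Matrix (Fin 3) (Fin 3) ℝ, ξ.IsSymm →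
      c * ddot ξ ξ ≤ ddot ((C x).app ξ) ξ)
    {η : Fin 3 → Fin 3 → Lp ℝ 2 μ} (hη : ∀ k l, η k l = η l k) :
    c * ∑ k, ∑ l, ‖η k l‖ ^ 2 ≤
      ∑ i, ∑ j, ∑ k, ∑ l, inner ℝ (mulL μ (fun x => C x i j k l) (η k l)) (η i j) := by
  obtain ⟨hint, heq⟩ := sum_inner_mulL_eq_integral hC η η
  rw [heq]
  have hi : ∀ k l, Integrable (fun x => η k l x ^ 2) μ := fun k l =>
    (Lp.memLp _).integrable_sq
  have h1 : c * ∑ k, ∑ l, ‖η k l‖ ^ 2 =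
      ∫ x, c * ddot (Matrix.of fun k l => η k l x) (Matrix.of fun k l => η k l x) ∂μ := by
    rw [integral_const_mul]
    congr 1
    simp only [ddot, Matrix.of_apply, ← sq]
    rw [integral_finsetSum _ fun k _ => integrable_finsetSum _ fun l _ => hi k l]
    refine Finset.sum_congr rfl fun k _ => ?_
    rw [integral_finsetSum _ fun l _ => hi k l]
    exact Finset.sum_congr rfl fun l _ => norm_sq_eq_integral _
  rw [h1]
  refine integral_mono_ae ?_ hint ?_
  · refine Integrable.const_mul ?_ c
    simp only [ddot, Matrix.of_apply, ← sq]
    exact integrable_finsetSum _ fun k _ => integrable_finsetSum _ fun l _ => hi k l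
  · filter_upwards [hc] with x hx
    refine hx _ ?_
    ext k l
    exact congrArg (fun f : Lp ℝ 2 μ => f x) (hη l k)

lemma le_elForm_self {C : Pt n → Tensor4} (hC : IsBddTensor μ C) {c : ℝ}
    (hc : ∀ᵐ x ∂μ, ∀ ξ : Matrix (Fin 3) (Fin 3) ℝ, ξ.IsSymm →
      c * ddot ξ ξ ≤ ddot ((C x).app ξ) ξ)
    (R : Matrix (Fin n) (Fin 3) ℝ) (z : Jet n μ) :
    c * ∑ k, ∑ l, ‖strainL μ R k l z‖ ^ 2 ≤ elForm μ C R z z := by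
  rw [elForm_apply]
  exact le_sum_inner_mulL hC hc fun k l => by rw [strainL_comm]

lemma Jet.norm_sq (z : Jet n μ) :
    ‖z‖ ^ 2 = ∑ k, (‖z (k, none)‖ ^ 2 + ∑ j, ‖z (k, some j)‖ ^ 2) := by
  rw [PiLp.norm_sq_eq_of_L2, Fintype.sum_prod_type]
  simp [Fintype.sum_option]

/-- The Lax–Milgram theorem on a closed subspace, for a form given on the whole space. -/
lemma exists_mem_form_eq {H : Type*} [NormedAddCommGroup H] [InnerProductSpace ℝ H]
    [CompleteSpace H] (V : Submodule ℝ H) (hV : IsClosed (V : Set H)) (B : H →L[ℝ] H →L[ℝ] ℝ)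
    {c : ℝ} (hc : 0 < c) (hB : ∀ v ∈ V, c * ‖v‖ ^ 2 ≤ B v v) (F : H →L[ℝ] ℝ) :
    ∃ z ∈ V, ∀ v ∈ V, B z v = F v := by
  have : CompleteSpace V := hV.completeSpace_coe
  let B' : V →L[ℝ] V →L[ℝ] ℝ := B.bilinearComp V.subtypeL V.subtypeL
  have hB' : IsCoercive B' := ⟨c, hc, fun v => by
    have := hB v v.2
    rw [sq, ← mul_assoc] at this
    simpa [B'] using this⟩
  let f : V := (InnerProductSpace.toDual ℝ V).symm (F ∘L V.subtypeL)
  refine ⟨hB'.continuousLinearEquivOfBilin.symm f, Subtype.coe_prop _, fun v hv => ?_⟩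
  have h1 := hB'.continuousLinearEquivOfBilin_apply
    (hB'.continuousLinearEquivOfBilin.symm f) ⟨v, hv⟩
  rw [ContinuousLinearEquiv.apply_symm_apply, InnerProductSpace.toDual_symm_apply] at h1
  simpa [B'] using h1.symm

end

noncomputable section

/-! ### Test functions and weak derivatives -/

variable {n : ℕ} {Ω : Set (Pt n)}

lemma hasFDerivAt_of_contDiff {f : Pt n → ℝ} (hf : ContDiff ℝ ∞ f) (x : Pt n) :
    DifferentiableAt ℝ f x :=
  (hf.differentiable (by simp)) x

lemma contDiff_pderiv {f : Pt n → ℝ} (hf : ContDiff ℝ ∞ f) (j : Fin n) :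
    ContDiff ℝ ∞ (pderiv j f) := by
  unfold pderiv
  exact (hf.fderiv_right (m := ∞) (by simp)).clm_apply contDiff_const

lemma pderiv_mul {f g : Pt n → ℝ} (hf : ContDiff ℝ ∞ f) (hg : ContDiff ℝ ∞ g) (j : Fin n)
    (x : Pt n) : pderiv j (fun y => f y * g y) x = pderiv j f x * g x + f x * pderiv j g x := by
  unfold pderiv
  rw [fderiv_fun_mul (hasFDerivAt_of_contDiff hf x) (hasFDerivAt_of_contDiff hg x)]
  simp only [_root_.add_apply, _root_.smul_apply, smul_eq_mul]
  ring

lemma pderiv_add {f g : Pt n → ℝ} (hf : ContDiff ℝ ∞ f) (hg : ContDiff ℝ ∞ g) (j : Fin n)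
    (x : Pt n) : pderiv j (fun y => f y + g y) x = pderiv j f x + pderiv j g x := by
  unfold pderiv
  rw [fderiv_fun_add (hasFDerivAt_of_contDiff hf x) (hasFDerivAt_of_contDiff hg x)]
  rfl

lemma pderiv_const_mul {f : Pt n → ℝ} (hf : ContDiff ℝ ∞ f) (c : ℝ) (j : Fin n)
    (x : Pt n) : pderiv j (fun y => c * f y) x = c * pderiv j f x := by
  unfold pderiv
  rw [fderiv_const_mul (hasFDerivAt_of_contDiff hf x)]
  rfl

lemma pderiv_finsetSum {ι : Type*} (s : Finset ι) {f : ι → Pt n → ℝ}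
    (hf : ∀ i ∈ s, ContDiff ℝ ∞ (f i)) (j : Fin n) (x : Pt n) :
    pderiv j (fun y => ∑ i ∈ s, f i y) x = ∑ i ∈ s, pderiv j (f i) x := by
  unfold pderiv
  rw [fderiv_fun_sum fun i hi => hasFDerivAt_of_contDiff (hf i hi) x]
  simp

lemma pderiv_pderiv_comm {f : Pt n → ℝ} (hf : ContDiff ℝ ∞ f) (i j : Fin n) (x : Pt n) :
    pderiv i (pderiv j f) x = pderiv j (pderiv i f) x := by
  have hs : IsSymmSndFDerivAt ℝ f x :=
    (contDiff_infty.1 hf 2).contDiffAt.isSymmSndFDerivAt (by simp)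
  have hd : DifferentiableAt ℝ (fderiv ℝ f) x :=
    ((hf.fderiv_right (m := ∞) (by simp)).differentiable (by simp)) x
  have key : ∀ a b : Fin n, pderiv a (pderiv b f) x =
      fderiv ℝ (fderiv ℝ f) x (EuclideanSpace.single a 1) (EuclideanSpace.single b 1) := by
    intro a b
    unfold pderiv
    rw [fderiv_clm_apply hd (differentiableAt_const _)]
    simp
  rw [key, key]
  exact hs _ _

lemma IsTestFunction.add {f g : Pt n → ℝ} (hf : IsTestFunction Ω f) (hg : IsTestFunction Ω g) :
    IsTestFunction Ω (fun x => f x + g x) :=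
  ⟨hf.smooth.add hg.smooth, hf.compact.add hg.compact,
    (tsupport_add f g).trans (union_subset hf.support hg.support)⟩

lemma IsTestFunction.mul_right {f g : Pt n → ℝ} (hf : IsTestFunction Ω f)
    (hg : ContDiff ℝ ∞ g) : IsTestFunction Ω (fun x => f x * g x) :=
  ⟨hf.smooth.mul hg, hf.compact.mul_right, (tsupport_mul_subset_left).trans hf.support⟩

lemma IsTestFunction.const_mul {f : Pt n → ℝ} (hf : IsTestFunction Ω f) (c : ℝ) :
    IsTestFunction Ω (fun x => c * f x) := by
  simpa only [mul_comm] using hf.mul_right (contDiff_const (c := c))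

lemma IsTestFunction.zero : IsTestFunction Ω (fun _ => (0 : ℝ)) :=
  ⟨contDiff_const, HasCompactSupport.zero, by simp [tsupport]⟩

lemma IsTestFunction.pderiv {f : Pt n → ℝ} (hf : IsTestFunction Ω f) (j : Fin n) :
    IsTestFunction Ω (pderiv j f) := by
  have hs : tsupport (_root_.pderiv j f) ⊆ tsupport f := by
    refine closure_minimal (fun x hx => ?_) (isClosed_tsupport f)
    refine support_fderiv_subset ℝ (f := f) fun h => hx ?_
    simp [_root_.pderiv, h]
  exact ⟨contDiff_pderiv hf.smooth j, hf.compact.of_isClosed_subset (isClosed_tsupport _) hs,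
    hs.trans hf.support⟩

lemma IsTestFunction.continuous {f : Pt n → ℝ} (hf : IsTestFunction Ω f) : Continuous f :=
  hf.smooth.continuous

lemma IsTestFunction.memLp {f : Pt n → ℝ} (hf : IsTestFunction Ω f) (p : ENNReal)
    (s : Set (Pt n)) : MemLp f p (volume.restrict s) :=
  (hf.continuous.memLp_of_hasCompactSupport hf.compact).restrict s

lemma IsTestFunction.eq_zero {f : Pt n → ℝ} (hf : IsTestFunction Ω f) {x : Pt n} (hx : x ∉ Ω) :
    f x = 0 :=
  image_eq_zero_of_notMem_tsupport fun h => hx (hf.support h)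

lemma IsTestFunction.exists_bound {f : Pt n → ℝ} (hf : IsTestFunction Ω f) :
    ∃ C, 0 ≤ C ∧ ∀ x, |f x| ≤ C := by
  obtain ⟨C, hC⟩ := hf.compact.exists_bound_of_continuous hf.continuous
  exact ⟨C, (abs_nonneg _).trans (hC 0), hC⟩

/-- A smooth function is weakly differentiable and its weak derivative is the classical one. -/
lemma isWeakPartial_of_contDiff {f : Pt n → ℝ} (hf : ContDiff ℝ ∞ f) (j : Fin n) :
    IsWeakPartial Ω j f (pderiv j f) where
  locInt := hf.continuous.locallyIntegrable.locallyIntegrableOn _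
  locInt' := (contDiff_pderiv hf j).continuous.locallyIntegrable.locallyIntegrableOn _
  byParts := fun φ hφ => by
    have hc := (contDiff_pderiv hf j).continuous
    rw [setIntegral_eq_integral_of_forall_compl_eq_zero fun x hx => by
        rw [(hφ.pderiv j).eq_zero hx, mul_zero],
      setIntegral_eq_integral_of_forall_compl_eq_zero fun x hx => by
        rw [hφ.eq_zero hx, mul_zero]]
    exact integral_mul_fderiv_eq_neg_fderiv_mul_of_integrable
      ((hc.mul hφ.continuous).integrable_of_hasCompactSupport hφ.compact.mul_left)
      ((hf.continuous.mul (hφ.pderiv j).continuous).integrable_of_hasCompactSupport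
        (hφ.pderiv j).compact.mul_left)
      ((hf.continuous.mul hφ.continuous).integrable_of_hasCompactSupport hφ.compact.mul_left)
      (fun x _ => hasFDerivAt_of_contDiff hf x)
      (fun x _ => hasFDerivAt_of_contDiff hφ.smooth x)

lemma memLp_two_locallyIntegrableOn (hΩ : IsOpen Ω) {f : Pt n → ℝ}
    (hf : MemLp f 2 (volume.restrict Ω)) : LocallyIntegrableOn f Ω volume := by
  refine (locallyIntegrableOn_iff hΩ.isLocallyClosed).2 fun K hK hKc => ?_
  have : IsFiniteMeasure (volume.restrict K) := ⟨by simpa using hKc.measure_lt_top⟩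
  exact (hf.mono_measure (Measure.restrict_mono hK le_rfl)).integrable (by norm_num)

/-- Two weak derivatives can be exchanged between a function and a test function. -/
lemma IsWeakPartial.integral_comm {i j : Fin n} {v vi vj : Pt n → ℝ}
    (hi : IsWeakPartial Ω i v vi) (hj : IsWeakPartial Ω j v vj) {φ : Pt n → ℝ}
    (hφ : IsTestFunction Ω φ) :
    ∫ x in Ω, vi x * pderiv j φ x = ∫ x in Ω, vj x * pderiv i φ x := by
  have h1 := hi.byParts _ (hφ.pderiv j)
  have h2 := hj.byParts _ (hφ.pderiv i)
  rw [← neg_inj, ← h1, ← h2]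
  exact integral_congr_ae (Eventually.of_forall fun x => by
    simp only [pderiv_pderiv_comm hφ.smooth i j])

/-! ### Plane waves -/

/-- The real plane wave `Re (c e^{i κ·x})`. -/
def wave (c : ℂ) (κ : Fin n → ℝ) (x : Pt n) : ℝ :=
  (c * Complex.exp (Complex.I * ((∑ i, κ i * x i : ℝ) : ℂ))).re

lemma wave_eq (c : ℂ) (κ : Fin n → ℝ) (x : Pt n) :
    wave c κ x = c.re * Real.cos (∑ i, κ i * x i) - c.im * Real.sin (∑ i, κ i * x i) := by
  rw [wave]
  generalize ∑ i, κ i * x i = t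
  rw [mul_comm Complex.I, Complex.exp_mul_I, ← Complex.ofReal_cos, ← Complex.ofReal_sin]
  simp [Complex.cos_ofReal_re, Complex.sin_ofReal_re]

lemma abs_wave_le (c : ℂ) (κ : Fin n → ℝ) (x : Pt n) : |wave c κ x| ≤ ‖c‖ := by
  refine (Complex.abs_re_le_norm _).trans ?_
  rw [norm_mul, mul_comm Complex.I, Complex.norm_exp_ofReal_mul_I, mul_one]

lemma contDiff_wave (c : ℂ) (κ : Fin n → ℝ) : ContDiff ℝ ∞ (wave c κ) := by
  have : wave c κ = fun x : Pt n =>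
      c.re * Real.cos (∑ i, κ i * x i) - c.im * Real.sin (∑ i, κ i * x i) :=
    funext fun x => wave_eq c κ x
  rw [this]
  fun_prop

lemma wave_real_mul (a : ℝ) (c : ℂ) (κ : Fin n → ℝ) (x : Pt n) :
    wave (a * c) κ x = a * wave c κ x := by
  simp only [wave_eq, Complex.re_ofReal_mul, Complex.im_ofReal_mul]; ring

lemma wave_zero (κ : Fin n → ℝ) (x : Pt n) : wave 0 κ x = 0 := by
  simp [wave]

lemma wave_sum {ι : Type*} (s : Finset ι) (c : ι → ℂ) (κ : Fin n → ℝ) (x : Pt n) :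
    wave (∑ i ∈ s, c i) κ x = ∑ i ∈ s, wave (c i) κ x := by
  simp only [wave, Finset.sum_mul, Complex.re_sum]

lemma pderiv_wave (c : ℂ) (κ : Fin n → ℝ) (j : Fin n) (x : Pt n) :
    pderiv j (wave c κ) x = wave (κ j * (Complex.I * c)) κ x := by
  have hL : HasFDerivAt (fun x : Pt n => ∑ i, κ i * x i)
      (∑ i, κ i • (EuclideanSpace.proj i : Pt n →L[ℝ] ℝ)) x :=
    HasFDerivAt.fun_sum fun i _ => by
      simpa using ((EuclideanSpace.proj i : Pt n →L[ℝ] ℝ).hasFDerivAt (x := x)).const_mul (κ i)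
  have hw : wave c κ = fun x : Pt n =>
      c.re * Real.cos (∑ i, κ i * x i) - c.im * Real.sin (∑ i, κ i * x i) :=
    funext fun x => wave_eq c κ x
  have h := (hL.cos.const_mul c.re).sub (hL.sin.const_mul c.im)
  have h' : fderiv ℝ (fun x : Pt n =>
      c.re * Real.cos (∑ i, κ i * x i) - c.im * Real.sin (∑ i, κ i * x i)) x = _ := h.fderiv
  rw [pderiv, hw, h', wave_real_mul, wave_eq]
  simp
  ring

/-- Oscillating fluxes `Re (c e^{iκ·x})` with `c · κ = 0` are divergence free, and against a
gradient and a cutoff `Φ` they are of order `1 / |κ|`. The flux is the divergence of the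
skew-symmetric field with entries `(s_q κ_m - s_m κ_q) / |κ|²`, where `s_q = Re (-i c_q e^{iκ·x})`,
and the double divergence of a skew-symmetric field vanishes. -/
lemma sq_mul_integral_wave_grad {c : Fin n → ℂ} {κ : Fin n → ℝ} (hc : ∑ q, (κ q : ℂ) * c q = 0)
    {v : Pt n → ℝ} {Dv : Pt n → Fin n → ℝ}
    (hv : ∀ q, IsWeakPartial Ω q v (fun x => Dv x q))
    (hDv : ∀ q, MemLp (fun x => Dv x q) 2 (volume.restrict Ω))
    {Φ : Pt n → ℝ} (hΦ : IsTestFunction Ω Φ) :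
    (∑ m, κ m ^ 2) * ∫ x in Ω, Φ x * ∑ q, wave (c q) κ x * Dv x q =
      ∑ q, ∑ m, κ m * ∫ x in Ω, wave (-Complex.I * c q) κ x *
        (pderiv q Φ x * Dv x m - pderiv m Φ x * Dv x q) := by
  set s : Fin n → Pt n → ℝ := fun q => wave (-Complex.I * c q) κ with hs
  have hsc : ∀ q, ContDiff ℝ ∞ (s q) := fun q => contDiff_wave _ _
  have hint : ∀ (f : Pt n → ℝ), IsTestFunction Ω f → ∀ q,
      Integrable (fun x => f x * Dv x q) (volume.restrict Ω) := fun f hf q =>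
    (hf.memLp 2 Ω).integrable_mul (hDv q)
  have hds : ∀ q m x, pderiv m (s q) x = κ m * wave (c q) κ x := by
    intro q m x
    rw [hs, pderiv_wave, wave_real_mul]
    congr 2
    rw [← mul_assoc, mul_neg, Complex.I_mul_I]; ring
  have hdiv : ∀ x, ∑ q, pderiv q (s q) x = 0 := by
    intro x
    simp only [hds]
    simp only [← wave_real_mul]
    rw [← wave_sum, hc, wave_zero]
  have hP : ∀ q, IsTestFunction Ω (fun x => Φ x * s q x) := fun q => hΦ.mul_right (hsc q)
  have hdP : ∀ q m x, pderiv m (fun x => Φ x * s q x) x =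
      pderiv m Φ x * s q x + Φ x * pderiv m (s q) x := fun q m x =>
    pderiv_mul hΦ.smooth (hsc q) m x
  have hi1 : ∀ q m r, Integrable (fun x => pderiv m Φ x * s q x * Dv x r)
      (volume.restrict Ω) := fun q m r => hint _ ((hΦ.pderiv m).mul_right (hsc q)) r
  have hi2 : ∀ q m r, Integrable (fun x => Φ x * pderiv m (s q) x * Dv x r)
      (volume.restrict Ω) := fun q m r => hint _ (hΦ.mul_right (contDiff_pderiv (hsc q) m)) r
  -- exchange of the two derivatives of the product `Φ s_q`
  have hcomm : ∀ q m, (∫ x in Ω, pderiv q Φ x * s q x * Dv x m) +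
      ∫ x in Ω, Φ x * pderiv q (s q) x * Dv x m =
      (∫ x in Ω, pderiv m Φ x * s q x * Dv x q) +
      ∫ x in Ω, Φ x * pderiv m (s q) x * Dv x q := by
    intro q m
    rw [← integral_add (hi1 _ _ _) (hi2 _ _ _), ← integral_add (hi1 _ _ _) (hi2 _ _ _)]
    have := (hv m).integral_comm (hv q) (hP q)
    simp only [hdP] at this
    convert this using 2 <;> · funext x; ring
  have hzero : ∀ m, ∑ q, ∫ x in Ω, Φ x * pderiv q (s q) x * Dv x m = 0 := by
    intro m
    rw [← integral_finsetSum _ fun q _ => hi2 q q m]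
    rw [← integral_zero (Pt n) ℝ (μ := volume.restrict Ω)]
    refine integral_congr_ae (Eventually.of_forall fun x => ?_)
    simp only [← Finset.sum_mul, ← Finset.mul_sum, hdiv, mul_zero, zero_mul]
  have hL : (∑ m, κ m ^ 2) * ∫ x in Ω, Φ x * ∑ q, wave (c q) κ x * Dv x q =
      ∑ q, ∑ m, κ m * ∫ x in Ω, Φ x * pderiv m (s q) x * Dv x q := by
    have hi3 : ∀ q, Integrable (fun x => Φ x * wave (c q) κ x * Dv x q) (volume.restrict Ω) :=
      fun q => hint _ (hΦ.mul_right (contDiff_wave _ _)) q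
    have : ∫ x in Ω, Φ x * ∑ q, wave (c q) κ x * Dv x q =
        ∑ q, ∫ x in Ω, Φ x * wave (c q) κ x * Dv x q := by
      rw [← integral_finsetSum _ fun q _ => hi3 q]
      simp only [Finset.mul_sum, mul_assoc]
    rw [this, Finset.mul_sum]
    refine Finset.sum_congr rfl fun q _ => ?_
    rw [Finset.sum_mul]
    refine Finset.sum_congr rfl fun m _ => ?_
    simp only [hds]
    rw [sq, mul_assoc, ← integral_const_mul]
    congr 2
    funext x; ring
  have hR : ∀ q m, ∫ x in Ω, wave (-Complex.I * c q) κ x *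
        (pderiv q Φ x * Dv x m - pderiv m Φ x * Dv x q) =
      (∫ x in Ω, Φ x * pderiv m (s q) x * Dv x q) -
        ∫ x in Ω, Φ x * pderiv q (s q) x * Dv x m := by
    intro q m
    have h1 : ∫ x in Ω, wave (-Complex.I * c q) κ x *
        (pderiv q Φ x * Dv x m - pderiv m Φ x * Dv x q) =
      (∫ x in Ω, pderiv q Φ x * s q x * Dv x m) - ∫ x in Ω, pderiv m Φ x * s q x * Dv x q := by
      rw [← integral_sub (hi1 _ _ _) (hi1 _ _ _)]
      congr 1
      funext x
      simp only [hs]; ring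
    rw [h1]
    linarith [hcomm q m]
  rw [hL]
  simp only [hR]
  simp only [mul_sub, Finset.sum_sub_distrib]
  rw [Finset.sum_comm (f := fun q m => κ m * ∫ x in Ω, Φ x * pderiv q (s q) x * Dv x m)]
  simp only [← Finset.mul_sum, hzero, mul_zero, Finset.sum_const_zero, sub_zero]

end

noncomputable section

/-! ### The space `H¹₀` as a closed space of jets -/

variable {n : ℕ} {Ω : Set (Pt n)}

lemma inner_toLp {μ : Measure (Pt n)} {f g : Pt n → ℝ} (hf : MemLp f 2 μ) (hg : MemLp g 2 μ) :
    inner ℝ (hf.toLp f) (hg.toLp g) = ∫ x, f x * g x ∂μ := by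
  rw [inner_eq_integral_mul]
  refine integral_congr_ae ?_
  filter_upwards [hf.coeFn_toLp, hg.coeFn_toLp] with x h1 h2
  rw [h1, h2]

/-- The classical gradient. -/
def gradOf (φ : Field3 n) : Grad3 n := fun x k j => pderiv j (fun z => φ z k) x

lemma isL2Jet_of_test {φ : Field3 n} (hφ : ∀ k, IsTestFunction Ω (fun x => φ x k)) :
    IsL2Jet (volume.restrict Ω) φ (gradOf φ) :=
  ⟨fun k => (hφ k).memLp 2 Ω, fun k j => ((hφ k).pderiv j).memLp 2 Ω⟩

lemma IsH1.isL2Jet {u : Field3 n} {Du : Grad3 n} (h : IsH1 Ω u Du) :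
    IsL2Jet (volume.restrict Ω) u Du := ⟨h.memLp, h.memLp_grad⟩

lemma isH1_of_test {φ : Field3 n} (hφ : ∀ k, IsTestFunction Ω (fun x => φ x k)) :
    IsH1 Ω φ (gradOf φ) :=
  ⟨(isL2Jet_of_test hφ).memLp, (isL2Jet_of_test hφ).memLp_grad,
    fun k j => isWeakPartial_of_contDiff (hφ k).smooth j⟩

/-- Weak differentiability is a family of continuous linear conditions on the jet. -/
lemma isH1_iff_inner (hΩ : IsOpen Ω) {u : Field3 n} {Du : Grad3 n}
    (h : IsL2Jet (volume.restrict Ω) u Du) :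
    IsH1 Ω u Du ↔ ∀ k j (φ : Pt n → ℝ) (hφ : IsTestFunction Ω φ),
      inner ℝ (h.toJet (k, none)) (((hφ.pderiv j).memLp 2 Ω).toLp _) +
        inner ℝ (h.toJet (k, some j)) ((hφ.memLp 2 Ω).toLp _) = 0 := by
  simp only [h.toJet_none, h.toJet_some, inner_toLp]
  refine ⟨fun H k j φ hφ => ?_, fun H => ⟨h.memLp, h.memLp_grad, fun k j =>
    ⟨memLp_two_locallyIntegrableOn hΩ (h.memLp k),
      memLp_two_locallyIntegrableOn hΩ (h.memLp_grad k j), fun φ hφ => ?_⟩⟩⟩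
  · rw [(H.weak k j).byParts φ hφ]; ring
  · linarith [H k j φ hφ]

lemma isClosed_isH1 (hΩ : IsOpen Ω) :
    IsClosed {z : Jet n (volume.restrict Ω) | IsH1 Ω z.val z.grad} := by
  have : {z : Jet n (volume.restrict Ω) | IsH1 Ω z.val z.grad} =
      ⋂ (k) (j) (φ : Pt n → ℝ) (hφ : IsTestFunction Ω φ),
        {z | inner ℝ (z (k, none)) (((hφ.pderiv j).memLp 2 Ω).toLp _) +
          inner ℝ (z (k, some j)) ((hφ.memLp 2 Ω).toLp _) = 0} := by
    ext z
    simp only [mem_iInter, mem_ofPred_eq]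
    have := isH1_iff_inner hΩ z.isL2Jet
    rwa [z.toJet_isL2Jet] at this
  rw [this]
  refine isClosed_iInter fun k => isClosed_iInter fun j => isClosed_iInter fun φ =>
    isClosed_iInter fun hφ => isClosed_eq ?_ continuous_const
  have hc : ∀ p, Continuous fun z : Jet n (volume.restrict Ω) => z p := fun p =>
    (PiLp.proj (𝕜 := ℝ) 2
      (fun _ : Fin 3 × Option (Fin n) => Lp ℝ 2 (volume.restrict Ω)) p).continuous
  exact ((hc _).inner continuous_const).add ((hc _).inner continuous_const)

lemma isWeakPartial_congr {j : Fin n} {f g f' g' : Pt n → ℝ}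
    (hfg : f =ᵐ[volume.restrict Ω] g) (hfg' : f' =ᵐ[volume.restrict Ω] g')
    (h : IsWeakPartial Ω j f f') : IsWeakPartial Ω j g g' where
  locInt := h.locInt.congr hfg
  locInt' := h.locInt'.congr hfg'
  byParts := fun φ hφ => by
    have h1 : ∫ x in Ω, g x * pderiv j φ x = ∫ x in Ω, f x * pderiv j φ x :=
      integral_congr_ae (by filter_upwards [hfg] with x hx; rw [hx])
    have h2 : ∫ x in Ω, g' x * φ x = ∫ x in Ω, f' x * φ x :=
      integral_congr_ae (by filter_upwards [hfg'] with x hx; rw [hx])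
    rw [h1, h2, h.byParts φ hφ]

lemma isH1_congr {u v : Field3 n} {Du Dv : Grad3 n}
    (hu : ∀ᵐ x ∂(volume.restrict Ω), u x = v x)
    (hDu : ∀ᵐ x ∂(volume.restrict Ω), Du x = Dv x) (h : IsH1 Ω u Du) : IsH1 Ω v Dv := by
  have h1 : ∀ k, (fun x => u x k) =ᵐ[volume.restrict Ω] fun x => v x k := fun k => by
    filter_upwards [hu] with x hx; rw [hx]
  have h2 : ∀ k j, (fun x => Du x k j) =ᵐ[volume.restrict Ω] fun x => Dv x k j := fun k j => by
    filter_upwards [hDu] with x hx; rw [hx]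
  exact ⟨fun k => (memLp_congr_ae (h1 k)).1 (h.memLp k),
    fun k j => (memLp_congr_ae (h2 k j)).1 (h.memLp_grad k j),
    fun k j => isWeakPartial_congr (h1 k) (h2 k j) (h.weak k j)⟩

lemma isL2Jet_of_test_add {φ ψ : Field3 n} (hφ : ∀ k, IsTestFunction Ω (fun x => φ x k))
    (hψ : ∀ k, IsTestFunction Ω (fun x => ψ x k)) :
    (isL2Jet_of_test (φ := φ + ψ) fun k => (hφ k).add (hψ k)).toJet =
      (isL2Jet_of_test hφ).toJet + (isL2Jet_of_test hψ).toJet := by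
  rw [← IsL2Jet.toJet_add]
  exact IsL2Jet.toJet_congr _ _ (fun k => Eventually.of_forall fun x => rfl)
    fun k j => Eventually.of_forall fun x => pderiv_add (hφ k).smooth (hψ k).smooth j x

lemma isL2Jet_of_test_smul {φ : Field3 n} (hφ : ∀ k, IsTestFunction Ω (fun x => φ x k)) (c : ℝ) :
    (isL2Jet_of_test (φ := c • φ) fun k => (hφ k).const_mul c).toJet =
      c • (isL2Jet_of_test hφ).toJet := by
  rw [← IsL2Jet.toJet_smul]
  exact IsL2Jet.toJet_congr _ _ (fun k => Eventually.of_forall fun x => rfl)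
    fun k j => Eventually.of_forall fun x => pderiv_const_mul (hφ k).smooth c j x

variable (Ω) in
/-- The jets of test functions. -/
def testJets : Submodule ℝ (Jet n (volume.restrict Ω)) where
  carrier := {z | ∃ (φ : Field3 n) (hφ : ∀ k, IsTestFunction Ω (fun x => φ x k)),
    z = (isL2Jet_of_test hφ).toJet}
  zero_mem' := by
    have h := isL2Jet_of_test_smul (φ := fun _ _ => (0 : ℝ))
      (fun k => IsTestFunction.zero (Ω := Ω)) 0
    exact ⟨_, fun k => IsTestFunction.zero.const_mul 0, (h.trans (zero_smul ℝ _)).symm⟩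
  add_mem' := by
    rintro _ _ ⟨φ, hφ, rfl⟩ ⟨ψ, hψ, rfl⟩
    exact ⟨φ + ψ, fun k => (hφ k).add (hψ k), (isL2Jet_of_test_add hφ hψ).symm⟩
  smul_mem' := by
    rintro c _ ⟨φ, hφ, rfl⟩
    exact ⟨c • φ, fun k => (hφ k).const_mul c, (isL2Jet_of_test_smul hφ c).symm⟩

variable (Ω) in
/-- The jets of functions in `H¹₀`, defined as the closure of the jets of test functions. -/
def zeroTraceJets : Submodule ℝ (Jet n (volume.restrict Ω)) := (testJets Ω).topologicalClosure

lemma isClosed_zeroTraceJets : IsClosed (zeroTraceJets Ω : Set (Jet n (volume.restrict Ω))) :=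
  (testJets Ω).isClosed_topologicalClosure

lemma toJet_test_mem {φ : Field3 n} (hφ : ∀ k, IsTestFunction Ω (fun x => φ x k)) :
    (isL2Jet_of_test hφ).toJet ∈ zeroTraceJets Ω :=
  (testJets Ω).le_topologicalClosure ⟨φ, hφ, rfl⟩

/-- A closed condition that holds for test functions holds on `H¹₀`. -/
lemma zeroTraceJets_induction {P : Jet n (volume.restrict Ω) → Prop} (hP : IsClosed {z | P z})
    (h : ∀ (φ : Field3 n) (hφ : ∀ k, IsTestFunction Ω (fun x => φ x k)),
      P (isL2Jet_of_test hφ).toJet) {z : Jet n (volume.restrict Ω)} (hz : z ∈ zeroTraceJets Ω) :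
    P z := by
  refine closure_minimal (s := (testJets Ω : Set (Jet n (volume.restrict Ω)))) ?_ hP hz
  rintro _ ⟨φ, hφ, rfl⟩
  exact h φ hφ

lemma toJet_mem_zeroTraceJets_iff (hΩ : IsOpen Ω) {u : Field3 n} {Du : Grad3 n}
    (h : IsL2Jet (volume.restrict Ω) u Du) : h.toJet ∈ zeroTraceJets Ω ↔ IsH10 Ω u Du := by
  constructor
  · intro hz
    have hH1 : IsH1 Ω u Du := by
      refine isH1_congr h.val_toJet h.grad_toJet ?_
      refine zeroTraceJets_induction (P := fun z => IsH1 Ω z.val z.grad) (isClosed_isH1 hΩ) ?_ hz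
      intro φ hφ
      refine isH1_congr ?_ ?_ (isH1_of_test hφ)
      · filter_upwards [(isL2Jet_of_test hφ).val_toJet] with x hx using hx.symm
      · filter_upwards [(isL2Jet_of_test hφ).grad_toJet] with x hx using hx.symm
    obtain ⟨z, hz1, hz2⟩ := mem_closure_iff_seq_limit.1
      (show h.toJet ∈ closure (testJets Ω : Set (Jet n (volume.restrict Ω))) from hz)
    choose φ hφ hzφ using hz1
    have hlim : ∀ p, Tendsto (fun m => z m p) atTop (𝓝 (h.toJet p)) := fun p =>
      ((PiLp.proj (𝕜 := ℝ) 2 (fun _ : Fin 3 × Option (Fin n) =>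
        Lp ℝ 2 (volume.restrict Ω)) p).continuous.tendsto _).comp hz2
    refine ⟨hH1, φ, hφ, fun k => ?_, fun k j => ?_⟩
    · have := hlim (k, none)
      simp only [hzφ, IsL2Jet.toJet_none] at this
      exact (Lp.tendsto_Lp_iff_tendsto_eLpNorm'' _ _ _ _).1 this
    · have := hlim (k, some j)
      simp only [hzφ, IsL2Jet.toJet_some] at this
      exact (Lp.tendsto_Lp_iff_tendsto_eLpNorm'' _ _ _ _).1 this
  · rintro ⟨-, φ, hφ, h1, h2⟩
    refine mem_closure_iff_seq_limit.2
      ⟨fun m => (isL2Jet_of_test (hφ m)).toJet, fun m => ⟨φ m, hφ m, rfl⟩, ?_⟩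
    refine ((PiLp.homeomorph 2 _).isInducing.tendsto_nhds_iff).2 (tendsto_pi_nhds.2 ?_)
    rintro ⟨k, _ | j⟩
    · exact (Lp.tendsto_Lp_iff_tendsto_eLpNorm'' _ (fun m => ((hφ m) k).memLp 2 Ω) _ (h.memLp k)).2
        (h1 k)
    · exact (Lp.tendsto_Lp_iff_tendsto_eLpNorm'' _ (fun m => ((hφ m k).pderiv j).memLp 2 Ω) _
        (h.memLp_grad k j)).2 (h2 k j)

lemma mem_zeroTraceJets_iff (hΩ : IsOpen Ω) (z : Jet n (volume.restrict Ω)) :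
    z ∈ zeroTraceJets Ω ↔ IsH10 Ω z.val z.grad := by
  rw [← toJet_mem_zeroTraceJets_iff hΩ z.isL2Jet, z.toJet_isL2Jet]

/-! ### The inequalities of Korn and Poincaré -/

lemma continuous_jet_apply {μ : Measure (Pt n)} (p : Fin 3 × Option (Fin n)) :
    Continuous fun z : Jet n μ => z p :=
  (PiLp.proj (𝕜 := ℝ) 2 (fun _ : Fin 3 × Option (Fin n) => Lp ℝ 2 μ) p).continuous

lemma strainL_one_apply {μ : Measure (Pt 3)} (k l : Fin 3) (z : Jet 3 μ) :
    strainL μ 1 k l z = (1 / 2 : ℝ) • (z (k, some l) + z (l, some k)) := by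
  rw [strainL_apply, ← Finset.smul_sum, Finset.sum_add_distrib]
  simp [Matrix.one_apply]

/-- Korn's inequality in `H¹₀`: since `∫ ∂_l u_k ∂_k u_l = ∫ ∂_k u_k ∂_l u_l`, twice the integral of
the square of the strain is the sum of those of the squares of the gradient and of the
divergence. -/
lemma korn_zeroTrace {Ω : Set (Pt 3)} {z : Jet 3 (volume.restrict Ω)} (hz : z ∈ zeroTraceJets Ω) :
    ∑ k, ∑ j, ‖z (k, some j)‖ ^ 2 ≤ 2 * ∑ k, ∑ l, ‖strainL (volume.restrict Ω) 1 k l z‖ ^ 2 := by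
  have hswap : ∀ k l, inner ℝ (z (k, some l)) (z (l, some k)) =
      inner ℝ (z (k, some k)) (z (l, some l)) := by
    intro k l
    refine zeroTraceJets_induction (P := fun z => inner ℝ (z (k, some l)) (z (l, some k)) =
      inner ℝ (z (k, some k)) (z (l, some l))) ?_ ?_ hz
    · exact isClosed_eq ((continuous_jet_apply _).inner (continuous_jet_apply _))
        ((continuous_jet_apply _).inner (continuous_jet_apply _))
    · intro φ hφ
      simp only [IsL2Jet.toJet_some, inner_toLp]
      exact ((isH1_of_test hφ).weak k l).integral_comm ((isH1_of_test hφ).weak k k) (hφ l)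
  have hterm : ∀ k l, ‖strainL (volume.restrict Ω) 1 k l z‖ ^ 2 =
      (1 / 4) * (‖z (k, some l)‖ ^ 2 + ‖z (l, some k)‖ ^ 2) +
        (1 / 2) * inner ℝ (z (k, some k)) (z (l, some l)) := by
    intro k l
    rw [strainL_one_apply, norm_smul, mul_pow, norm_add_sq_real, hswap]
    norm_num
    ring
  have hdiv : ∑ k, ∑ l, inner ℝ (z (k, some k)) (z (l, some l)) =
      ‖∑ k, z (k, some k)‖ ^ 2 := by
    rw [← real_inner_self_eq_norm_sq, sum_inner]
    simp only [inner_sum]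
  simp only [hterm, Finset.sum_add_distrib, ← Finset.mul_sum, hdiv]
  rw [Finset.sum_comm (f := fun k l => ‖z (l, some k)‖ ^ 2)]
  nlinarith [sq_nonneg ‖∑ k, z (k, some k)‖]

/-- Poincaré's inequality: `∫ φ² = - 2 ∫ x₁ φ ∂₁φ`. -/
lemma poincare_zeroTrace {Ω : Set (Pt 3)} {M : ℝ} (hM : ∀ x ∈ Ω, |x 0| ≤ M)
    (hM0 : 0 ≤ M) (hΩ : IsOpen Ω)
    {z : Jet 3 (volume.restrict Ω)} (hz : z ∈ zeroTraceJets Ω) (k : Fin 3) :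
    ‖z (k, none)‖ ≤ 2 * M * ‖z (k, some 0)‖ := by
  refine zeroTraceJets_induction (P := fun z => ‖z (k, none)‖ ≤ 2 * M * ‖z (k, some 0)‖) ?_ ?_ hz
  · exact isClosed_le (continuous_jet_apply _).norm
      (continuous_const.mul (continuous_jet_apply _).norm)
  · intro φ hφ
    have hx : ContDiff ℝ ∞ fun x : Pt 3 => x 0 := by fun_prop
    have hdx : ∀ x : Pt 3, pderiv 0 (fun x : Pt 3 => x 0) x = 1 := by
      intro x
      have : HasFDerivAt (fun x : Pt 3 => x 0) (EuclideanSpace.proj 0 : Pt 3 →L[ℝ] ℝ) x :=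
        (EuclideanSpace.proj 0 : Pt 3 →L[ℝ] ℝ).hasFDerivAt
      rw [pderiv, this.fderiv]
      simp
    set f : Pt 3 → ℝ := fun x => φ x k with hf
    have hft : IsTestFunction Ω f := hφ k
    have hby := (isWeakPartial_of_contDiff (Ω := Ω) (hx.mul hft.smooth) 0).byParts f hft
    simp only [pderiv_mul hx hft.smooth, hdx, one_mul] at hby
    have i1 : Integrable (fun x => f x * f x) (volume.restrict Ω) :=
      (hft.memLp 2 Ω).integrable_mul (hft.memLp 2 Ω)
    have i2 : Integrable (fun x => x 0 * f x * pderiv 0 f x) (volume.restrict Ω) := by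
      have := ((hft.mul_right hx).memLp 2 Ω).integrable_mul ((hft.pderiv 0).memLp 2 Ω)
      refine this.congr (Eventually.of_forall fun x => ?_)
      simp only [Pi.mul_apply]; ring
    have e1 : ∫ x in Ω, (f x + x 0 * pderiv 0 f x) * f x =
        (∫ x in Ω, f x * f x) + ∫ x in Ω, x 0 * f x * pderiv 0 f x := by
      rw [← integral_add i1 i2]
      congr 1; funext x; ring
    have e2 : ∫ x in Ω, f x * f x = -2 * ∫ x in Ω, x 0 * f x * pderiv 0 f x := by
      have hby' : ∫ x in Ω, x 0 * f x * pderiv 0 f x =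
        -∫ x in Ω, (f x + x 0 * pderiv 0 f x) * f x := hby
      linarith
    rw [IsL2Jet.toJet_none, IsL2Jet.toJet_some]
    set F := ((isL2Jet_of_test hφ).memLp k).toLp _ with hF
    have hd : MemLp (pderiv 0 f) 2 (volume.restrict Ω) := (hft.pderiv 0).memLp 2 Ω
    have hxf : MemLp (fun x => f x * x 0) 2 (volume.restrict Ω) := (hft.mul_right hx).memLp 2 Ω
    have hF2 : ‖F‖ ^ 2 = -2 * inner ℝ (hxf.toLp _) (hd.toLp _) := by
      rw [← real_inner_self_eq_norm_sq, hF, inner_toLp, inner_toLp]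
      refine e2.trans ?_
      congr 2; funext x; ring
    have hxF : ‖hxf.toLp _‖ ≤ M * ‖F‖ := by
      refine Lp.norm_le_mul_norm_of_ae_le_mul ?_
      filter_upwards [hxf.coeFn_toLp, ((isL2Jet_of_test hφ).memLp k).coeFn_toLp,
        ae_restrict_mem hΩ.measurableSet] with x h1 h2 h3
      rw [h1, hF, h2, norm_mul, mul_comm]
      exact mul_le_mul_of_nonneg_right (hM x h3) (norm_nonneg _)
    have hcs := abs_real_inner_le_norm (hxf.toLp _) (hd.toLp _)
    have hle : ‖F‖ ^ 2 ≤ 2 * M * ‖hd.toLp _‖ * ‖F‖ := by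
      have := (neg_abs_le (inner ℝ (hxf.toLp _) (hd.toLp _)))
      nlinarith [norm_nonneg (hd.toLp _), mul_le_mul_of_nonneg_right hxF (norm_nonneg (hd.toLp _))]
    rcases (norm_nonneg F).eq_or_lt with h0 | h0
    · rw [← h0]; positivity
    · exact le_of_mul_le_mul_right (by rw [← sq]; exact hle) h0

/-- On a bounded open set the strain controls the whole `H¹` norm of functions in `H¹₀`. -/
lemma exists_norm_sq_le_strain {Ω : Set (Pt 3)} (hΩ : IsOpen Ω) (hΩb : Bornology.IsBounded Ω) :
    ∃ K : ℝ, 0 < K ∧ ∀ z ∈ zeroTraceJets Ω,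
      ‖z‖ ^ 2 ≤ K * ∑ k, ∑ l, ‖strainL (volume.restrict Ω) 1 k l z‖ ^ 2 := by
  obtain ⟨M, hM0, hM⟩ := hΩb.exists_pos_norm_le
  have hM' : ∀ x ∈ Ω, |x 0| ≤ M := fun x hx => (PiLp.norm_apply_le x 0).trans (hM x hx)
  refine ⟨2 * (4 * M ^ 2 + 1), by positivity, fun z hz => ?_⟩
  have hk := korn_zeroTrace hz
  have hp : ∀ k, ‖z (k, none)‖ ^ 2 ≤ 4 * M ^ 2 * ∑ j, ‖z (k, some j)‖ ^ 2 := by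
    intro k
    have h1 := poincare_zeroTrace hM' hM0.le hΩ hz k
    have h2 : ‖z (k, some 0)‖ ^ 2 ≤ ∑ j, ‖z (k, some j)‖ ^ 2 :=
      Finset.single_le_sum (f := fun j => ‖z (k, some j)‖ ^ 2) (fun _ _ => sq_nonneg _)
        (Finset.mem_univ 0)
    have h3 : ‖z (k, none)‖ ^ 2 ≤ (2 * M * ‖z (k, some 0)‖) ^ 2 :=
      pow_le_pow_left₀ (norm_nonneg _) h1 2
    nlinarith [sq_nonneg M]
  have hsum : ∑ k, ‖z (k, none)‖ ^ 2 ≤ 4 * M ^ 2 * ∑ k, ∑ j, ‖z (k, some j)‖ ^ 2 := by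
    rw [Finset.mul_sum]
    exact Finset.sum_le_sum fun k _ => hp k
  rw [Jet.norm_sq, Finset.sum_add_distrib]
  nlinarith [sq_nonneg M]

end

noncomputable section

/-! ### Lattice periodic functions -/

variable {n : ℕ}

/-- An integer vector as a point. -/
def intVec (m : Fin n → ℤ) : Pt n := WithLp.toLp 2 fun b => (m b : ℝ)

variable (n) in
/-- The half-open unit cube. -/
def unitCube : Set (Pt n) := {y | ∀ b, y b ∈ Ico (0 : ℝ) 1}

/-- Periodicity with respect to the integer lattice. -/
def IsLatticePeriodic {α : Type*} (f : Pt n → α) : Prop :=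
  ∀ y b, f (y + EuclideanSpace.single b 1) = f y

lemma IsLatticePeriodic.add_intVec {α : Type*} {f : Pt n → α} (hf : IsLatticePeriodic f)
    (m : Fin n → ℤ) (y : Pt n) : f (y + intVec m) = f y := by
  have h : ∀ s : Finset (Fin n),
      Function.Periodic f (∑ b ∈ s, m b • (EuclideanSpace.single b 1 : Pt n)) := by
    classical
    intro s
    induction s using Finset.induction_on with
    | empty => intro y; simp
    | insert b s hb ih =>
      rw [Finset.sum_insert hb]
      have hp : Function.Periodic f (EuclideanSpace.single b 1 : Pt n) := fun y => hf y b
      exact (hp.zsmul (m b)).add_period ih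
  have e : (intVec m : Pt n) = ∑ b, m b • (EuclideanSpace.single b 1 : Pt n) := by
    ext b
    simp [intVec, Finset.sum_apply, Pi.single_apply]
  rw [e]
  exact h _ y

lemma measurableSet_unitCube : MeasurableSet (unitCube n) := by
  have : unitCube n = ⋂ b, (fun y : Pt n => y b) ⁻¹' Ico (0 : ℝ) 1 := by
    ext y; simp [unitCube]
  rw [this]
  exact MeasurableSet.iInter fun b =>
    (by fun_prop : Measurable fun y : Pt n => y b) measurableSet_Ico

/-- The integral of a periodic function over a box is at most the integral over a unit cell times
the number of cells that meet the box. -/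
lemma lintegral_box_le {f : Pt n → ENNReal} (hf : IsLatticePeriodic f) {p q : Fin n → ℝ}
    (hpq : ∀ b, p b ≤ q b) {s : Set (Pt n)} (hs : ∀ y ∈ s, ∀ b, y b ∈ Icc (p b) (q b)) :
    ∫⁻ y in s, f y ≤ ENNReal.ofReal (∏ b, (q b - p b + 2)) * ∫⁻ y in unitCube n, f y := by
  classical
  set F : Finset (Fin n → ℤ) := Fintype.piFinset fun b => Finset.Icc ⌊p b⌋ ⌊q b⌋ with hF
  have hcell : ∀ m : Fin n → ℤ, ∫⁻ y in (fun y => y + intVec (-m)) ⁻¹' unitCube n, f y =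
      ∫⁻ y in unitCube n, f y := by
    intro m
    have hm : MeasurableSet ((fun y : Pt n => y + intVec (-m)) ⁻¹' unitCube n) :=
      (measurable_id.add_const _) measurableSet_unitCube
    rw [← lintegral_indicator hm, ← lintegral_indicator measurableSet_unitCube,
      ← lintegral_add_right_eq_self ((unitCube n).indicator f) (intVec (-m))]
    congr 1
    funext y
    by_cases hy : y + intVec (-m) ∈ unitCube n
    · rw [indicator_of_mem hy, indicator_of_mem (by exact hy), hf.add_intVec]
    · rw [indicator_of_notMem hy, indicator_of_notMem (by exact hy)]
  have hcov : s ⊆ ⋃ m ∈ F, (fun y => y + intVec (-m)) ⁻¹' unitCube n := by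
    intro y hy
    simp only [mem_iUnion]
    refine ⟨fun b => ⌊y b⌋, ?_, ?_⟩
    · simp only [hF, Fintype.mem_piFinset, Finset.mem_Icc]
      exact fun b => ⟨Int.floor_le_floor (hs y hy b).1, Int.floor_le_floor (hs y hy b).2⟩
    · intro b
      simp only [intVec, PiLp.add_apply, Pi.neg_apply, Int.cast_neg, ← sub_eq_add_neg]
      exact ⟨Int.fract_nonneg _, Int.fract_lt_one _⟩
  have hcard : (F.card : ENNReal) ≤ ENNReal.ofReal (∏ b, (q b - p b + 2)) := by
    rw [← ENNReal.ofReal_natCast]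
    refine ENNReal.ofReal_le_ofReal ?_
    rw [hF, Fintype.card_piFinset, Nat.cast_prod]
    refine Finset.prod_le_prod (fun _ _ => Nat.cast_nonneg _) fun b _ => ?_
    have h1 : ⌊p b⌋ ≤ ⌊q b⌋ := Int.floor_le_floor (hpq b)
    have h2 : ((Finset.Icc ⌊p b⌋ ⌊q b⌋).card : ℤ) = ⌊q b⌋ + 1 - ⌊p b⌋ := by
      rw [Int.card_Icc, Int.toNat_of_nonneg (by omega)]
    have h3 : ((Finset.Icc ⌊p b⌋ ⌊q b⌋).card : ℝ) = ⌊q b⌋ + 1 - ⌊p b⌋ := by exact_mod_cast h2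
    rw [h3]
    linarith [Int.floor_le (q b), Int.lt_floor_add_one (p b)]
  calc ∫⁻ y in s, f y ≤ ∫⁻ y in ⋃ m ∈ F, (fun y => y + intVec (-m)) ⁻¹' unitCube n, f y :=
        lintegral_mono_set hcov
    _ ≤ ∑ m ∈ F, ∫⁻ y in (fun y => y + intVec (-m)) ⁻¹' unitCube n, f y := by
        refine le_trans (lintegral_mono' (?_ : volume.restrict _ ≤
          ∑ m ∈ F, volume.restrict ((fun y : Pt n => y + intVec (-m)) ⁻¹' unitCube n)) le_rfl) ?_
        · rw [← Measure.sum_coe_finset]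
          exact Measure.restrict_biUnion_le F.countable_toSet
        · rw [lintegral_finsetSum_measure]
    _ = F.card * ∫⁻ y in unitCube n, f y := by simp [hcell]
    _ ≤ _ := mul_le_mul_left hcard _

end

noncomputable section

/-! ### Fourier series on the unit square -/

/-- Lebesgue measure on the unit square. -/
abbrev sqVol : Measure (Pt 2) := volume.restrict unitSquare

lemma unitSquare_ae_eq_Ioc :
    (unitSquare : Set (Pt 2)) =ᵐ[volume] {y : Pt 2 | ∀ b, y b ∈ Ioc (0 : ℝ) 1} := by
  have h := (Measure.univ_pi_Ioc_ae_eq_Icc (f := fun _ : Fin 2 => (0 : ℝ)) (g := fun _ => 1)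
    (μ := fun _ : Fin 2 => (volume : Measure ℝ))).symm
  have h2 := (PiLp.volume_preserving_ofLp (Fin 2)).quasiMeasurePreserving.preimage_ae_eq h
  have e1 : (unitSquare : Set (Pt 2)) =
      (WithLp.ofLp : Pt 2 → Fin 2 → ℝ) ⁻¹' Icc (fun _ => 0) (fun _ => 1) := by
    ext y
    simp only [unitSquare, mem_ofPred_eq, mem_preimage, mem_Icc, Pi.le_def, forall_and]
  have e2 : {y : Pt 2 | ∀ b, y b ∈ Ioc (0 : ℝ) 1} =
      (WithLp.ofLp : Pt 2 → Fin 2 → ℝ) ⁻¹' univ.pi fun _ => Ioc 0 1 := by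
    ext y
    simp only [mem_ofPred_eq, mem_preimage, mem_univ_pi]
  rw [e1, e2]
  exact h2

lemma unitSquare_ae_eq_unitCube : (unitSquare : Set (Pt 2)) =ᵐ[volume] unitCube 2 := by
  have h := (Measure.univ_pi_Ico_ae_eq_Icc (f := fun _ : Fin 2 => (0 : ℝ)) (g := fun _ => 1)
    (μ := fun _ : Fin 2 => (volume : Measure ℝ))).symm
  have h2 := (PiLp.volume_preserving_ofLp (Fin 2)).quasiMeasurePreserving.preimage_ae_eq h
  have e1 : (unitSquare : Set (Pt 2)) =
      (WithLp.ofLp : Pt 2 → Fin 2 → ℝ) ⁻¹' Icc (fun _ => 0) (fun _ => 1) := by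
    ext y
    simp only [unitSquare, mem_ofPred_eq, mem_preimage, mem_Icc, Pi.le_def, forall_and]
  have e2 : unitCube 2 =
      (WithLp.ofLp : Pt 2 → Fin 2 → ℝ) ⁻¹' univ.pi fun _ => Ico 0 1 := by
    ext y
    simp only [mem_ofPred_eq, mem_preimage, mem_univ_pi, unitCube]
  rw [e1, e2]
  exact h2

lemma sqVol_eq_unitCube : sqVol = volume.restrict (unitCube 2) :=
  Measure.restrict_congr_set unitSquare_ae_eq_unitCube

lemma measurableSet_unitSquare : MeasurableSet unitSquare := by
  have : unitSquare = (WithLp.ofLp : Pt 2 → Fin 2 → ℝ) ⁻¹' Icc 0 1 := by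
    ext y; simp [unitSquare, Pi.le_def, forall_and]
  rw [this]
  exact (PiLp.volume_preserving_ofLp (Fin 2)).measurable measurableSet_Icc

lemma volume_unitSquare : volume (unitSquare : Set (Pt 2)) = 1 := by
  have h : (unitSquare : Set (Pt 2)) = (WithLp.ofLp : Pt 2 → Fin 2 → ℝ) ⁻¹' Icc 0 1 := by
    ext y; simp [unitSquare, Pi.le_def, forall_and]
  rw [h, (PiLp.volume_preserving_ofLp (Fin 2)).measure_preimage measurableSet_Icc.nullMeasurableSet,
    Real.volume_Icc_pi]
  simp

instance : IsProbabilityMeasure sqVol := ⟨by simp [volume_unitSquare]⟩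

section Torus

/-- The circle carries its probability Haar measure, as in the theory of Fourier series on the
torus. -/
local instance circleMeasureSpace : MeasureSpace UnitAddCircle := ⟨AddCircle.haarAddCircle⟩

local instance isProbabilityMeasure_circle :
    IsProbabilityMeasure (volume : Measure UnitAddCircle) :=
  inferInstanceAs (IsProbabilityMeasure AddCircle.haarAddCircle)

open UnitAddTorus

/-- The section of the covering of the torus by the plane, with values in `(0,1]²`. -/
def torusSection (t : UnitAddTorus (Fin 2)) : Pt 2 :=
  WithLp.toLp 2 (measurableEquivPiIoc (fun _ : Fin 2 => (0 : ℝ)) t).1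

lemma measurePreserving_torusSection :
    MeasurePreserving torusSection volume sqVol := by
  have h1 := UnitAddTorus.measurePreserving_equivPiIoc (fun _ : Fin 2 => (0 : ℝ))
  have hs : MeasurableSet {x : Fin 2 → ℝ | ∀ i, x i ∈ Ioc (0 : ℝ) (0 + 1)} :=
    MeasurableSet.univ_pi' fun _ => measurableSet_Ioc
  have h2 : MeasurePreserving
      (Subtype.val : {x : Fin 2 → ℝ // ∀ i, x i ∈ Ioc (0 : ℝ) (0 + 1)} → Fin 2 → ℝ)
      (Measure.comap Subtype.val volume)
      (volume.restrict {x : Fin 2 → ℝ | ∀ i, x i ∈ Ioc (0 : ℝ) (0 + 1)}) :=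
    ⟨measurable_subtype_coe, map_comap_subtype_coe hs volume⟩
  have h3 := (PiLp.volume_preserving_toLp (Fin 2)).restrict_preimage_emb
    (MeasurableEquiv.toLp 2 (Fin 2 → ℝ)).measurableEmbedding {y : Pt 2 | ∀ b, y b ∈ Ioc (0 : ℝ) 1}
  have e : sqVol = volume.restrict {y : Pt 2 | ∀ b, y b ∈ Ioc (0 : ℝ) 1} :=
    Measure.restrict_congr_set unitSquare_ae_eq_Ioc
  rw [e]
  have e2 : (WithLp.toLp 2 : (Fin 2 → ℝ) → Pt 2) ⁻¹' {y : Pt 2 | ∀ b, y b ∈ Ioc (0 : ℝ) 1} =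
      {x : Fin 2 → ℝ | ∀ i, x i ∈ Ioc (0 : ℝ) (0 + 1)} := by
    ext x; simp
  rw [e2] at h3
  exact h3.comp (h2.comp h1)

/-- The frequency vector `2 π m`. -/
def freq (m : Fin 2 → ℤ) (b : Fin 2) : ℝ := 2 * Real.pi * m b

lemma mFourier_eq_exp (m : Fin 2 → ℤ) (t : UnitAddTorus (Fin 2)) :
    mFourier m t = Complex.exp (Complex.I * ((∑ b, freq m b * torusSection t b : ℝ) : ℂ)) := by
  have ht : ∀ b, t b = ((torusSection t b : ℝ) : UnitAddCircle) := by
    intro b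
    have := (measurableEquivPiIoc (fun _ : Fin 2 => (0 : ℝ))).symm_apply_apply t
    exact (congrFun this b).symm
  have h1 : mFourier m t = ∏ b, fourier (m b) (t b) := rfl
  rw [h1, Complex.ofReal_sum, Finset.mul_sum, Complex.exp_sum]
  refine Finset.prod_congr rfl fun b _ => ?_
  rw [ht b, fourier_coe_apply]
  congr 1
  simp only [freq]
  push_cast
  ring

/-- The complex `L²` function on the torus that corresponds to a real `L²` function on the unit
square. -/
def toTorus (f : Lp ℝ 2 sqVol) : Lp ℂ 2 (volume : Measure (UnitAddTorus (Fin 2))) :=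
  (((Lp.memLp f).ofReal (K := ℂ)).comp_measurePreserving measurePreserving_torusSection).toLp _

lemma coeFn_toTorus (f : Lp ℝ 2 sqVol) :
    toTorus f =ᵐ[volume] fun t => ((f (torusSection t) : ℝ) : ℂ) :=
  MemLp.coeFn_toLp _

lemma norm_toTorus (f : Lp ℝ 2 sqVol) : ‖toTorus f‖ = ‖f‖ := by
  have h := eLpNorm_comp_measurePreserving (p := 2) ((Lp.memLp f).ofReal (K := ℂ)).1
    measurePreserving_torusSection
  rw [toTorus, Lp.norm_toLp, Lp.norm_def]
  refine congrArg ENNReal.toReal (h.trans ?_)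
  exact eLpNorm_congr_norm_ae (Eventually.of_forall fun x => by simp)

/-- The wave `Re (c e^{i κ·y})` as an element of `L²` of the unit square. -/
def waveLp (c : ℂ) (κ : Fin 2 → ℝ) : Lp ℝ 2 sqVol :=
  (MemLp.of_bound (μ := sqVol) (p := 2) (contDiff_wave c κ).continuous.aestronglyMeasurable ‖c‖
    (Eventually.of_forall fun x => abs_wave_le c κ x)).toLp _

lemma coeFn_waveLp (c : ℂ) (κ : Fin 2 → ℝ) : waveLp c κ =ᵐ[sqVol] wave c κ := MemLp.coeFn_toLp _

/-- The `m`-th Fourier coefficient `∫ f e^{-2πi m·y}` of a real function on the unit square. -/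
def fcL (m : Fin 2 → ℤ) : Lp ℝ 2 sqVol →L[ℝ] ℂ :=
  (Complex.ofRealCLM ∘L innerSL ℝ (waveLp 1 (freq m))) -
    Complex.I • (Complex.ofRealCLM ∘L innerSL ℝ (waveLp (-Complex.I) (freq m)))

lemma fcL_apply (m : Fin 2 → ℤ) (f : Lp ℝ 2 sqVol) :
    fcL m f = ((inner ℝ (waveLp 1 (freq m)) f : ℝ) : ℂ) -
      Complex.I * ((inner ℝ (waveLp (-Complex.I) (freq m)) f : ℝ) : ℂ) := by
  simp [fcL]

lemma inner_waveLp (c : ℂ) (κ : Fin 2 → ℝ) (f : Lp ℝ 2 sqVol) :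
    inner ℝ (waveLp c κ) f = ∫ y in unitSquare, wave c κ y * f y := by
  rw [inner_eq_integral_mul]
  refine integral_congr_ae ?_
  filter_upwards [coeFn_waveLp c κ] with y hy
  rw [hy]

lemma fcL_eq_mFourierCoeff (m : Fin 2 → ℤ) (f : Lp ℝ 2 sqVol) :
    fcL m f = mFourierCoeff (toTorus f) m := by
  have hi : ∀ c : ℂ, Integrable (fun y => wave c (freq m) y * f y) sqVol := fun c => by
    refine (integrable_coeFn_mul (waveLp c (freq m)) f).congr ?_
    filter_upwards [coeFn_waveLp c (freq m)] with y hy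
    rw [hy]
  have h1 : mFourierCoeff (toTorus f) m = ∫ t : UnitAddTorus (Fin 2),
      (fun y : Pt 2 => ((wave 1 (freq m) y * f y : ℝ) : ℂ) -
        Complex.I * ((wave (-Complex.I) (freq m) y * f y : ℝ) : ℂ)) (torusSection t) := by
    refine integral_congr_ae ?_
    filter_upwards [coeFn_toTorus f] with t ht
    rw [ht, mFourier_neg, mFourier_eq_exp, smul_eq_mul, ← Complex.exp_conj]
    simp only [wave_eq, map_mul, Complex.conj_I, Complex.conj_ofReal]
    generalize ∑ b, freq m b * torusSection t b = θ
    rw [neg_mul, mul_comm Complex.I, ← neg_mul, ← Complex.ofReal_neg, Complex.exp_mul_I,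
      ← Complex.ofReal_cos, ← Complex.ofReal_sin, Real.cos_neg, Real.sin_neg]
    simp only [Complex.one_re, Complex.one_im, Complex.neg_re, Complex.neg_im, Complex.I_re,
      Complex.I_im]
    push_cast
    ring
  have hint : Integrable (fun y : Pt 2 => ((wave 1 (freq m) y * f y : ℝ) : ℂ) -
        Complex.I * ((wave (-Complex.I) (freq m) y * f y : ℝ) : ℂ)) sqVol :=
    (hi 1).ofReal.sub ((hi _).ofReal.const_mul _)
  have hmap := measurePreserving_torusSection.map_eq
  have h2 := integral_map (μ := (volume : Measure (UnitAddTorus (Fin 2))))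
    measurePreserving_torusSection.measurable.aemeasurable (by rw [hmap]; exact hint.1)
  rw [h1, ← h2, hmap, integral_sub (hi 1).ofReal ((hi _).ofReal.const_mul _),
    integral_const_mul, integral_complex_ofReal, integral_complex_ofReal, fcL_apply, inner_waveLp,
    inner_waveLp]

/-- Parseval's identity on the unit square. -/
lemma hasSum_norm_fcL_sq (f : Lp ℝ 2 sqVol) : HasSum (fun m => ‖fcL m f‖ ^ 2) (‖f‖ ^ 2) := by
  have h := hasSum_sq_mFourierCoeff (toTorus f)
  simp only [← fcL_eq_mFourierCoeff] at h
  convert h using 1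
  rw [← norm_toTorus, ← inner_self_eq_norm_sq (𝕜 := ℂ), L2.inner_def, ← integral_re
    (L2.integrable_inner _ _)]
  simp only [inner_self_eq_norm_sq]

lemma norm_fcL_le (m : Fin 2 → ℤ) (f : Lp ℝ 2 sqVol) : ‖fcL m f‖ ≤ ‖f‖ := by
  have := (hasSum_norm_fcL_sq f).summable.le_tsum m fun _ _ => sq_nonneg _
  rw [(hasSum_norm_fcL_sq f).tsum_eq] at this
  exact le_of_sq_le_sq this (norm_nonneg _)

/-- The error of a real partial sum of the Fourier series is at most the part of the norm that is
carried by the other coefficients. -/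
lemma norm_sub_partialSum_sq_le (S : Finset (Fin 2 → ℤ)) (f : Lp ℝ 2 sqVol) :
    ‖f - ∑ m ∈ S, waveLp (fcL m f) (freq m)‖ ^ 2 ≤ ‖f‖ ^ 2 - ∑ m ∈ S, ‖fcL m f‖ ^ 2 := by
  set F := toTorus f with hF
  set P := ∑ m ∈ S, fcL m f • mFourierLp (d := Fin 2) 2 m with hP
  have hin : ∀ m, inner ℂ (mFourierLp 2 m) F = fcL m f := by
    intro m
    rw [fcL_eq_mFourierCoeff, ← mFourierBasis_repr, HilbertBasis.repr_apply_apply,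
      coe_mFourierBasis]
  have hPF : ‖F - P‖ ^ 2 = ‖f‖ ^ 2 - ∑ m ∈ S, ‖fcL m f‖ ^ 2 := by
    have hPP : ‖P‖ ^ 2 = ∑ m ∈ S, ‖fcL m f‖ ^ 2 := by
      have := orthonormal_mFourier.inner_sum (fun m => fcL m f) (fun m => fcL m f) S
      rw [← hP, inner_self_eq_norm_sq_to_K] at this
      have h2 : ((‖P‖ ^ 2 : ℝ) : ℂ) = ((∑ m ∈ S, ‖fcL m f‖ ^ 2 : ℝ) : ℂ) := by
        push_cast
        refine Eq.trans (by simpa using this) (Finset.sum_congr rfl fun m _ => ?_)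
        rw [Complex.conj_mul']
      exact_mod_cast h2
    have hFP : RCLike.re (inner ℂ F P) = ∑ m ∈ S, ‖fcL m f‖ ^ 2 := by
      rw [hP, inner_sum, map_sum]
      refine Finset.sum_congr rfl fun m _ => ?_
      rw [inner_smul_right, ← inner_conj_symm, hin, Complex.mul_conj']
      norm_cast
    rw [norm_sub_sq (𝕜 := ℂ), hPP, hFP, hF, norm_toTorus]
    ring
  rw [← hPF, ← norm_toTorus]
  refine pow_le_pow_left₀ (norm_nonneg _) (Lp.norm_le_norm_of_ae_le ?_) 2
  have hq := measurePreserving_torusSection.quasiMeasurePreserving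
  have hsum : ∀ᵐ t : UnitAddTorus (Fin 2), P t = ∑ m ∈ S, fcL m f * mFourier m t := by
    have h1 : P = ContinuousMap.toLp (E := ℂ) 2 volume ℂ (∑ m ∈ S, fcL m f • mFourier m) := by
      rw [hP, map_sum]
      simp only [map_smul]
    rw [h1]
    filter_upwards [ContinuousMap.coeFn_toLp (E := ℂ) (p := 2) (𝕜 := ℂ) volume
      (∑ m ∈ S, fcL m f • mFourier m)] with t ht
    rw [ht]
    simp
  filter_upwards [coeFn_toTorus (f - ∑ m ∈ S, waveLp (fcL m f) (freq m)), hsum,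
    Lp.coeFn_sub F P, coeFn_toTorus f,
    hq.ae (Lp.coeFn_sub f (∑ m ∈ S, waveLp (fcL m f) (freq m))),
    hq.ae (coeFn_finsetSum S fun m => waveLp (fcL m f) (freq m)),
    hq.ae (ae_all_iff.2 fun m => coeFn_waveLp (fcL m f) (freq m))] with t h1 h2 h3 h4 h5 h6 h7
  have e : f (torusSection t) - ∑ m ∈ S, wave (fcL m f) (freq m) (torusSection t) =
      (F t - P t).re := by
    rw [h2, hF, h4, Complex.sub_re, Complex.ofReal_re, Complex.re_sum]
    congr 1
    refine Finset.sum_congr rfl fun m _ => ?_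
    rw [wave, mFourier_eq_exp]
  rw [h1, h5, h3, Pi.sub_apply, Pi.sub_apply, h6, Finset.sum_congr rfl fun m _ => h7 m, e,
    Complex.norm_real]
  exact Complex.abs_re_le_norm _

end Torus

end

noncomputable section

/-! ### Periodic Sobolev functions and Fourier coefficients -/

lemma mem_unitCube_iff_floor {n : ℕ} (y : Pt n) (m : Fin n → ℤ) :
    y + intVec (-m) ∈ unitCube n ↔ (fun b => ⌊y b⌋) = m := by
  simp only [unitCube, intVec, mem_ofPred_eq, PiLp.add_apply, Pi.neg_apply, Int.cast_neg, mem_Ico,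
    funext_iff, Int.floor_eq_iff]
  refine forall_congr' fun b => ⟨fun h => ⟨by linarith [h.1], by linarith [h.2]⟩,
    fun h => ⟨by linarith [h.1], by linarith [h.2]⟩⟩

/-- Unfolding: the integral of the product of a periodic function and of a function `ψ` with
compact support is an integral over the unit cell of the product with the periodization of `ψ`. -/
lemma integral_mul_eq_sum_unitCube {g ψ : Pt 2 → ℝ} (hg : LocallyIntegrable g)
    (hper : ∀ m : Fin 2 → ℤ, ∀ᵐ y, g (y + intVec m) = g y) (hψ : Continuous ψ)
    (hc : HasCompactSupport ψ) (F : Finset (Fin 2 → ℤ))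
    (hF : ∀ y, ψ y ≠ 0 → (fun b => ⌊y b⌋) ∈ F) :
    ∫ y, g y * ψ y = ∑ m ∈ F, ∫ y in unitSquare, g y * ψ (y + intVec m) := by
  have hint : Integrable fun y => g y * ψ y := by
    simpa only [smul_eq_mul, mul_comm] using
      hg.integrable_smul_left_of_hasCompactSupport hψ hc
  set cell : (Fin 2 → ℤ) → Set (Pt 2) := fun m => (fun y => y + intVec (-m)) ⁻¹' unitCube 2
    with hcell
  have hm : ∀ m, MeasurableSet (cell m) := fun m =>
    (measurable_id.add_const _) measurableSet_unitCube
  have hdisj : (F : Set (Fin 2 → ℤ)).Pairwise (Function.onFun Disjoint cell) := by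
    intro m _ m' _ hne
    refine Set.disjoint_left.2 fun y hy hy' => hne ?_
    rw [← (mem_unitCube_iff_floor y m).1 hy, ← (mem_unitCube_iff_floor y m').1 hy']
  have h1 : ∫ y, g y * ψ y = ∫ y in ⋃ m ∈ F, cell m, g y * ψ y := by
    refine (setIntegral_eq_integral_of_forall_compl_eq_zero fun y hy => ?_).symm
    by_contra hne
    refine hy ?_
    simp only [mem_iUnion]
    exact ⟨_, hF y (right_ne_zero_of_mul hne), (mem_unitCube_iff_floor y _).2 rfl⟩
  rw [h1, integral_biUnion_finset F (fun m _ => hm m) hdisj fun m _ => hint.integrableOn]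
  refine Finset.sum_congr rfl fun m _ => ?_
  rw [show (volume.restrict unitSquare : Measure (Pt 2)) = volume.restrict (unitCube 2) from
    sqVol_eq_unitCube, ← integral_indicator (hm m), ← integral_indicator measurableSet_unitCube,
    ← integral_add_right_eq_self _ (intVec m)]
  refine integral_congr_ae ?_
  filter_upwards [hper m] with y hy
  have e : y + intVec m + intVec (-m) = y := by
    ext b; simp [intVec]
  by_cases hyc : y ∈ unitCube 2
  · rw [indicator_of_mem (by simpa only [hcell, mem_preimage, e] using hyc),
      indicator_of_mem hyc, hy]
  · rw [indicator_of_notMem (by simpa only [hcell, mem_preimage, e] using hyc),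
      indicator_of_notMem hyc]

lemma pderiv_comp_add {n : ℕ} (f : Pt n → ℝ) (v : Pt n) (j : Fin n) (x : Pt n) :
    pderiv j (fun y => f (y + v)) x = pderiv j f (x + v) := by
  unfold pderiv
  rw [fderiv_comp_add_right]

lemma isTestFunction_univ {n : ℕ} {f : Pt n → ℝ} (hf : ContDiff ℝ ∞ f) (hc : HasCompactSupport f) :
    IsTestFunction univ f := ⟨hf, hc, subset_univ _⟩

/-- The weak derivative of a periodic function is periodic, up to null sets. -/
lemma IsWeakPartial.ae_periodic {b : Fin 2} {w D : Pt 2 → ℝ} (h : IsWeakPartial univ b w D)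
    (hw : IsLatticePeriodic w) (m : Fin 2 → ℤ) : ∀ᵐ y, D (y + intVec m) = D y := by
  have hD : LocallyIntegrable D := locallyIntegrableOn_univ.1 h.locInt'
  have hDm : LocallyIntegrable fun y => D (y + intVec m) := by
    have hmap : Measure.map (Homeomorph.addRight (intVec m : Pt 2)) volume = volume :=
      (measurePreserving_add_right volume (intVec m : Pt 2)).map_eq
    have := (locallyIntegrable_map_homeomorph (Homeomorph.addRight (intVec m : Pt 2)) (f := D)
      (μ := volume)).1 (by rw [hmap]; exact hD)
    exact this
  refine ae_eq_of_integral_contDiff_smul_eq hDm hD fun φ hφ hc => ?_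
  have hby := h.byParts
  simp only [Measure.restrict_univ] at hby
  have e : ∀ y, y + intVec m + -intVec m = (y : Pt 2) := fun y => by abel
  have hφ' : IsTestFunction univ fun y => φ (y + -intVec m) := by
    refine isTestFunction_univ (hφ.comp (contDiff_id.add contDiff_const)) ?_
    exact hc.comp_homeomorph (Homeomorph.addRight (-intVec m : Pt 2))
  have h1 : ∫ y, φ y • D (y + intVec m) = ∫ y, D y * φ (y + -intVec m) := by
    rw [← integral_add_right_eq_self (fun y => D y * φ (y + -intVec m)) (intVec m)]
    simp only [e, smul_eq_mul, mul_comm]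
  have h2 : ∫ y, w y * pderiv b (fun y => φ (y + -intVec m)) y = ∫ y, w y * pderiv b φ y := by
    simp only [pderiv_comp_add]
    rw [← integral_add_right_eq_self (fun y => w y * pderiv b φ (y + -intVec m)) (intVec m)]
    simp only [e, hw.add_intVec]
  have h3 := hby _ hφ'
  have h4 := hby _ (isTestFunction_univ hφ hc)
  rw [h1]
  simp only [smul_eq_mul, mul_comm (φ _)]
  linarith

/-- A smooth cutoff on the line whose integer translates sum up to one. -/
def cutoffLine (t : ℝ) : ℝ := Real.smoothTransition t - Real.smoothTransition (t - 1)

lemma cutoffLine_eq_zero {t : ℝ} (ht : t ∉ Ioo (0 : ℝ) 2) : cutoffLine t = 0 := by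
  unfold cutoffLine
  by_cases h0 : t ≤ 0
  · rw [Real.smoothTransition.zero_of_nonpos h0,
      Real.smoothTransition.zero_of_nonpos (by linarith), sub_zero]
  · have h2 : 2 ≤ t := by
      by_contra h
      exact ht ⟨not_le.1 h0, not_le.1 h⟩
    rw [Real.smoothTransition.one_of_one_le (by linarith),
      Real.smoothTransition.one_of_one_le (by linarith), sub_self]

lemma cutoffLine_add {t : ℝ} (h0 : 0 ≤ t) (h1 : t ≤ 1) :
    cutoffLine t + cutoffLine (t + 1) = 1 := by
  unfold cutoffLine
  rw [Real.smoothTransition.zero_of_nonpos (by linarith : t - 1 ≤ 0),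
    Real.smoothTransition.one_of_one_le (by linarith : 1 ≤ t + 1), add_sub_cancel_right]
  ring

lemma contDiff_cutoffLine : ContDiff ℝ ∞ cutoffLine := by
  unfold cutoffLine
  exact Real.smoothTransition.contDiff.sub
    (Real.smoothTransition.contDiff.comp (contDiff_id.sub contDiff_const))

/-- A smooth cutoff in the plane whose integer translates sum up to one. -/
def cutoffPlane (y : Pt 2) : ℝ := cutoffLine (y 0) * cutoffLine (y 1)

lemma contDiff_cutoffPlane : ContDiff ℝ ∞ cutoffPlane := by
  unfold cutoffPlane
  exact (contDiff_cutoffLine.comp (by fun_prop)).mul (contDiff_cutoffLine.comp (by fun_prop))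

lemma mem_Ioo_of_cutoffPlane_ne_zero {y : Pt 2} (hy : cutoffPlane y ≠ 0) (b : Fin 2) :
    y b ∈ Ioo (0 : ℝ) 2 := by
  by_contra h
  refine hy ?_
  have h0 := cutoffLine_eq_zero h
  unfold cutoffPlane
  fin_cases b
  · exact mul_eq_zero_of_left h0 _
  · exact mul_eq_zero_of_right _ h0

lemma hasCompactSupport_cutoffPlane : HasCompactSupport cutoffPlane := by
  refine HasCompactSupport.intro (K := (WithLp.ofLp : Pt 2 → Fin 2 → ℝ) ⁻¹' Icc 0 2) ?_ ?_
  · exact (PiLp.homeomorph 2 (fun _ : Fin 2 => ℝ)).isCompact_preimage.2 isCompact_Icc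
  · intro y hy
    by_contra hne
    exact hy ⟨fun b => (mem_Ioo_of_cutoffPlane_ne_zero hne b).1.le,
      fun b => (mem_Ioo_of_cutoffPlane_ne_zero hne b).2.le⟩

/-- The four cells that meet the support of the cutoff. -/
def cutoffCells : Finset (Fin 2 → ℤ) := Fintype.piFinset fun _ => {0, 1}

lemma sum_cutoffPlane {y : Pt 2} (hy : y ∈ unitSquare) :
    ∑ m ∈ cutoffCells, cutoffPlane (y + intVec m) = 1 := by
  have e : ∑ m ∈ cutoffCells, cutoffPlane (y + intVec m) =
      ∑ m ∈ cutoffCells, ∏ b, cutoffLine (y b + m b) := by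
    refine Finset.sum_congr rfl fun m _ => ?_
    simp [cutoffPlane, intVec, Fin.prod_univ_two]
  rw [e, cutoffCells, Finset.sum_prod_piFinset {(0 : ℤ), 1} fun b (k : ℤ) => cutoffLine (y b + k)]
  refine Finset.prod_eq_one fun b _ => ?_
  rw [Finset.sum_pair (by norm_num)]
  simpa using cutoffLine_add (hy b).1 (hy b).2

lemma sum_pderiv_cutoffPlane (b : Fin 2) :
    ∀ᵐ y ∂sqVol, ∑ m ∈ cutoffCells, pderiv b cutoffPlane (y + intVec m) = 0 := by
  have hopen : (unitSquare : Set (Pt 2)) =ᵐ[volume] {y : Pt 2 | ∀ b, y b ∈ Ioo (0 : ℝ) 1} := by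
    have h := (Measure.univ_pi_Ioo_ae_eq_Icc (f := fun _ : Fin 2 => (0 : ℝ)) (g := fun _ => 1)
      (μ := fun _ : Fin 2 => (volume : Measure ℝ))).symm
    have h2 := (PiLp.volume_preserving_ofLp (Fin 2)).quasiMeasurePreserving.preimage_ae_eq h
    have e1 : (unitSquare : Set (Pt 2)) =
        (WithLp.ofLp : Pt 2 → Fin 2 → ℝ) ⁻¹' Icc (fun _ => 0) (fun _ => 1) := by
      ext y
      simp only [unitSquare, mem_ofPred_eq, mem_preimage, mem_Icc, Pi.le_def, forall_and]
    have e2 : {y : Pt 2 | ∀ b, y b ∈ Ioo (0 : ℝ) 1} =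
        (WithLp.ofLp : Pt 2 → Fin 2 → ℝ) ⁻¹' univ.pi fun _ => Ioo 0 1 := by
      ext y
      simp only [mem_ofPred_eq, mem_preimage, mem_univ_pi]
    rw [e1, e2]
    exact h2
  have hO : IsOpen {y : Pt 2 | ∀ b, y b ∈ Ioo (0 : ℝ) 1} := by
    simp only [ofPred_forall]
    exact isOpen_iInter_of_finite fun b =>
      isOpen_Ioo.preimage (by fun_prop : Continuous fun y : Pt 2 => y b)
  rw [show sqVol = volume.restrict _ from Measure.restrict_congr_set hopen]
  filter_upwards [ae_restrict_mem hO.measurableSet] with y hy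
  have hev : (fun y => ∑ m ∈ cutoffCells, cutoffPlane (y + intVec m)) =ᶠ[𝓝 y] fun _ => 1 := by
    filter_upwards [hO.mem_nhds hy] with z hz
    exact sum_cutoffPlane fun b => ⟨(hz b).1.le, (hz b).2.le⟩
  have h := hev.fderiv_eq (𝕜 := ℝ)
  have h2 := pderiv_finsetSum cutoffCells (f := fun m y => cutoffPlane (y + intVec m))
    (fun m _ => contDiff_cutoffPlane.comp (contDiff_id.add contDiff_const)) b y
  simp only [pderiv_comp_add] at h2
  rw [← h2, pderiv, h]
  simp

lemma wave_isLatticePeriodic (c : ℂ) (m : Fin 2 → ℤ) : IsLatticePeriodic (wave c (freq m)) := by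
  intro y b
  have e : ∑ i, freq m i * (y + EuclideanSpace.single b 1 : Pt 2) i =
      ∑ i, freq m i * y i + m b * (2 * Real.pi) := by
    simp only [PiLp.add_apply, mul_add, Finset.sum_add_distrib]
    simp [freq]
    ring
  rw [wave_eq, wave_eq, e, Real.cos_add_int_mul_two_pi, Real.sin_add_int_mul_two_pi]

/-- Integration by parts over the unit cell against a plane wave. -/
lemma integral_wave_mul_weakPartial {b : Fin 2} {w D : Pt 2 → ℝ} (h : IsWeakPartial univ b w D)
    (hw : IsLatticePeriodic w) (hwi : Integrable w sqVol) (c : ℂ) (m : Fin 2 → ℤ)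
    (hDi : Integrable D sqVol) :
    ∫ y in unitSquare, wave c (freq m) y * D y =
      -∫ y in unitSquare, freq m b * wave (Complex.I * c) (freq m) y * w y := by
  set e := wave c (freq m) with he
  have hec : ContDiff ℝ ∞ e := contDiff_wave _ _
  have hep : ∀ (l : Fin 2 → ℤ) y, e (y + intVec l) = e y := fun l y =>
    (wave_isLatticePeriodic c m).add_intVec l y
  set e' := wave (freq m b * (Complex.I * c)) (freq m) with he'
  have hde : ∀ y, pderiv b e y = e' y := fun y => pderiv_wave _ _ _ _
  have hep' : ∀ (l : Fin 2 → ℤ) y, e' (y + intVec l) = e' y := fun l y =>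
    (wave_isLatticePeriodic _ m).add_intVec l y
  have hec' : Continuous e' := (contDiff_wave _ _).continuous
  have hφ : IsTestFunction univ fun y => cutoffPlane y * e y :=
    (isTestFunction_univ contDiff_cutoffPlane hasCompactSupport_cutoffPlane).mul_right hec
  have hby := h.byParts _ hφ
  simp only [Measure.restrict_univ, pderiv_mul contDiff_cutoffPlane hec, hde] at hby
  have hcells : ∀ y : Pt 2, (∀ b, y b ∈ Ioo (0 : ℝ) 2) → (fun b => ⌊y b⌋) ∈ cutoffCells := by
    intro y hy
    simp only [cutoffCells, Fintype.mem_piFinset, Finset.mem_insert, Finset.mem_singleton]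
    intro b
    have h1 : 0 ≤ ⌊y b⌋ := Int.floor_nonneg.2 (hy b).1.le
    have h2 : ⌊y b⌋ < 2 := Int.floor_lt.2 (by exact_mod_cast (hy b).2)
    omega
  have hout : ∀ y : Pt 2, ¬ (∀ b, y b ∈ Ioo (0 : ℝ) 2) → cutoffPlane y = 0 := by
    intro y hy
    by_contra hne
    exact hy fun b => mem_Ioo_of_cutoffPlane_ne_zero hne b
  have hpc : Continuous (pderiv b cutoffPlane) := (contDiff_pderiv contDiff_cutoffPlane b).continuous
  -- outside the open square the cutoff attains its minimum, so that its derivative vanishes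
  have hout' : ∀ y : Pt 2, ¬ (∀ b, y b ∈ Ioo (0 : ℝ) 2) → pderiv b cutoffPlane y = 0 := by
    intro y hy
    have hnn : ∀ t, 0 ≤ cutoffLine t := fun t => by
      by_cases h1 : t ≤ 1
      · rw [cutoffLine, Real.smoothTransition.zero_of_nonpos (by linarith : t - 1 ≤ 0), sub_zero]
        exact Real.smoothTransition.nonneg t
      · rw [cutoffLine, Real.smoothTransition.one_of_one_le (by linarith)]
        linarith [Real.smoothTransition.le_one (t - 1)]
    have hmin : IsLocalMin cutoffPlane y := by
      refine Eventually.of_forall fun z => ?_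
      rw [hout y hy]
      exact mul_nonneg (hnn _) (hnn _)
    rw [pderiv, hmin.fderiv_eq_zero]
    rfl
  have hwl : LocallyIntegrable w := locallyIntegrableOn_univ.1 h.locInt
  have hDl : LocallyIntegrable D := locallyIntegrableOn_univ.1 h.locInt'
  have hψ1 : Continuous fun y => pderiv b cutoffPlane y * e y + cutoffPlane y * e' y :=
    (hpc.mul hec.continuous).add (contDiff_cutoffPlane.continuous.mul hec')
  have hψ1c : HasCompactSupport fun y => pderiv b cutoffPlane y * e y + cutoffPlane y * e' y :=
    ((isTestFunction_univ contDiff_cutoffPlane hasCompactSupport_cutoffPlane).pderiv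
      b).compact.mul_right.add hasCompactSupport_cutoffPlane.mul_right
  rw [integral_mul_eq_sum_unitCube hwl (fun l => Eventually.of_forall fun y => hw.add_intVec l y)
      hψ1 hψ1c cutoffCells (fun y hy => hcells y (by
        by_contra hn
        exact hy (by simp only [hout y hn, hout' y hn, zero_mul, add_zero]))),
    integral_mul_eq_sum_unitCube hDl (h.ae_periodic hw) hφ.continuous hφ.compact cutoffCells
      (fun y hy => hcells y (by
        by_contra hn
        exact hy (by simp only [hout y hn, zero_mul])))] at hby
  have hbd : ∀ (l : Fin 2 → ℤ) (ψ : Pt 2 → ℝ), Continuous ψ → HasCompactSupport ψ →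
      ∀ g : Pt 2 → ℝ, Integrable g sqVol → Integrable (fun y => g y * ψ (y + intVec l)) sqVol := by
    intro l ψ hψ hψc g hg
    obtain ⟨C, hC⟩ := hψc.exists_bound_of_continuous hψ
    exact hg.mul_bdd ((hψ.comp (continuous_id.add continuous_const)).aestronglyMeasurable)
      (Eventually.of_forall fun y => hC _)
  rw [← integral_finsetSum _ fun l _ => hbd l _ hψ1 hψ1c w hwi,
    ← integral_finsetSum _ fun l _ => hbd l _ hφ.continuous hφ.compact D hDi] at hby
  have hL : ∫ y in unitSquare, ∑ l ∈ cutoffCells,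
      w y * (pderiv b cutoffPlane (y + intVec l) * e (y + intVec l) +
        cutoffPlane (y + intVec l) * e' (y + intVec l)) = ∫ y in unitSquare, w y * e' y := by
    refine integral_congr_ae ?_
    filter_upwards [sum_pderiv_cutoffPlane b, ae_restrict_mem measurableSet_unitSquare] with y hy hyS
    simp only [hep, hep']
    rw [← Finset.mul_sum, Finset.sum_add_distrib, ← Finset.sum_mul, ← Finset.sum_mul, hy,
      sum_cutoffPlane hyS]
    ring
  have hR : ∫ y in unitSquare, ∑ l ∈ cutoffCells,
      D y * (cutoffPlane (y + intVec l) * e (y + intVec l)) = ∫ y in unitSquare, D y * e y := by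
    refine integral_congr_ae ?_
    filter_upwards [ae_restrict_mem measurableSet_unitSquare] with y hyS
    simp only [hep]
    rw [← Finset.mul_sum, ← Finset.sum_mul, sum_cutoffPlane hyS]
    ring
  rw [hL, hR] at hby
  simp only [← wave_real_mul, ← he', mul_comm (e _), mul_comm (e' _)]
  linarith

end

noncomputable section

/-- The weak derivative of a periodic function multiplies the Fourier coefficients by the
frequency. -/
lemma fcL_weakPartial {b : Fin 2} {w D : Pt 2 → ℝ} (h : IsWeakPartial univ b w D)
    (hw : IsLatticePeriodic w) (hw2 : MemLp w 2 sqVol) (hD2 : MemLp D 2 sqVol) (m : Fin 2 → ℤ) :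
    fcL m (hD2.toLp D) = freq m b * (Complex.I * fcL m (hw2.toLp w)) := by
  have hi : ∀ (c : ℂ) {f : Pt 2 → ℝ} (hf : MemLp f 2 sqVol),
      inner ℝ (waveLp c (freq m)) (hf.toLp f) = ∫ y in unitSquare, wave c (freq m) y * f y := by
    intro c f hf
    rw [inner_waveLp]
    refine integral_congr_ae ?_
    filter_upwards [hf.coeFn_toLp] with y hy
    rw [hy]
  have hp : ∀ c : ℂ, ∫ y in unitSquare, wave c (freq m) y * D y =
      -(freq m b * ∫ y in unitSquare, wave (Complex.I * c) (freq m) y * w y) := by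
    intro c
    rw [integral_wave_mul_weakPartial h hw (hw2.integrable (by norm_num)) c m
      (hD2.integrable (by norm_num)), ← integral_const_mul]
    simp only [mul_assoc]
  have hneg : ∫ y in unitSquare, wave (Complex.I * 1) (freq m) y * w y =
      -∫ y in unitSquare, wave (-Complex.I) (freq m) y * w y := by
    rw [← integral_neg]
    congr 1
    funext y
    simp only [wave_eq, mul_one, Complex.neg_re, Complex.neg_im]
    ring
  have hI : Complex.I * -Complex.I = 1 := by rw [mul_neg, Complex.I_mul_I, neg_neg]
  rw [fcL_apply, fcL_apply, hi, hi, hi, hi, hp, hp, hneg, hI]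
  push_cast
  linear_combination (freq m b : ℂ) *
    ((∫ y in unitSquare, wave (-Complex.I) (freq m) y * w y : ℝ) : ℂ) * Complex.I_sq

/-- The representative of a point modulo the integer lattice in the unit cell. -/
def fractPt (y : Pt 2) : Pt 2 := WithLp.toLp 2 fun b => Int.fract (y b)

lemma isLatticePeriodic_comp_fractPt {α : Type*} (f : Pt 2 → α) :
    IsLatticePeriodic fun y => f (fractPt y) := by
  intro y b
  have e : fractPt (y + EuclideanSpace.single b 1) = fractPt y := by
    ext c
    by_cases h : c = b
    · subst h
      simp [fractPt]
    · simp [fractPt, h]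
  exact congrArg f e

lemma measurable_fractPt : Measurable fractPt := by
  refine (PiLp.volume_preserving_toLp (Fin 2)).measurable.comp (measurable_pi_iff.2 fun b => ?_)
  exact measurable_fract.comp (by fun_prop : Measurable fun y : Pt 2 => y b)

lemma ae_fractPt : ∀ᵐ y ∂sqVol, fractPt y = y := by
  rw [sqVol_eq_unitCube]
  filter_upwards [ae_restrict_mem measurableSet_unitCube] with y hy
  ext b
  exact Int.fract_eq_self.2 (hy b)

lemma memLp_comp_fractPt (f : Lp ℝ 2 sqVol) : MemLp (fun y => f (fractPt y)) 2 sqVol :=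
  (memLp_congr_ae (by filter_upwards [ae_fractPt] with y hy; rw [hy])).1 (Lp.memLp f)

lemma toLp_comp_fractPt (f : Lp ℝ 2 sqVol) : (memLp_comp_fractPt f).toLp _ = f := by
  refine Lp.ext ?_
  filter_upwards [(memLp_comp_fractPt f).coeFn_toLp, ae_fractPt] with y h1 h2
  rw [h1, h2]

lemma locallyIntegrable_of_periodic {g : Pt 2 → ℝ} (hg : IsLatticePeriodic g)
    (hm : AEStronglyMeasurable g) (hi : Integrable g sqVol) : LocallyIntegrable g := by
  refine locallyIntegrable_iff.2 fun K hK => ⟨hm.restrict, ?_⟩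
  obtain ⟨M, hM0, hM⟩ := hK.isBounded.exists_pos_norm_le
  have hle := lintegral_box_le (n := 2) (f := fun y => ‖g y‖ₑ) (s := K) (p := fun _ => -M)
    (q := fun _ => M) (fun y b => congrArg (‖·‖ₑ) (hg y b)) (fun _ => by linarith)
    (fun y hy b => abs_le.1 ((PiLp.norm_apply_le y b).trans (hM y hy)))
  refine hle.trans_lt (ENNReal.mul_lt_top ENNReal.ofReal_lt_top ?_)
  rw [← sqVol_eq_unitCube]
  exact hi.2

/-- Integration of periodic functions against a fixed function with compact support is a continuous
functional on `L²` of the unit square. -/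
lemma exists_integral_eq_inner {ψ : Pt 2 → ℝ} (hψ : Continuous ψ) (hc : HasCompactSupport ψ) :
    ∃ Ψ : Lp ℝ 2 sqVol, ∀ (g : Pt 2 → ℝ) (hg : MemLp g 2 sqVol), LocallyIntegrable g →
      IsLatticePeriodic g → ∫ y, g y * ψ y = inner ℝ (hg.toLp g) Ψ := by
  obtain ⟨M, hM0, hM⟩ := hc.isCompact.isBounded.exists_pos_norm_le
  set F : Finset (Fin 2 → ℤ) := Fintype.piFinset fun _ => Finset.Icc ⌊-M⌋ ⌊M⌋ with hF
  have hFm : ∀ y, ψ y ≠ 0 → (fun b => ⌊y b⌋) ∈ F := by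
    intro y hy
    simp only [hF, Fintype.mem_piFinset, Finset.mem_Icc]
    intro b
    have h := abs_le.1 ((PiLp.norm_apply_le y b).trans (hM y (subset_tsupport _ hy)))
    exact ⟨Int.floor_le_floor h.1, Int.floor_le_floor h.2⟩
  obtain ⟨C, hC⟩ := hc.exists_bound_of_continuous hψ
  have hψm : ∀ m : Fin 2 → ℤ, MemLp (fun y => ψ (y + intVec m)) 2 sqVol := fun m =>
    MemLp.of_bound (hψ.comp (continuous_id.add continuous_const)).aestronglyMeasurable C
      (Eventually.of_forall fun y => hC _)
  refine ⟨∑ m ∈ F, (hψm m).toLp _, fun g hg hgl hper => ?_⟩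
  rw [integral_mul_eq_sum_unitCube hgl (fun m => Eventually.of_forall fun y => hper.add_intVec m y)
    hψ hc F hFm, inner_sum]
  exact Finset.sum_congr rfl fun m _ => (inner_toLp hg (hψm m)).symm

/-- The real partial sums of the Fourier series converge in `L²`. -/
lemma tendsto_partialSum (f : Lp ℝ 2 sqVol) :
    Tendsto (fun S : Finset (Fin 2 → ℤ) => ∑ m ∈ S, waveLp (fcL m f) (freq m)) atTop (𝓝 f) := by
  have h1 : Tendsto (fun S : Finset (Fin 2 → ℤ) => ‖f‖ ^ 2 - ∑ m ∈ S, ‖fcL m f‖ ^ 2) atTop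
      (𝓝 0) := by
    have h := Tendsto.const_sub (‖f‖ ^ 2) (hasSum_norm_fcL_sq f)
    rwa [sub_self] at h
  have h2 : Tendsto (fun S : Finset (Fin 2 → ℤ) =>
      ‖f - ∑ m ∈ S, waveLp (fcL m f) (freq m)‖ ^ 2) atTop (𝓝 0) :=
    squeeze_zero (fun _ => sq_nonneg _) (fun S => norm_sub_partialSum_sq_le S f) h1
  rw [tendsto_iff_norm_sub_tendsto_zero]
  have h3 := h2.sqrt
  simp only [Real.sqrt_zero, Real.sqrt_sq (norm_nonneg _)] at h3
  simpa only [norm_sub_rev] using h3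

/-- Functions whose Fourier coefficients are related by the frequency are related by weak
differentiation. -/
lemma isWeakPartial_of_fcL {b : Fin 2} {f f' : Lp ℝ 2 sqVol}
    (h : ∀ m, fcL m f' = freq m b * (Complex.I * fcL m f)) :
    IsWeakPartial univ b (fun y => f (fractPt y)) (fun y => f' (fractPt y)) := by
  have hl : ∀ f : Lp ℝ 2 sqVol, LocallyIntegrable fun y => f (fractPt y) := fun f =>
    locallyIntegrable_of_periodic (isLatticePeriodic_comp_fractPt f)
      ((Lp.stronglyMeasurable f).measurable.comp measurable_fractPt).aestronglyMeasurable
      ((memLp_comp_fractPt f).integrable (by norm_num))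
  refine ⟨(hl f).locallyIntegrableOn _, (hl f').locallyIntegrableOn _, fun φ hφ => ?_⟩
  simp only [Measure.restrict_univ]
  obtain ⟨Ψ', hΨ'⟩ := exists_integral_eq_inner (hφ.pderiv b).continuous (hφ.pderiv b).compact
  obtain ⟨Ψ, hΨ⟩ := exists_integral_eq_inner hφ.continuous hφ.compact
  rw [hΨ' _ (memLp_comp_fractPt f) (hl f) (isLatticePeriodic_comp_fractPt f),
    hΨ _ (memLp_comp_fractPt f') (hl f') (isLatticePeriodic_comp_fractPt f'),
    toLp_comp_fractPt, toLp_comp_fractPt]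
  have hwave : ∀ (c : ℂ) m, inner ℝ (waveLp c (freq m)) Ψ' =
      -inner ℝ (waveLp (freq m b * (Complex.I * c)) (freq m)) Ψ := by
    intro c m
    have h1 := hΨ' (wave c (freq m)) (MemLp.of_bound
      (contDiff_wave c _).continuous.aestronglyMeasurable ‖c‖
      (Eventually.of_forall fun x => abs_wave_le c _ x))
      (contDiff_wave c _).continuous.locallyIntegrable (wave_isLatticePeriodic c m)
    have h2 := hΨ (wave (freq m b * (Complex.I * c)) (freq m)) (MemLp.of_bound
      (contDiff_wave _ _).continuous.aestronglyMeasurable _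
      (Eventually.of_forall fun x => abs_wave_le _ _ x))
      (contDiff_wave _ _).continuous.locallyIntegrable (wave_isLatticePeriodic _ m)
    have h3 := (isWeakPartial_of_contDiff (Ω := univ) (contDiff_wave c (freq m)) b).byParts φ hφ
    simp only [Measure.restrict_univ, pderiv_wave] at h3
    rw [h1, h2] at h3
    exact h3
  have ht : Tendsto (fun S : Finset (Fin 2 → ℤ) =>
      inner ℝ (∑ m ∈ S, waveLp (fcL m f) (freq m)) Ψ') atTop (𝓝 (inner ℝ f Ψ')) :=
    (tendsto_partialSum f).inner tendsto_const_nhds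
  have ht' : Tendsto (fun S : Finset (Fin 2 → ℤ) =>
      -inner ℝ (∑ m ∈ S, waveLp (fcL m f') (freq m)) Ψ) atTop (𝓝 (-inner ℝ f' Ψ)) :=
    ((tendsto_partialSum f').inner tendsto_const_nhds).neg
  refine tendsto_nhds_unique ht (ht'.congr fun S => ?_)
  rw [sum_inner, sum_inner, ← Finset.sum_neg_distrib]
  exact Finset.sum_congr rfl fun m _ => by rw [hwave, h m]

/-! ### The space of the cell problem -/

/-- The jets of periodic functions of mean zero, characterized by their Fourier coefficients. -/
def cellJets : Submodule ℝ (Jet 2 sqVol) where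
  carrier := {z | (∀ k b m, fcL m (z (k, some b)) =
    freq m b * (Complex.I * fcL m (z (k, none)))) ∧ ∀ k, fcL 0 (z (k, none)) = 0}
  zero_mem' := by simp
  add_mem' := by
    rintro z z' ⟨h1, h2⟩ ⟨h1', h2'⟩
    refine ⟨fun k b m => ?_, fun k => ?_⟩
    · simp only [PiLp.add_apply, map_add, h1, h1']; ring
    · simp only [PiLp.add_apply, map_add, h2, h2', add_zero]
  smul_mem' := by
    rintro c z ⟨h1, h2⟩
    refine ⟨fun k b m => ?_, fun k => ?_⟩
    · simp only [PiLp.smul_apply, map_smul, h1, Complex.real_smul]; ring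
    · simp only [PiLp.smul_apply, map_smul, h2, smul_zero]

lemma isClosed_cellJets : IsClosed (cellJets : Set (Jet 2 sqVol)) := by
  have e : (cellJets : Set (Jet 2 sqVol)) =
      (⋂ (k) (b) (m), {z | fcL m (z (k, some b)) =
        freq m b * (Complex.I * fcL m (z (k, none)))}) ∩ ⋂ k, {z | fcL 0 (z (k, none)) = 0} := by
    ext z
    simp [cellJets]
  have hc : ∀ m p, Continuous fun z : Jet 2 sqVol => fcL m (z p) := fun m p =>
    (fcL m).continuous.comp (continuous_jet_apply p)
  rw [e]
  refine IsClosed.inter ?_ (isClosed_iInter fun k => isClosed_eq (hc _ _) continuous_const)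
  exact isClosed_iInter fun k => isClosed_iInter fun b => isClosed_iInter fun m =>
    isClosed_eq (hc _ _) (continuous_const.mul (continuous_const.mul (hc _ _)))

/-- Jets in the space of the cell problem are the jets of periodic Sobolev functions. -/
lemma isH1Per_of_mem_cellJets {z : Jet 2 sqVol} (hz : z ∈ cellJets) :
    IsH1Per (fun y => z.val (fractPt y)) (fun y => z.grad (fractPt y)) :=
  ⟨isLatticePeriodic_comp_fractPt _, fun _ => memLp_comp_fractPt _,
    fun _ _ => memLp_comp_fractPt _, fun k b => isWeakPartial_of_fcL (hz.1 k b)⟩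

lemma fcL_zero (f : Lp ℝ 2 sqVol) : fcL 0 f = ((∫ y in unitSquare, f y : ℝ) : ℂ) := by
  rw [fcL_apply, inner_waveLp, inner_waveLp]
  have h0 : freq 0 = 0 := by ext b; simp [freq]
  simp [wave_eq, h0]

lemma IsWeakPartial.sub_const {n : ℕ} {Ω : Set (Pt n)} {b : Fin n} {w D : Pt n → ℝ}
    (h : IsWeakPartial Ω b w D) (c : ℝ) : IsWeakPartial Ω b (fun y => w y - c) D where
  locInt := h.locInt.sub (continuous_const.locallyIntegrable.locallyIntegrableOn _)
  locInt' := h.locInt'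
  byParts := fun φ hφ => by
    have h0 := (isWeakPartial_of_contDiff (Ω := Ω) (contDiff_const (c := c)) b).byParts φ hφ
    have hd : ∀ x, pderiv b (fun _ : Pt n => c) x = 0 := fun x => by simp [pderiv]
    simp only [hd, zero_mul, integral_zero, neg_zero] at h0
    have hi : ∀ {g : Pt n → ℝ}, LocallyIntegrableOn g Ω volume →
        Integrable (fun x => g x * pderiv b φ x) (volume.restrict Ω) := by
      intro g hg
      have hK := hg.integrableOn_compact_subset (hφ.pderiv b).support (hφ.pderiv b).compact
      obtain ⟨C, -, hC⟩ := (hφ.pderiv b).exists_bound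
      have h1 : IntegrableOn (fun x => g x * pderiv b φ x) (tsupport (pderiv b φ)) :=
        Integrable.mul_bdd hK (hφ.pderiv b).continuous.aestronglyMeasurable
          (Eventually.of_forall fun x => hC x)
      refine ((integrableOn_iff_integrable_of_support_subset ?_).1 h1).integrableOn
      exact (Function.support_mul_subset_right _ _).trans (subset_tsupport _)
    simp only [sub_mul]
    rw [integral_sub (hi h.locInt) (hi (continuous_const.locallyIntegrable.locallyIntegrableOn _)),
      h0, sub_zero, h.byParts φ hφ]

lemma IsH1Per.isL2Jet {v : Field3 2} {Dv : Grad3 2} (h : IsH1Per v Dv) : IsL2Jet sqVol v Dv :=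
  ⟨h.memLp, h.memLp_grad⟩

/-- Up to a constant, which does not enter the gradient, every periodic Sobolev function has its
jet in the space of the cell problem. -/
lemma IsH1Per.exists_mem_cellJets {v : Field3 2} {Dv : Grad3 2} (h : IsH1Per v Dv) :
    ∃ z ∈ cellJets, ∀ k b, z (k, some b) = h.isL2Jet.toJet (k, some b) := by
  set c : Fin 3 → ℝ := fun k => ∫ y in unitSquare, v y k with hc
  have h2 : IsL2Jet sqVol (fun y k => v y k - c k) Dv :=
    ⟨fun k => (h.memLp k).sub (memLp_const _), h.memLp_grad⟩
  refine ⟨h2.toJet, ⟨fun k b m => ?_, fun k => ?_⟩, fun k b => rfl⟩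
  · exact fcL_weakPartial ((h.weak k b).sub_const (c k))
      (fun y i => congrArg (fun t : Fin 3 → ℝ => t k - c k) (h.periodic y i)) (h2.memLp k)
      (h.memLp_grad k b) m
  · rw [fcL_zero, h2.toJet_none]
    have e : ∫ y in unitSquare, (h2.memLp k).toLp _ y = ∫ y in unitSquare, (v y k - c k) :=
      integral_congr_ae (h2.memLp k).coeFn_toLp
    rw [e, integral_sub ((h.memLp k).integrable (by norm_num)) (integrable_const _)]
    simp [hc]

lemma rotHat_row_sq (α : ℝ) (f : Fin 2 → ℝ) :
    ∑ k, (∑ b, rotHat α b k * f b) ^ 2 = ∑ b, f b ^ 2 := by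
  simp [rotHat, Fin.sum_univ_three, Fin.sum_univ_two]
  nlinarith [Real.sin_sq_add_cos_sq α]

/-- Mean-zero periodic fields obey Poincaré's inequality with constant `1`, since all nonzero
frequencies are at least `2π`. -/
lemma poincare_cell {z : Jet 2 sqVol} (hz : z ∈ cellJets) (k : Fin 3) :
    ‖z (k, none)‖ ^ 2 ≤ ∑ b, ‖z (k, some b)‖ ^ 2 := by
  refine hasSum_le (fun m => ?_) (hasSum_norm_fcL_sq _)
    (hasSum_sum fun b _ => hasSum_norm_fcL_sq (z (k, some b)))
  simp only [hz.1 k _ m, norm_mul, Complex.norm_real, Complex.norm_I, one_mul, mul_pow]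
  rw [← Finset.sum_mul]
  by_cases hm : m = 0
  · rw [hm, hz.2 k]; simp
  · obtain ⟨b, hb⟩ := Function.ne_iff.1 hm
    refine le_mul_of_one_le_left (sq_nonneg _) ?_
    have h1 : (1 : ℝ) ≤ ‖freq m b‖ ^ 2 := by
      rw [Real.norm_eq_abs, sq_abs, freq]
      have : (1 : ℝ) ≤ (m b : ℝ) ^ 2 := by
        have : (1 : ℤ) ≤ m b ^ 2 := Int.one_le_abs (by simpa using hb) |> fun h => by
          rw [← sq_abs]; nlinarith
        exact_mod_cast this
      rw [mul_pow]
      exact one_le_mul_of_one_le_of_one_le (by nlinarith [Real.pi_gt_three]) this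
    exact h1.trans (Finset.single_le_sum (f := fun b => ‖freq m b‖ ^ 2) (fun _ _ => sq_nonneg _)
      (Finset.mem_univ b))

lemma fcL_strainL {z : Jet 2 sqVol} (hz : z ∈ cellJets) (R : Matrix (Fin 2) (Fin 3) ℝ)
    (k l : Fin 3) (m : Fin 2 → ℤ) :
    fcL m (strainL sqVol R k l z) = Complex.I * ((1 / 2 : ℝ) *
      ((∑ b, R b l * freq m b : ℝ) * fcL m (z (k, none)) +
        (∑ b, R b k * freq m b : ℝ) * fcL m (z (l, none)))) := by
  rw [strainL_apply]
  simp only [map_sum, map_smul, map_add, hz.1, Complex.real_smul]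
  push_cast
  simp only [Finset.sum_mul, ← Finset.sum_add_distrib, Finset.mul_sum]
  refine Finset.sum_congr rfl fun b _ => ?_
  ring

/-- The algebra of Korn's inequality for a single plane wave. -/
lemma sum_sq_mul_sum_sq_le (κ a : Fin 3 → ℝ) :
    (∑ k, κ k ^ 2) * ∑ k, a k ^ 2 ≤ (1 / 2) * ∑ k, ∑ l, (κ l * a k + κ k * a l) ^ 2 := by
  simp only [Fin.sum_univ_three]
  nlinarith [sq_nonneg (κ 0 * a 0 + κ 1 * a 1 + κ 2 * a 2)]

/-- Korn's inequality for the rotated strain of periodic functions. -/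
lemma korn_cell {z : Jet 2 sqVol} (hz : z ∈ cellJets) (α : ℝ) :
    ∑ k, ∑ b, ‖z (k, some b)‖ ^ 2 ≤
      2 * ∑ k, ∑ l, ‖strainL sqVol (rotHat α) k l z‖ ^ 2 := by
  refine hasSum_le (fun m => ?_)
    (hasSum_sum fun k _ => hasSum_sum fun b _ => hasSum_norm_fcL_sq (z (k, some b)))
    ((hasSum_sum fun k _ => hasSum_sum fun l _ =>
      hasSum_norm_fcL_sq (strainL sqVol (rotHat α) k l z)).mul_left 2)
  simp only [fcL_strainL hz, hz.1 _ _ m]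
  set κ : Fin 3 → ℝ := fun k => ∑ b, rotHat α b k * freq m b with hκ
  have hκ2 : ∑ k, κ k ^ 2 = ∑ b, freq m b ^ 2 := rotHat_row_sq α _
  generalize hv : (fun k => fcL m (z (k, none))) = v
  have hv' : ∀ k, fcL m (z (k, none)) = v k := fun k => congrFun hv k
  have h1 : ∑ k, ∑ b, ‖(freq m b : ℂ) * (Complex.I * fcL m (z (k, none)))‖ ^ 2 =
      (∑ k, κ k ^ 2) * ∑ k, ‖v k‖ ^ 2 := by
    simp only [norm_mul, Complex.norm_real, Complex.norm_I, one_mul, mul_pow, Real.norm_eq_abs,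
      sq_abs, hv']
    simp only [← Finset.sum_mul, ← Finset.mul_sum, hκ2]
  rw [h1]
  simp only [hv', norm_mul, Complex.norm_I, one_mul, Complex.norm_real, mul_pow]
  have hn : ∀ k l, ‖(κ l : ℂ) * v k + (κ k : ℂ) * v l‖ ^ 2 =
      (κ l * (v k).re + κ k * (v l).re) ^ 2 + (κ l * (v k).im + κ k * (v l).im) ^ 2 := by
    intro k l
    rw [Complex.sq_norm, Complex.normSq_apply]
    simp
    ring
  have hnv : ∀ k, ‖v k‖ ^ 2 = (v k).re ^ 2 + (v k).im ^ 2 := fun k => by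
    rw [Complex.sq_norm, Complex.normSq_apply]; ring
  have h3 : ∀ k l, ‖((∑ b, rotHat α b l * freq m b : ℝ) : ℂ) * v k +
      ((∑ b, rotHat α b k * freq m b : ℝ) : ℂ) * v l‖ ^ 2 =
      (κ l * (v k).re + κ k * (v l).re) ^ 2 + (κ l * (v k).im + κ k * (v l).im) ^ 2 := hn
  simp only [h3, hnv, Finset.sum_add_distrib, ← Finset.mul_sum, mul_add]
  have e1 := sum_sq_mul_sum_sq_le κ fun k => (v k).re
  have e2 := sum_sq_mul_sum_sq_le κ fun k => (v k).im
  have e3 : ‖(1 / 2 : ℝ)‖ ^ 2 = 1 / 4 := by norm_num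
  rw [e3]
  linarith

lemma norm_sq_le_strain_cell {z : Jet 2 sqVol} (hz : z ∈ cellJets) (α : ℝ) :
    ‖z‖ ^ 2 ≤ 4 * ∑ k, ∑ l, ‖strainL sqVol (rotHat α) k l z‖ ^ 2 := by
  have h1 := korn_cell hz α
  have h2 := Finset.sum_le_sum fun k (_ : k ∈ Finset.univ) => poincare_cell hz k
  rw [Jet.norm_sq, Finset.sum_add_distrib]
  linarith

end

noncomputable section

/-! ### The elasticity tensors -/

variable {n : ℕ} {μ : Measure (Pt n)} {E₁ E₂ : Tensor4}

lemma mix_zero_or_one {χ : ℝ} (h : χ = 0 ∨ χ = 1) : mix E₁ E₂ χ = E₁ ∨ mix E₁ E₂ χ = E₂ := by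
  rcases h with rfl | rfl
  · right; funext i j k l; simp [mix]
  · left; funext i j k l; simp [mix]

lemma fibreChar_zero_or_one (a s t : ℝ) : fibreChar a s t = 0 ∨ fibreChar a s t = 1 := by
  unfold fibreChar
  split_ifs <;> simp

lemma measurable_fibreChar (a : ℝ) : Measurable fun s : ℝ × ℝ => fibreChar a s.1 s.2 := by
  unfold fibreChar
  refine Measurable.ite (measurableSet_le ?_ measurable_const) measurable_const measurable_const
  exact (((measurable_fract.comp measurable_fst).sub_const _).pow_const 2).add
    (((measurable_fract.comp measurable_snd).sub_const _).pow_const 2)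

lemma exists_coercive (hE₁ : IsStiffness E₁) (hE₂ : IsStiffness E₂) :
    ∃ c : ℝ, 0 < c ∧ ∀ E, (E = E₁ ∨ E = E₂) → ∀ ξ : Matrix (Fin 3) (Fin 3) ℝ, ξ.IsSymm →
      c * ddot ξ ξ ≤ ddot (E.app ξ) ξ := by
  obtain ⟨c₁, h₁, H₁⟩ := hE₁.posDef
  obtain ⟨c₂, h₂, H₂⟩ := hE₂.posDef
  refine ⟨min c₁ c₂, lt_min h₁ h₂, ?_⟩
  have hnn : ∀ ξ : Matrix (Fin 3) (Fin 3) ℝ, 0 ≤ ddot ξ ξ := fun ξ =>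
    Finset.sum_nonneg fun i _ => Finset.sum_nonneg fun j _ => mul_self_nonneg _
  rintro E (rfl | rfl) ξ hξ
  · exact (mul_le_mul_of_nonneg_right (min_le_left _ _) (hnn ξ)).trans (H₁ ξ hξ)
  · exact (mul_le_mul_of_nonneg_right (min_le_right _ _) (hnn ξ)).trans (H₂ ξ hξ)

variable (E₁ E₂) in
/-- A bound for all entries of the two tensors. -/
def tensorBound : ℝ := ∑ i, ∑ j, ∑ k, ∑ l, (|E₁ i j k l| + |E₂ i j k l|)

lemma abs_le_tensorBound {E : Tensor4} (hE : E = E₁ ∨ E = E₂) (i j k l : Fin 3) :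
    |E i j k l| ≤ tensorBound E₁ E₂ := by
  have h0 : ∀ i j k l, 0 ≤ |E₁ i j k l| + |E₂ i j k l| := fun i j k l => by positivity
  have h1 : |E₁ i j k l| + |E₂ i j k l| ≤ tensorBound E₁ E₂ := by
    refine le_trans ?_ (Finset.single_le_sum (fun i _ => Finset.sum_nonneg fun j _ =>
      Finset.sum_nonneg fun k _ => Finset.sum_nonneg fun l _ => h0 i j k l) (Finset.mem_univ i))
    refine le_trans ?_ (Finset.single_le_sum (fun j _ =>
      Finset.sum_nonneg fun k _ => Finset.sum_nonneg fun l _ => h0 i j k l) (Finset.mem_univ j))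
    refine le_trans ?_ (Finset.single_le_sum (fun k _ =>
      Finset.sum_nonneg fun l _ => h0 i j k l) (Finset.mem_univ k))
    exact Finset.single_le_sum (f := fun l => |E₁ i j k l| + |E₂ i j k l|)
      (fun l _ => h0 i j k l) (Finset.mem_univ l)
  rcases hE with rfl | rfl
  · linarith [abs_nonneg (E₂ i j k l)]
  · linarith [abs_nonneg (E₁ i j k l)]

lemma tensorBound_nonneg : 0 ≤ tensorBound E₁ E₂ :=
  (abs_nonneg _).trans (abs_le_tensorBound (Or.inl rfl) 0 0 0 0)

lemma isBddTensor_of_twoPhase {C : Pt n → Tensor4} (hC : ∀ x, C x = E₁ ∨ C x = E₂)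
    (hm : ∀ i j k l, AEStronglyMeasurable (fun x => C x i j k l) μ) : IsBddTensor μ C :=
  fun i j k l => memLp_top_of_bound (hm i j k l) (tensorBound E₁ E₂)
    (Eventually.of_forall fun x => abs_le_tensorBound (hC x) i j k l)

lemma minor_left_of_twoPhase (hE₁ : IsStiffness E₁) (hE₂ : IsStiffness E₂) {E : Tensor4}
    (hE : E = E₁ ∨ E = E₂) (i j k l : Fin 3) : E i j k l = E j i k l := by
  rcases hE with rfl | rfl
  · exact hE₁.minor_left i j k l
  · exact hE₂.minor_left i j k l

lemma minor_right_of_twoPhase (hE₁ : IsStiffness E₁) (hE₂ : IsStiffness E₂) {E : Tensor4}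
    (hE : E = E₁ ∨ E = E₂) (i j k l : Fin 3) : E i j k l = E i j l k := by
  rcases hE with rfl | rfl
  · exact hE₁.minor_right i j k l
  · exact hE₂.minor_right i j k l

lemma major_of_twoPhase (hE₁ : IsStiffness E₁) (hE₂ : IsStiffness E₂) {E : Tensor4}
    (hE : E = E₁ ∨ E = E₂) (i j k l : Fin 3) : E i j k l = E k l i j := by
  rcases hE with rfl | rfl
  · exact hE₁.major i j k l
  · exact hE₂.major i j k l

variable (a : ℝ)

lemma cellTensor_twoPhase (y : Pt 2) : cellTensor a E₁ E₂ y = E₁ ∨ cellTensor a E₁ E₂ y = E₂ :=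
  mix_zero_or_one (fibreChar_zero_or_one _ _ _)

lemma measurable_cellTensor (i j k l : Fin 3) :
    Measurable fun y => cellTensor a E₁ E₂ y i j k l := by
  have h : Measurable fun y : Pt 2 => fibreChar a (y 0) (y 1) :=
    (measurable_fibreChar a).comp ((by fun_prop : Measurable fun y : Pt 2 => y 0).prodMk
      (by fun_prop : Measurable fun y : Pt 2 => y 1))
  unfold cellTensor mix
  exact (h.const_mul _).add ((measurable_const.sub h).const_mul _)

lemma isBddTensor_cellTensor : IsBddTensor sqVol (cellTensor a E₁ E₂) :=
  isBddTensor_of_twoPhase (cellTensor_twoPhase a)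
    fun i j k l => (measurable_cellTensor a i j k l).aestronglyMeasurable

/-! ### Stresses and the cell problem -/

variable (μ) in
/-- The stress `C η` of a matrix of square integrable functions. -/
def stressL (C : Pt n → Tensor4) (η : Fin 3 → Fin 3 → Lp ℝ 2 μ) (p q : Fin 3) : Lp ℝ 2 μ :=
  ∑ k, ∑ l, mulL μ (fun x => C x p q k l) (η k l)

lemma sum_inner_stressL (C : Pt n → Tensor4) (η ζ : Fin 3 → Fin 3 → Lp ℝ 2 μ) :
    ∑ p, ∑ q, inner ℝ (stressL μ C η p q) (ζ p q) =
      ∑ i, ∑ j, ∑ k, ∑ l, inner ℝ (mulL μ (fun x => C x i j k l) (η k l)) (ζ i j) := by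
  simp only [stressL, sum_inner]

lemma stressL_add (C : Pt n → Tensor4) (η ζ : Fin 3 → Fin 3 → Lp ℝ 2 μ) (p q : Fin 3) :
    stressL μ C (fun k l => η k l + ζ k l) p q = stressL μ C η p q + stressL μ C ζ p q := by
  simp only [stressL, map_add, Finset.sum_add_distrib]

lemma stressL_sub (C : Pt n → Tensor4) (η ζ : Fin 3 → Fin 3 → Lp ℝ 2 μ) (p q : Fin 3) :
    stressL μ C (fun k l => η k l - ζ k l) p q = stressL μ C η p q - stressL μ C ζ p q := by
  simp only [stressL, map_sub, Finset.sum_sub_distrib]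

lemma stressL_smul (C : Pt n → Tensor4) (c : ℝ) (η : Fin 3 → Fin 3 → Lp ℝ 2 μ) (p q : Fin 3) :
    stressL μ C (c • η) p q = c • stressL μ C η p q := by
  simp only [stressL, Pi.smul_apply, map_smul, Finset.smul_sum]

lemma stressL_sum {ι : Type*} (s : Finset ι) (C : Pt n → Tensor4)
    (η : ι → Fin 3 → Fin 3 → Lp ℝ 2 μ) (p q : Fin 3) :
    stressL μ C (∑ i ∈ s, η i) p q = ∑ i ∈ s, stressL μ C (η i) p q := by
  simp only [stressL, Finset.sum_apply, map_sum]
  rw [Finset.sum_congr rfl fun k _ => Finset.sum_comm, Finset.sum_comm]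

lemma coeFn_stressL {C : Pt n → Tensor4} (hC : IsBddTensor μ C)
    (η : Fin 3 → Fin 3 → Lp ℝ 2 μ) (p q : Fin 3) :
    stressL μ C η p q =ᵐ[μ] fun x => (C x).app (Matrix.of fun k l => η k l x) p q := by
  have h1 : ∀ k, ∀ᵐ x ∂μ, (∑ l, mulL μ (fun x => C x p q k l) (η k l) : Lp ℝ 2 μ) x =
      ∑ l, C x p q k l * η k l x := by
    intro k
    filter_upwards [coeFn_finsetSum Finset.univ fun l => mulL μ (fun x => C x p q k l) (η k l),
      ae_all_iff.2 fun l => coeFn_mulL (hC p q k l) (η k l)] with x hx hx'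
    rw [hx]
    exact Finset.sum_congr rfl fun l _ => hx' l
  filter_upwards [coeFn_finsetSum Finset.univ fun k =>
    ∑ l, mulL μ (fun x => C x p q k l) (η k l), ae_all_iff.2 h1] with x hx hx'
  rw [stressL, hx]
  simp only [hx', Tensor4.app, Matrix.of_apply]

lemma stressL_comm {C : Pt n → Tensor4} (hC : ∀ x i j k l, C x i j k l = C x j i k l)
    (η : Fin 3 → Fin 3 → Lp ℝ 2 μ) (p q : Fin 3) : stressL μ C η p q = stressL μ C η q p := by
  simp only [stressL, fun x k l => hC x p q k l]

/-- The constant function one on the unit square. -/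
def oneLp : Lp ℝ 2 sqVol := Lp.const 2 sqVol (1 : ℝ)

lemma coeFn_smul_oneLp_add (c : ℝ) (f : Lp ℝ 2 sqVol) :
    (c • oneLp + f : Lp ℝ 2 sqVol) =ᵐ[sqVol] fun y => c + f y := by
  filter_upwards [Lp.coeFn_add (c • oneLp) f, Lp.coeFn_smul c oneLp,
    Lp.coeFn_const (p := 2) (μ := sqVol) (1 : ℝ)] with y h1 h2 h3
  rw [h1, Pi.add_apply, h2, Pi.smul_apply, oneLp, h3]
  simp

lemma inner_oneLp (f : Lp ℝ 2 sqVol) : inner ℝ oneLp f = ∫ y in unitSquare, f y := by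
  rw [inner_eq_integral_mul]
  refine integral_congr_ae ?_
  filter_upwards [Lp.coeFn_const (p := 2) (μ := sqVol) (1 : ℝ)] with y h
  rw [oneLp, h]
  simp

lemma norm_oneLp : ‖oneLp‖ = 1 := by
  have h : ‖oneLp‖ ^ 2 = 1 := by
    rw [← real_inner_self_eq_norm_sq, inner_oneLp, oneLp]
    exact (integral_congr_ae (Lp.coeFn_const (p := 2) (μ := sqVol) (1 : ℝ))).trans (by simp)
  nlinarith [norm_nonneg oneLp]

/-- The strain of a periodic field has mean zero. -/
lemma inner_oneLp_strainL {z : Jet 2 sqVol} (hz : z ∈ cellJets) (R : Matrix (Fin 2) (Fin 3) ℝ)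
    (k l : Fin 3) : inner ℝ oneLp (strainL sqVol R k l z) = 0 := by
  have h := fcL_strainL hz R k l 0
  rw [fcL_zero, hz.2 k, hz.2 l] at h
  rw [inner_oneLp]
  simpa using h

variable (E₁ E₂) in
/-- The stress in the unit cell that belongs to the macroscopic strain `l_{ij}` and to the jet `z`
of a corrector. -/
def cellStress (α : ℝ) (i j : Fin 3) (z : Jet 2 sqVol) (p q : Fin 3) : Lp ℝ 2 sqVol :=
  stressL sqVol (cellTensor a E₁ E₂)
    (fun k l => symUnit i j k l • oneLp + strainL sqVol (rotHat α) k l z) p q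

variable (E₁ E₂) in
/-- The functional `v ↦ ∫ Ã l_{ij} : ê(v)`, the right-hand side of the cell problem up to the
sign. -/
def cellLoad (α : ℝ) (i j : Fin 3) : Jet 2 sqVol →L[ℝ] ℝ :=
  ∑ p, ∑ q, innerSL ℝ (stressL sqVol (cellTensor a E₁ E₂) (fun k l => symUnit i j k l • oneLp) p q)
    ∘L strainL sqVol (rotHat α) p q

lemma cellLoad_apply (α : ℝ) (i j : Fin 3) (v : Jet 2 sqVol) :
    cellLoad E₁ E₂ a α i j v = ∑ p, ∑ q,
      inner ℝ (stressL sqVol (cellTensor a E₁ E₂) (fun k l => symUnit i j k l • oneLp) p q)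
        (strainL sqVol (rotHat α) p q v) := by
  simp [cellLoad]

lemma sum_inner_cellStress (α : ℝ) (i j : Fin 3) (z v : Jet 2 sqVol) :
    ∑ p, ∑ q, inner ℝ (cellStress E₁ E₂ a α i j z p q) (strainL sqVol (rotHat α) p q v) =
      elForm sqVol (cellTensor a E₁ E₂) (rotHat α) z v + cellLoad E₁ E₂ a α i j v := by
  rw [elForm_apply, ← sum_inner_stressL, cellLoad_apply]
  simp only [cellStress, stressL_add, inner_add_left, Finset.sum_add_distrib]
  ring

lemma elForm_cell_coercive {c : ℝ} (hc0 : 0 < c)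
    (hc : ∀ E, (E = E₁ ∨ E = E₂) → ∀ ξ : Matrix (Fin 3) (Fin 3) ℝ, ξ.IsSymm →
      c * ddot ξ ξ ≤ ddot (E.app ξ) ξ) (α : ℝ) {z : Jet 2 sqVol} (hz : z ∈ cellJets) :
    c / 4 * ‖z‖ ^ 2 ≤ elForm sqVol (cellTensor a E₁ E₂) (rotHat α) z z := by
  have h1 := le_elForm_self (isBddTensor_cellTensor a) (c := c)
    (Eventually.of_forall fun y => hc _ (cellTensor_twoPhase a y)) (rotHat α) z
  have h2 := norm_sq_le_strain_cell hz α
  nlinarith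

lemma exists_cellJet (hE₁ : IsStiffness E₁) (hE₂ : IsStiffness E₂) (α : ℝ) (i j : Fin 3) :
    ∃ z ∈ cellJets, ∀ v ∈ cellJets,
      elForm sqVol (cellTensor a E₁ E₂) (rotHat α) z v = -cellLoad E₁ E₂ a α i j v := by
  obtain ⟨c, hc0, hc⟩ := exists_coercive hE₁ hE₂
  exact exists_mem_form_eq cellJets isClosed_cellJets _ (c := c / 4) (by positivity)
    (fun v hv => elForm_cell_coercive a hc0 hc α hv) (-cellLoad E₁ E₂ a α i j)

/-- The jet of the solution of mean zero of the cell problem. -/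
def cellJet (hE₁ : IsStiffness E₁) (hE₂ : IsStiffness E₂) (α : ℝ) (i j : Fin 3) : Jet 2 sqVol :=
  (exists_cellJet a hE₁ hE₂ α i j).choose

variable (hE₁ : IsStiffness E₁) (hE₂ : IsStiffness E₂)

lemma cellJet_mem (α : ℝ) (i j : Fin 3) : cellJet a hE₁ hE₂ α i j ∈ cellJets :=
  (exists_cellJet a hE₁ hE₂ α i j).choose_spec.1

lemma elForm_cellJet (α : ℝ) (i j : Fin 3) {v : Jet 2 sqVol} (hv : v ∈ cellJets) :
    elForm sqVol (cellTensor a E₁ E₂) (rotHat α) (cellJet a hE₁ hE₂ α i j) v =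
      -cellLoad E₁ E₂ a α i j v :=
  (exists_cellJet a hE₁ hE₂ α i j).choose_spec.2 v hv

lemma strainL_congr {z z' : Jet n μ} (h : ∀ k b, z (k, some b) = z' (k, some b))
    (R : Matrix (Fin n) (Fin 3) ℝ) (k l : Fin 3) : strainL μ R k l z = strainL μ R k l z' := by
  rw [strainL_apply, strainL_apply]
  simp only [h]

lemma sum_inner_cellStress_cellJet (α : ℝ) (i j : Fin 3) {v : Field3 2} {Dv : Grad3 2}
    (hv : IsH1Per v Dv) :
    ∑ p, ∑ q, inner ℝ (cellStress E₁ E₂ a α i j (cellJet a hE₁ hE₂ α i j) p q)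
      (strainL sqVol (rotHat α) p q hv.isL2Jet.toJet) = 0 := by
  obtain ⟨z, hz, hzv⟩ := hv.exists_mem_cellJets
  simp only [← strainL_congr hzv]
  rw [sum_inner_cellStress, elForm_cellJet a hE₁ hE₂ α i j hz, neg_add_cancel]

lemma strain_rotHat (α : ℝ) (d : Fin 3 → Fin 2 → ℝ) :
    strain (fun i => (rotHat α)ᵀ *ᵥ d i) = rotStrain α d := by
  ext k l
  simp only [strain, rotStrain, Matrix.of_apply, add_comm]

lemma cellLoad_toJet (α : ℝ) (i j : Fin 3) {v : Field3 2} {Dv : Grad3 2}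
    (h : IsL2Jet sqVol v Dv) :
    cellLoad E₁ E₂ a α i j h.toJet = ∫ y in unitSquare,
      ddot ((cellTensor a E₁ E₂ y).app (symUnit i j)) (rotStrain α (Dv y)) := by
  rw [cellLoad_apply, sum_inner_stressL,
    (sum_inner_mulL_eq_integral (isBddTensor_cellTensor a) _ _).2]
  refine integral_congr_ae ?_
  have h0 : ∀ k l, ∀ᵐ y ∂sqVol, (symUnit i j k l • oneLp : Lp ℝ 2 sqVol) y = symUnit i j k l := by
    intro k l
    have h := coeFn_smul_oneLp_add (symUnit i j k l) 0
    rw [add_zero] at h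
    filter_upwards [h, Lp.coeFn_zero ℝ 2 sqVol] with y h1 h2
    rw [h1, h2]
    simp
  filter_upwards [ae_strainL_eq (rotHat α) h, ae_all_iff.2 fun k => ae_all_iff.2 (h0 k)]
    with y h1 h2
  simp only [h1, h2, strain_rotHat]
  rfl

lemma elForm_cell_toJet (α : ℝ) {w v : Field3 2} {Dw Dv : Grad3 2}
    (hw : IsL2Jet sqVol w Dw) (hv : IsL2Jet sqVol v Dv) :
    elForm sqVol (cellTensor a E₁ E₂) (rotHat α) hw.toJet hv.toJet = ∫ y in unitSquare,
      ddot ((cellTensor a E₁ E₂ y).app (rotStrain α (Dw y))) (rotStrain α (Dv y)) := by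
  rw [elForm_toJet (isBddTensor_cellTensor a)]
  simp only [strain_rotHat]

lemma elForm_congr {C : Pt n → Tensor4} {R : Matrix (Fin n) (Fin 3) ℝ} {z z' v v' : Jet n μ}
    (h : ∀ k b, z (k, some b) = z' (k, some b)) (h' : ∀ k b, v (k, some b) = v' (k, some b)) :
    elForm μ C R z v = elForm μ C R z' v' := by
  simp only [elForm_apply, strainL_congr h, strainL_congr h']

/-- The cell problem has a solution. -/
lemma isCellSolution_cellJet (α : ℝ) (i j : Fin 3) :
    IsCellSolution a E₁ E₂ α i j (fun y => (cellJet a hE₁ hE₂ α i j).val (fractPt y))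
      (fun y => (cellJet a hE₁ hE₂ α i j).grad (fractPt y)) := by
  have hper := isH1Per_of_mem_cellJets (cellJet_mem a hE₁ hE₂ α i j)
  refine ⟨hper, fun v Dv hv => ?_⟩
  rw [← elForm_cell_toJet a α hper.isL2Jet hv.isL2Jet, ← cellLoad_toJet a α i j hv.isL2Jet]
  obtain ⟨z, hz, hzv⟩ := hv.exists_mem_cellJets
  have e : ∀ k b, hper.isL2Jet.toJet (k, some b) = cellJet a hE₁ hE₂ α i j (k, some b) :=
    fun k b => toLp_comp_fractPt _
  rw [elForm_congr e fun k b => (hzv k b).symm, elForm_cellJet a hE₁ hE₂ α i j hz, cellLoad_apply,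
    cellLoad_apply]
  simp only [strainL_congr hzv]

/-- The gradient of the solution of the cell problem is unique. -/
lemma IsCellSolution.toJet_eq {α : ℝ} {i j : Fin 3} {w : Field3 2} {Dw : Grad3 2}
    (h : IsCellSolution a E₁ E₂ α i j w Dw) (k : Fin 3) (b : Fin 2) :
    h.isH1Per.isL2Jet.toJet (k, some b) = cellJet a hE₁ hE₂ α i j (k, some b) := by
  obtain ⟨c, hc0, hc⟩ := exists_coercive hE₁ hE₂
  obtain ⟨z, hz, hzw⟩ := h.isH1Per.exists_mem_cellJets
  set d := z - cellJet a hE₁ hE₂ α i j with hd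
  have hdm : d ∈ cellJets := cellJets.sub_mem hz (cellJet_mem a hE₁ hE₂ α i j)
  have hper := isH1Per_of_mem_cellJets hdm
  have e : ∀ k b, d (k, some b) = hper.isL2Jet.toJet (k, some b) :=
    fun k b => (toLp_comp_fractPt _).symm
  have h1 := h.weak _ _ hper
  rw [← elForm_cell_toJet a α h.isH1Per.isL2Jet hper.isL2Jet,
    ← cellLoad_toJet a α i j hper.isL2Jet,
    ← elForm_congr hzw e] at h1
  have h2 : elForm sqVol (cellTensor a E₁ E₂) (rotHat α) z d = -cellLoad E₁ E₂ a α i j d := by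
    rw [h1, cellLoad_apply, cellLoad_apply]
    simp only [strainL_congr e]
  have h3 : elForm sqVol (cellTensor a E₁ E₂) (rotHat α) d d = 0 := by
    have e : elForm sqVol (cellTensor a E₁ E₂) (rotHat α) d =
        elForm sqVol (cellTensor a E₁ E₂) (rotHat α) z -
          elForm sqVol (cellTensor a E₁ E₂) (rotHat α) (cellJet a hE₁ hE₂ α i j) := map_sub _ _ _
    rw [e, _root_.sub_apply, h2, elForm_cellJet a hE₁ hE₂ α i j hdm, sub_self]
  have h4 := elForm_cell_coercive a hc0 hc α hdm
  rw [h3] at h4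
  have h5 : d = 0 := by
    have : ‖d‖ ^ 2 ≤ 0 := by
      by_contra hne
      have : 0 < c / 4 * ‖d‖ ^ 2 := mul_pos (by positivity) (not_le.1 hne)
      linarith
    exact norm_eq_zero.1 (pow_eq_zero_iff (two_ne_zero) |>.1 (le_antisymm this (sq_nonneg _)))
  rw [← hzw, sub_eq_zero.1 h5]

/-! ### The homogenized tensor -/

/-- The homogenized tensor at angle `α`: the mean of the cell stress of the correctors of mean
zero. -/
def homA (α : ℝ) : Tensor4 := fun i j k l =>
  inner ℝ oneLp (cellStress E₁ E₂ a α i j (cellJet a hE₁ hE₂ α i j) k l)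

lemma sum_mul_symUnit (A : Fin 3 → Fin 3 → ℝ) (i j : Fin 3) :
    ∑ p, ∑ q, A p q * symUnit i j p q = (A i j + A j i) / 2 := by
  simp only [symUnit, Matrix.smul_apply, Matrix.add_apply, Matrix.single_apply, smul_eq_mul]
  simp only [mul_add, Finset.sum_add_distrib, mul_ite, mul_one, mul_zero, ite_and,
    Finset.sum_ite_irrel, Finset.sum_ite_eq, Finset.mem_univ, if_true, Finset.sum_const_zero]
  ring

lemma sum_symUnit_mul {ξ : Matrix (Fin 3) (Fin 3) ℝ} (hξ : ξ.IsSymm) (k l : Fin 3) :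
    ∑ i, ∑ j, ξ i j * symUnit i j k l = ξ k l := by
  have e : ∀ i j, symUnit i j k l = symUnit k l i j := by
    intro i j
    simp only [symUnit, Matrix.smul_apply, Matrix.add_apply, Matrix.single_apply, smul_eq_mul]
    congr 2
    · simp only [eq_comm]
    · simp only [eq_comm, and_comm]
  simp only [e]
  refine (sum_mul_symUnit (fun i j => ξ i j) k l).trans ?_
  rw [hξ.apply]
  ring

/-- The homogenized tensor does not depend on the choice of the solutions of the cell problems. -/
lemma homTensor_eq_homA {α : ℝ} {W : Fin 3 → Fin 3 → Field3 2} {DW : Fin 3 → Fin 3 → Grad3 2}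
    (h : ∀ i j, IsCellSolution a E₁ E₂ α i j (W i j) (DW i j)) :
    homTensor a E₁ E₂ α DW = homA a hE₁ hE₂ α := by
  funext i j k l
  have hz := (h i j).toJet_eq a hE₁ hE₂
  have hL := (h i j).isH1Per.isL2Jet
  rw [homTensor, setAverage_eq, homA, inner_oneLp]
  have h1 : (volume.real unitSquare)⁻¹ = 1 := by simp [Measure.real, volume_unitSquare]
  rw [h1, one_smul]
  refine integral_congr_ae ?_
  have hs : ∀ p q, strainL sqVol (rotHat α) p q (cellJet a hE₁ hE₂ α i j) =
      strainL sqVol (rotHat α) p q hL.toJet := fun p q =>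
    strainL_congr (fun k b => (hz k b).symm) _ _ _
  filter_upwards [coeFn_stressL (isBddTensor_cellTensor (E₁ := E₁) (E₂ := E₂) a)
    (fun k l => symUnit i j k l • oneLp +
      strainL sqVol (rotHat α) k l (cellJet a hE₁ hE₂ α i j)) k l,
    ae_all_iff.2 fun p => ae_all_iff.2 fun q => coeFn_smul_oneLp_add (symUnit i j p q)
      (strainL sqVol (rotHat α) p q (cellJet a hE₁ hE₂ α i j)),
    ae_strainL_eq (rotHat α) hL] with y h1 h2 h3
  rw [cellStress, h1]
  have h4 : ∀ p q, strainL sqVol (rotHat α) p q (cellJet a hE₁ hE₂ α i j) y =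
      rotStrain α (DW i j y) p q := by
    intro p q
    rw [hs, ← strain_rotHat, ← h3]
    rfl
  simp only [Tensor4.app, Matrix.of_apply, h2, h4, mul_add, Finset.sum_add_distrib]
  rw [sum_mul_symUnit (fun p q => cellTensor a E₁ E₂ y k l p q)]
  have hy := cellTensor_twoPhase (E₁ := E₁) (E₂ := E₂) a y
  rw [← minor_right_of_twoPhase hE₁ hE₂ hy k l i j, major_of_twoPhase hE₁ hE₂ hy k l i j]
  ring

/-- The homogenized tensor is coercive, with the constant of the two phases. -/
lemma homA_coercive {c : ℝ} (hc0 : 0 < c)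
    (hc : ∀ E, (E = E₁ ∨ E = E₂) → ∀ ξ : Matrix (Fin 3) (Fin 3) ℝ, ξ.IsSymm →
      c * ddot ξ ξ ≤ ddot (E.app ξ) ξ) (α : ℝ) {ξ : Matrix (Fin 3) (Fin 3) ℝ} (hξ : ξ.IsSymm) :
    c * ddot ξ ξ ≤ ddot ((homA a hE₁ hE₂ α).app ξ) ξ := by
  set z : Jet 2 sqVol := ∑ i, ∑ j, ξ i j • cellJet a hE₁ hE₂ α i j with hz
  have hzm : z ∈ cellJets := cellJets.sum_mem fun i _ => cellJets.sum_mem fun j _ =>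
    cellJets.smul_mem _ (cellJet_mem a hE₁ hE₂ α i j)
  set η : Fin 3 → Fin 3 → Lp ℝ 2 sqVol := fun k l =>
    ξ k l • oneLp + strainL sqVol (rotHat α) k l z with hη
  have hηs : ∀ k l, η k l = η l k := fun k l => by
    simp only [hη, strainL_comm (rotHat α) k l, hξ.apply l k]
  have h1 := le_sum_inner_mulL (isBddTensor_cellTensor (E₁ := E₁) (E₂ := E₂) a) (c := c)
    (Eventually.of_forall fun y => hc _ (cellTensor_twoPhase a y)) hηs
  rw [← sum_inner_stressL] at h1
  have h2 : ddot ξ ξ ≤ ∑ k, ∑ l, ‖η k l‖ ^ 2 := by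
    refine Finset.sum_le_sum fun k _ => Finset.sum_le_sum fun l _ => ?_
    have h3 : inner ℝ oneLp (η k l) = ξ k l := by
      simp only [hη]
      rw [inner_add_right, inner_smul_right, real_inner_self_eq_norm_sq, norm_oneLp,
        inner_oneLp_strainL hzm]
      ring
    have h4 := abs_real_inner_le_norm oneLp (η k l)
    rw [h3, norm_oneLp, one_mul] at h4
    rw [← sq, ← sq_abs]
    exact pow_le_pow_left₀ (abs_nonneg _) h4 2
  have hη' : ∀ k l, η k l = ∑ i, ∑ j, ξ i j • (symUnit i j k l • oneLp +
      strainL sqVol (rotHat α) k l (cellJet a hE₁ hE₂ α i j)) := by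
    intro k l
    simp only [hη, hz, map_sum, map_smul, smul_add, Finset.sum_add_distrib, smul_smul,
      ← Finset.sum_smul, sum_symUnit_mul hξ]
  have h5 : ∀ p q, stressL sqVol (cellTensor a E₁ E₂) η p q =
      ∑ i, ∑ j, ξ i j • cellStress E₁ E₂ a α i j (cellJet a hE₁ hE₂ α i j) p q := by
    intro p q
    rw [show η = ∑ i, ∑ j, ξ i j • (fun k l => symUnit i j k l • oneLp +
      strainL sqVol (rotHat α) k l (cellJet a hE₁ hE₂ α i j)) from by
        funext k l
        simp only [hη', Finset.sum_apply, Pi.smul_apply], stressL_sum]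
    refine Finset.sum_congr rfl fun i _ => ?_
    rw [stressL_sum]
    exact Finset.sum_congr rfl fun j _ => stressL_smul _ _ _ _ _
  have h6 : ∑ p, ∑ q, inner ℝ (stressL sqVol (cellTensor a E₁ E₂) η p q)
      (strainL sqVol (rotHat α) p q z) = 0 := by
    have e : ∑ p, ∑ q, inner ℝ (stressL sqVol (cellTensor a E₁ E₂) η p q)
      (strainL sqVol (rotHat α) p q z) = ∑ i, ∑ j, ξ i j * ∑ p, ∑ q,
        inner ℝ (cellStress E₁ E₂ a α i j (cellJet a hE₁ hE₂ α i j) p q)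
          (strainL sqVol (rotHat α) p q z) := by
      simp only [h5, sum_inner, real_inner_smul_left, Finset.mul_sum]
      rw [Finset.sum_congr rfl fun p _ => Finset.sum_comm, Finset.sum_comm]
      refine Finset.sum_congr rfl fun i _ => ?_
      rw [Finset.sum_congr rfl fun p _ => Finset.sum_comm, Finset.sum_comm]
    rw [e]
    refine Finset.sum_eq_zero fun i _ => Finset.sum_eq_zero fun j _ => ?_
    rw [sum_inner_cellStress, elForm_cellJet a hE₁ hE₂ α i j hzm, neg_add_cancel, mul_zero]
  have h7 : ∑ p, ∑ q, inner ℝ (stressL sqVol (cellTensor a E₁ E₂) η p q) (η p q) =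
      ddot ((homA a hE₁ hE₂ α).app ξ) ξ := by
    have e : ∀ p q, inner ℝ (stressL sqVol (cellTensor a E₁ E₂) η p q) (η p q) =
        ξ p q * (∑ i, ∑ j, ξ i j * homA a hE₁ hE₂ α i j p q) +
        inner ℝ (stressL sqVol (cellTensor a E₁ E₂) η p q)
          (strainL sqVol (rotHat α) p q z) := by
      intro p q
      conv_lhs => rw [show η p q = ξ p q • oneLp + strainL sqVol (rotHat α) p q z from rfl]
      rw [inner_add_right, inner_smul_right]
      congr 2
      rw [h5, sum_inner]
      refine Finset.sum_congr rfl fun i _ => ?_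
      rw [sum_inner]
      refine Finset.sum_congr rfl fun j _ => ?_
      rw [real_inner_smul_left, real_inner_comm, homA]
    simp only [e, Finset.sum_add_distrib]
    rw [h6, add_zero]
    simp only [ddot, Tensor4.app, Matrix.of_apply, Finset.mul_sum, Finset.sum_mul]
    rw [Finset.sum_congr rfl fun p _ => Finset.sum_comm, Finset.sum_comm]
    refine Finset.sum_congr rfl fun i _ => ?_
    rw [Finset.sum_congr rfl fun p _ => Finset.sum_comm, Finset.sum_comm]
    refine Finset.sum_congr rfl fun j _ => Finset.sum_congr rfl fun p _ =>
      Finset.sum_congr rfl fun q _ => by ring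
  rw [h7] at h1
  exact (mul_le_mul_of_nonneg_left h2 hc0.le).trans h1

end

noncomputable section

/-! ### Dependence of the cell problem on the angle -/

variable {n : ℕ} {μ : Measure (Pt n)} {E₁ E₂ : Tensor4} (a : ℝ)

lemma continuous_rotHat (b : Fin 2) (k : Fin 3) : Continuous fun α => rotHat α b k := by
  fin_cases b <;> fin_cases k <;> simp [rotHat] <;> fun_prop

lemma continuous_strainL (k l : Fin 3) : Continuous fun α => strainL sqVol (rotHat α) k l := by
  have h := continuous_rotHat
  unfold strainL
  fun_prop

lemma continuous_cellStress (i j p q : Fin 3) {z : ℝ → Jet 2 sqVol} (hz : Continuous z) :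
    Continuous fun α => cellStress E₁ E₂ a α i j (z α) p q := by
  unfold cellStress stressL
  exact continuous_finsetSum _ fun k _ => continuous_finsetSum _ fun l _ =>
    (mulL sqVol _).continuous.comp
      (continuous_const.add ((continuous_strainL k l).clm_apply hz))

variable (E₁ E₂) in
/-- The residual of the cell problem as a functional on all jets. -/
def cellResidual (α : ℝ) (i j : Fin 3) (z : Jet 2 sqVol) : Jet 2 sqVol →L[ℝ] ℝ :=
  ∑ p, ∑ q, innerSL ℝ (cellStress E₁ E₂ a α i j z p q) ∘L strainL sqVol (rotHat α) p q

lemma cellResidual_apply (α : ℝ) (i j : Fin 3) (z v : Jet 2 sqVol) :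
    cellResidual E₁ E₂ a α i j z v =
      elForm sqVol (cellTensor a E₁ E₂) (rotHat α) z v + cellLoad E₁ E₂ a α i j v := by
  rw [← sum_inner_cellStress]
  simp [cellResidual]

lemma continuous_cellResidual (i j : Fin 3) (z : Jet 2 sqVol) :
    Continuous fun α => cellResidual E₁ E₂ a α i j z := by
  unfold cellResidual
  exact continuous_finsetSum _ fun p _ => continuous_finsetSum _ fun q _ =>
    ((innerSL ℝ).continuous.comp (continuous_cellStress a i j p q continuous_const)).clm_comp
      (continuous_strainL p q)

variable (hE₁ : IsStiffness E₁) (hE₂ : IsStiffness E₂)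

/-- The solution of the cell problem depends continuously on the angle, since the residual does and
the cell forms are uniformly coercive. -/
lemma continuous_cellJet (i j : Fin 3) : Continuous fun α => cellJet a hE₁ hE₂ α i j := by
  obtain ⟨c, hc0, hc⟩ := exists_coercive hE₁ hE₂
  rw [continuous_iff_continuousAt]
  intro β
  set zβ := cellJet a hE₁ hE₂ β i j with hzβ
  have key : ∀ α, c / 4 * ‖cellJet a hE₁ hE₂ α i j - zβ‖ ≤
      ‖cellResidual E₁ E₂ a β i j zβ - cellResidual E₁ E₂ a α i j zβ‖ := by
    intro α
    set d := cellJet a hE₁ hE₂ α i j - zβ with hd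
    have hdm : d ∈ cellJets :=
      cellJets.sub_mem (cellJet_mem a hE₁ hE₂ α i j) (cellJet_mem a hE₁ hE₂ β i j)
    have h1 := elForm_cell_coercive a hc0 hc α hdm
    have h2 : elForm sqVol (cellTensor a E₁ E₂) (rotHat α) d d =
        (cellResidual E₁ E₂ a β i j zβ - cellResidual E₁ E₂ a α i j zβ) d := by
      have e : elForm sqVol (cellTensor a E₁ E₂) (rotHat α) d =
        elForm sqVol (cellTensor a E₁ E₂) (rotHat α) (cellJet a hE₁ hE₂ α i j) -
          elForm sqVol (cellTensor a E₁ E₂) (rotHat α) zβ := map_sub _ _ _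
      rw [e, _root_.sub_apply, _root_.sub_apply, elForm_cellJet a hE₁ hE₂ α i j hdm,
        cellResidual_apply, cellResidual_apply, elForm_cellJet a hE₁ hE₂ β i j hdm]
      ring
    rw [h2] at h1
    have h3 := (le_abs_self _).trans
      ((cellResidual E₁ E₂ a β i j zβ - cellResidual E₁ E₂ a α i j zβ).le_opNorm d)
    rcases (norm_nonneg d).eq_or_lt with h0 | h0
    · rw [← h0, mul_zero]
      exact norm_nonneg _
    · refine le_of_mul_le_mul_right ?_ h0
      calc c / 4 * ‖d‖ * ‖d‖ = c / 4 * ‖d‖ ^ 2 := by ring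
        _ ≤ _ := h1
        _ ≤ _ := h3
  have h4 : Tendsto (fun α => (4 / c) *
      ‖cellResidual E₁ E₂ a β i j zβ - cellResidual E₁ E₂ a α i j zβ‖) (𝓝 β) (𝓝 0) := by
    have h5 := ((continuous_const (y := cellResidual E₁ E₂ a β i j zβ)).sub
      (continuous_cellResidual (E₁ := E₁) (E₂ := E₂) a i j zβ)).norm.const_mul (4 / c)
    have h6 := h5.tendsto β
    simpa only [Pi.sub_apply, sub_self, norm_zero, mul_zero] using h6
  refine tendsto_iff_norm_sub_tendsto_zero.2 (squeeze_zero (fun _ => norm_nonneg _) (fun α => ?_) h4)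
  have h7 := key α
  rw [show ‖cellJet a hE₁ hE₂ α i j - zβ‖ = 4 / c * (c / 4 * ‖cellJet a hE₁ hE₂ α i j - zβ‖) by
    field_simp]
  exact mul_le_mul_of_nonneg_left h7 (by positivity)

lemma continuous_homA (i j k l : Fin 3) : Continuous fun α => homA a hE₁ hE₂ α i j k l :=
  (innerSL ℝ oneLp).continuous.comp
    (continuous_cellStress a i j k l (continuous_cellJet a hE₁ hE₂ i j))

/-! ### Truncated Fourier series of correctors and stresses -/

/-- The partial sum of the Fourier series. -/
def fourierSum (S : Finset (Fin 2 → ℤ)) (f : Lp ℝ 2 sqVol) : Lp ℝ 2 sqVol :=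
  ∑ m ∈ S, waveLp (fcL m f) (freq m)

/-- On a compact set of functions the partial sums converge uniformly, by Dini's theorem for the
tails in Parseval's identity. -/
lemma eventually_norm_sub_fourierSum_le {K : Set (Lp ℝ 2 sqVol)} (hK : IsCompact K) {η : ℝ}
    (hη : 0 < η) : ∀ᶠ S in atTop, ∀ f ∈ K, ‖f - fourierSum S f‖ ≤ η := by
  have h := Monotone.tendstoUniformlyOn_of_forall_tendsto
    (F := fun (S : Finset (Fin 2 → ℤ)) (f : Lp ℝ 2 sqVol) => ∑ m ∈ S, ‖fcL m f‖ ^ 2)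
    (f := fun f => ‖f‖ ^ 2) hK
    (fun S => (continuous_finsetSum _ fun m _ => ((fcL m).continuous.norm.pow 2)).continuousOn)
    (fun f _ S T hST => Finset.sum_le_sum_of_subset_of_nonneg hST fun m _ _ => sq_nonneg _)
    (continuous_norm.pow 2).continuousOn (fun f _ => hasSum_norm_fcL_sq f)
  rw [Metric.tendstoUniformlyOn_iff] at h
  filter_upwards [h (η ^ 2) (by positivity)] with S hS f hf
  have h1 := hS f hf
  rw [Real.dist_eq] at h1
  have h2 := (norm_sub_partialSum_sq_le S f).trans ((le_abs_self _).trans h1.le)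
  exact le_of_sq_le_sq h2 hη.le

/-- Componentwise truncation of the Fourier series of a jet. -/
def truncJet (S : Finset (Fin 2 → ℤ)) (z : Jet 2 sqVol) : Jet 2 sqVol :=
  WithLp.toLp 2 fun p => fourierSum S (z p)

lemma eventually_norm_sub_truncJet_le {K : Set (Jet 2 sqVol)} (hK : IsCompact K) {η : ℝ}
    (hη : 0 < η) : ∀ᶠ S in atTop, ∀ z ∈ K, ‖z - truncJet S z‖ ≤ η := by
  have h : ∀ᶠ S in atTop, ∀ p : Fin 3 × Option (Fin 2), ∀ z ∈ K,
      ‖z p - fourierSum S (z p)‖ ≤ η / 3 := by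
    rw [eventually_all]
    intro p
    have := eventually_norm_sub_fourierSum_le (hK.image (continuous_jet_apply p))
      (show 0 < η / 3 by positivity)
    filter_upwards [this] with S hS z hz
    exact hS _ (mem_image_of_mem _ hz)
  filter_upwards [h] with S hS z hz
  refine le_of_sq_le_sq ?_ hη.le
  rw [PiLp.norm_sq_eq_of_L2]
  calc ∑ p, ‖(z - truncJet S z) p‖ ^ 2 ≤ ∑ _p : Fin 3 × Option (Fin 2), (η / 3) ^ 2 :=
        Finset.sum_le_sum fun p _ => pow_le_pow_left₀ (norm_nonneg _) (hS p z hz) 2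
    _ = η ^ 2 := by
      rw [Finset.sum_const, Finset.card_univ, Fintype.card_prod, Fintype.card_option,
        Fintype.card_fin, Fintype.card_fin]
      norm_num
      ring

/-- The error in the balance of stresses if corrector and stress are replaced by their truncated
Fourier series. -/
def cellError (S : Finset (Fin 2 → ℤ)) (α : ℝ) (i j p q : Fin 3) : Lp ℝ 2 sqVol :=
  cellStress E₁ E₂ a α i j (truncJet S (cellJet a hE₁ hE₂ α i j)) p q -
    fourierSum S (cellStress E₁ E₂ a α i j (cellJet a hE₁ hE₂ α i j) p q)

lemma exists_norm_cellStress_sub_le : ∃ C : ℝ, 0 < C ∧ ∀ α ∈ Icc 0 Real.pi, ∀ i j p q z z',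
    ‖cellStress E₁ E₂ a α i j z p q - cellStress E₁ E₂ a α i j z' p q‖ ≤ C * ‖z - z'‖ := by
  let T : Fin 3 → Fin 3 → ℝ → Jet 2 sqVol →L[ℝ] Lp ℝ 2 sqVol := fun p q α =>
    ∑ k, ∑ l, mulL sqVol (fun x => cellTensor a E₁ E₂ x p q k l) ∘L strainL sqVol (rotHat α) k l
  have hT : ∀ p q, Continuous (T p q) := fun p q => continuous_finsetSum _ fun k _ =>
    continuous_finsetSum _ fun l _ => continuous_const.clm_comp (continuous_strainL k l)
  have hb : ∀ p q, ∃ C, ∀ α ∈ Icc 0 Real.pi, ‖T p q α‖ ≤ C := fun p q =>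
    isCompact_Icc.exists_bound_of_continuousOn (hT p q).continuousOn
  choose C hC using hb
  refine ⟨∑ p, ∑ q, |C p q| + 1, by positivity, fun α hα i j p q z z' => ?_⟩
  have h1 : cellStress E₁ E₂ a α i j z p q - cellStress E₁ E₂ a α i j z' p q = T p q α (z - z') := by
    rw [cellStress, cellStress, ← stressL_sub]
    simp [T, stressL]
  have h2 : |C p q| ≤ ∑ p, ∑ q, |C p q| :=
    (Finset.single_le_sum (f := fun q => |C p q|) (fun q _ => abs_nonneg _)
      (Finset.mem_univ q)).trans
      (Finset.single_le_sum (f := fun p => ∑ q, |C p q|)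
        (fun p _ => Finset.sum_nonneg fun q _ => abs_nonneg _) (Finset.mem_univ p))
  rw [h1]
  refine ((T p q α).le_opNorm _).trans (mul_le_mul_of_nonneg_right ?_ (norm_nonneg _))
  linarith [hC p q α hα, le_abs_self (C p q)]

/-- Finitely many Fourier modes suffice for all angles in `[0, π]`, because the correctors and the
cell stresses depend continuously on the angle and so form compact sets. -/
lemma exists_norm_cellError_le {η : ℝ} (hη : 0 < η) :
    ∃ S : Finset (Fin 2 → ℤ), 0 ∈ S ∧ ∀ α ∈ Icc 0 Real.pi, ∀ i j p q,
      ‖cellError a hE₁ hE₂ S α i j p q‖ ≤ η := by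
  obtain ⟨C, hC0, hC⟩ := exists_norm_cellStress_sub_le (E₁ := E₁) (E₂ := E₂) a
  have h1 : ∀ᶠ S in atTop, ∀ i j, ∀ z ∈ (fun α => cellJet a hE₁ hE₂ α i j) '' Icc 0 Real.pi,
      ‖z - truncJet S z‖ ≤ η / (2 * C) := by
    simp only [eventually_all]
    exact fun i j => eventually_norm_sub_truncJet_le
      (isCompact_Icc.image (continuous_cellJet a hE₁ hE₂ i j)) (by positivity)
  have h2 : ∀ᶠ S in atTop, ∀ i j p q, ∀ f ∈ (fun α => cellStress E₁ E₂ a α i j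
      (cellJet a hE₁ hE₂ α i j) p q) '' Icc 0 Real.pi, ‖f - fourierSum S f‖ ≤ η / 2 := by
    simp only [eventually_all]
    exact fun i j p q => eventually_norm_sub_fourierSum_le (isCompact_Icc.image
      (continuous_cellStress a i j p q (continuous_cellJet a hE₁ hE₂ i j))) (by positivity)
  obtain ⟨S, h1, h2, h3⟩ := (h1.and (h2.and (eventually_ge_atTop {0}))).exists
  refine ⟨S, h3 (Finset.mem_singleton_self 0), fun α hα i j p q => ?_⟩
  have e : cellError a hE₁ hE₂ S α i j p q =
      (cellStress E₁ E₂ a α i j (truncJet S (cellJet a hE₁ hE₂ α i j)) p q -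
        cellStress E₁ E₂ a α i j (cellJet a hE₁ hE₂ α i j) p q) +
      (cellStress E₁ E₂ a α i j (cellJet a hE₁ hE₂ α i j) p q -
        fourierSum S (cellStress E₁ E₂ a α i j (cellJet a hE₁ hE₂ α i j) p q)) := by
    rw [cellError]; abel
  rw [e]
  refine (norm_add_le _ _).trans ?_
  have h4 := hC α hα i j p q (truncJet S (cellJet a hE₁ hE₂ α i j)) (cellJet a hE₁ hE₂ α i j)
  rw [norm_sub_rev (truncJet _ _)] at h4
  have h5 := mul_le_mul_of_nonneg_left (h1 i j _ (mem_image_of_mem _ hα)) hC0.le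
  have h6 := h2 i j p q _ (mem_image_of_mem _ hα)
  have h7 : C * (η / (2 * C)) = η / 2 := by field_simp
  linarith

/-- The Fourier coefficients of the cell stress are orthogonal to the rotated frequency, which is
the cell problem tested with plane waves. -/
lemma sum_mul_fcL_cellStress (α : ℝ) (i j p : Fin 3) (m : Fin 2 → ℤ) :
    ∑ q, ((∑ b, rotHat α b q * freq m b : ℝ) : ℂ) *
      fcL m (cellStress E₁ E₂ a α i j (cellJet a hE₁ hE₂ α i j) p q) = 0 := by
  set τ := cellStress E₁ E₂ a α i j (cellJet a hE₁ hE₂ α i j) with hτ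
  have hsymm : ∀ k l, τ k l = τ l k := fun k l => stressL_comm (fun x i j k l =>
    minor_left_of_twoPhase hE₁ hE₂ (cellTensor_twoPhase a x) i j k l) _ k l
  have key : ∀ c : ℂ, ∑ q, (∑ b, rotHat α b q * freq m b) *
      inner ℝ (waveLp c (freq m)) (τ p q) = 0 := by
    intro c
    let v : Field3 2 := fun y k => if k = p then wave (-Complex.I * c) (freq m) y else 0
    have hs : ∀ k, ContDiff ℝ ∞ fun y => v y k := by
      intro k
      by_cases hk : k = p
      · simpa only [v, hk, if_true] using contDiff_wave _ _
      · simpa only [v, hk, if_false] using contDiff_const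
    have hD : ∀ k b y, gradOf v y k b = if k = p then freq m b * wave c (freq m) y else 0 := by
      intro k b y
      by_cases hk : k = p
      · simp only [gradOf, v, hk, if_true]
        rw [pderiv_wave, wave_real_mul, ← mul_assoc, mul_neg, Complex.I_mul_I, neg_neg, one_mul]
      · simp only [gradOf, v, hk, if_false, pderiv]
        simp
    have hbd : ∀ (f : Pt 2 → ℝ) (K : ℝ), Continuous f → (∀ y, |f y| ≤ K) → MemLp f 2 sqVol :=
      fun f K hf hK => MemLp.of_bound hf.aestronglyMeasurable K (Eventually.of_forall hK)
    have hv : IsH1Per v (gradOf v) := by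
      refine ⟨fun y b => ?_, fun k => ?_, fun k b => ?_, fun k b => isWeakPartial_of_contDiff (hs k) b⟩
      · funext k
        simp only [v, wave_isLatticePeriodic (-Complex.I * c) m y b]
      · refine hbd _ ‖-Complex.I * c‖ (hs k).continuous fun y => ?_
        simp only [v]
        split_ifs
        · exact abs_wave_le _ _ _
        · simp
      · refine hbd _ (|freq m b| * ‖c‖) (contDiff_pderiv (hs k) b).continuous fun y => ?_
        rw [hD]
        split_ifs
        · rw [abs_mul]
          exact mul_le_mul_of_nonneg_left (abs_wave_le _ _ _) (abs_nonneg _)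
        · simp only [abs_zero]; positivity
    have hz : ∀ k b, hv.isL2Jet.toJet (k, some b) =
        if k = p then freq m b • waveLp c (freq m) else 0 := by
      intro k b
      rw [IsL2Jet.toJet_some]
      refine Lp.ext ((MemLp.coeFn_toLp _).trans ?_)
      by_cases hk : k = p
      · filter_upwards [coeFn_waveLp c (freq m), Lp.coeFn_smul (freq m b) (waveLp c (freq m))]
          with y h1 h2
        rw [hD, if_pos hk, if_pos hk, h2, Pi.smul_apply, h1, smul_eq_mul]
      · filter_upwards [Lp.coeFn_zero ℝ 2 sqVol] with y h1
        rw [hD, if_neg hk, if_neg hk, h1]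
        rfl
    have h0 := sum_inner_cellStress_cellJet a hE₁ hE₂ α i j hv
    have h1 : ∀ k l, strainL sqVol (rotHat α) k l hv.isL2Jet.toJet = (1 / 2 : ℝ) •
        ((if k = p then (∑ b, rotHat α b l * freq m b) else 0) • waveLp c (freq m) +
          (if l = p then (∑ b, rotHat α b k * freq m b) else 0) • waveLp c (freq m)) := by
      intro k l
      rw [strainL_apply, ← Finset.smul_sum, Finset.sum_add_distrib]
      simp only [hz]
      congr 2 <;> split_ifs <;> simp [add_smul, smul_smul]
    rw [← hτ] at h0
    simp only [h1, inner_smul_right, inner_add_right, mul_add, Finset.sum_add_distrib, ite_mul,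
      zero_mul, mul_ite, mul_zero, Finset.sum_ite_irrel, Finset.sum_ite_eq', Finset.mem_univ, if_true,
      Finset.sum_const_zero] at h0
    simp only [hsymm _ p] at h0
    simp only [real_inner_comm (waveLp c (freq m))] at h0 ⊢
    rw [← two_mul, Finset.mul_sum] at h0
    rw [← h0]
    refine Finset.sum_congr rfl fun q _ => ?_
    ring
  have h1 := key 1
  have h2 := key (-Complex.I)
  simp only [fcL_apply, mul_sub, Finset.sum_sub_distrib]
  have h3 : ∑ q, ((∑ b, rotHat α b q * freq m b : ℝ) : ℂ) *
      ((inner ℝ (waveLp 1 (freq m)) (τ p q) : ℝ) : ℂ) = 0 := by exact_mod_cast h1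
  have h4 : ∑ q, ((∑ b, rotHat α b q * freq m b : ℝ) : ℂ) * (Complex.I *
      ((inner ℝ (waveLp (-Complex.I) (freq m)) (τ p q) : ℝ) : ℂ)) = 0 := by
    have h5 : ∑ q, ((∑ b, rotHat α b q * freq m b : ℝ) : ℂ) *
      ((inner ℝ (waveLp (-Complex.I) (freq m)) (τ p q) : ℝ) : ℂ) = 0 := by exact_mod_cast h2
    rw [← mul_zero Complex.I, ← h5, Finset.mul_sum]
    exact Finset.sum_congr rfl fun q _ => by ring
  rw [h3, h4, sub_zero]

/-- The mean of the cell stress is the homogenized tensor. -/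
lemma fcL_zero_cellStress (α : ℝ) (i j p q : Fin 3) :
    fcL 0 (cellStress E₁ E₂ a α i j (cellJet a hE₁ hE₂ α i j) p q) = homA a hE₁ hE₂ α i j p q := by
  rw [fcL_zero, homA, inner_oneLp]

/-- The truncated corrector as a smooth periodic function. -/
def correctorFun (S : Finset (Fin 2 → ℤ)) (z : Jet 2 sqVol) : Field3 2 :=
  fun y k => ∑ m ∈ S, wave (fcL m (z (k, none))) (freq m) y

lemma gradOf_correctorFun (S : Finset (Fin 2 → ℤ)) (z : Jet 2 sqVol) (y : Pt 2) (k : Fin 3)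
    (b : Fin 2) : gradOf (correctorFun S z) y k b =
      ∑ m ∈ S, wave (freq m b * (Complex.I * fcL m (z (k, none)))) (freq m) y := by
  simp only [gradOf, correctorFun]
  rw [pderiv_finsetSum _ fun m _ => contDiff_wave _ _]
  simp only [pderiv_wave]

/-- The error `cellError` as a function that is defined everywhere. -/
def errorFun (S : Finset (Fin 2 → ℤ)) (α : ℝ) (i j p q : Fin 3) (y : Pt 2) : ℝ :=
  (cellTensor a E₁ E₂ y).app (symUnit i j +
      rotStrain α (gradOf (correctorFun S (cellJet a hE₁ hE₂ α i j)) y)) p q -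
    ∑ m ∈ S, wave (fcL m (cellStress E₁ E₂ a α i j (cellJet a hE₁ hE₂ α i j) p q)) (freq m) y

lemma coeFn_fourierSum (S : Finset (Fin 2 → ℤ)) (f : Lp ℝ 2 sqVol) :
    fourierSum S f =ᵐ[sqVol] fun y => ∑ m ∈ S, wave (fcL m f) (freq m) y := by
  rw [fourierSum]
  have h : ∀ᵐ y ∂sqVol, ∀ m ∈ S, waveLp (fcL m f) (freq m) y = wave (fcL m f) (freq m) y :=
    (ae_ball_iff S.countable_toSet).2 fun m _ => coeFn_waveLp _ _
  filter_upwards [coeFn_finsetSum S fun m => waveLp (fcL m f) (freq m), h] with y h1 h2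
  rw [h1]
  exact Finset.sum_congr rfl h2

lemma coeFn_cellError (S : Finset (Fin 2 → ℤ)) (α : ℝ) (i j p q : Fin 3) :
    cellError a hE₁ hE₂ S α i j p q =ᵐ[sqVol] errorFun a hE₁ hE₂ S α i j p q := by
  set z := cellJet a hE₁ hE₂ α i j with hz
  have hg : ∀ k b, ∀ᵐ y ∂sqVol, truncJet S z (k, some b) y = gradOf (correctorFun S z) y k b := by
    intro k b
    filter_upwards [coeFn_fourierSum S (z (k, some b))] with y hy
    rw [gradOf_correctorFun]
    refine hy.trans (Finset.sum_congr rfl fun m _ => ?_)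
    rw [(cellJet_mem a hE₁ hE₂ α i j).1 k b m]
  filter_upwards [Lp.coeFn_sub (cellStress E₁ E₂ a α i j (truncJet S z) p q)
      (fourierSum S (cellStress E₁ E₂ a α i j z p q)),
    coeFn_fourierSum S (cellStress E₁ E₂ a α i j z p q),
    coeFn_stressL (isBddTensor_cellTensor (E₁ := E₁) (E₂ := E₂) a)
      (fun k l => symUnit i j k l • oneLp + strainL sqVol (rotHat α) k l (truncJet S z)) p q,
    ae_all_iff.2 fun k => ae_all_iff.2 fun l => coeFn_smul_oneLp_add (symUnit i j k l)
      (strainL sqVol (rotHat α) k l (truncJet S z)),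
    ae_all_iff.2 fun k => ae_all_iff.2 fun l => coeFn_strainL (rotHat α) k l (truncJet S z),
    ae_all_iff.2 fun k => ae_all_iff.2 fun b => hg k b] with y h1 h2 h3 h4 h5 h6
  have h7 : (truncJet S z).grad y = gradOf (correctorFun S z) y :=
    funext fun k => funext fun b => h6 k b
  rw [cellError, ← hz, h1, Pi.sub_apply, h2, cellStress, h3, errorFun, ← hz]
  congr 3
  ext k l
  simp only [Matrix.of_apply, h4, h5, h7, strain_rotHat, Matrix.add_apply]

lemma isLatticePeriodic_cellTensor (i j k l : Fin 3) :
    IsLatticePeriodic fun y => cellTensor a E₁ E₂ y i j k l := by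
  intro y b
  have h : ∀ c, Int.fract ((y + EuclideanSpace.single b 1 : Pt 2) c) = Int.fract (y c) := by
    intro c
    by_cases hc : c = b
    · subst hc; simp
    · simp [hc]
  simp only [cellTensor, fibreChar, h]

lemma isLatticePeriodic_errorFun (S : Finset (Fin 2 → ℤ)) (α : ℝ) (i j p q : Fin 3) :
    IsLatticePeriodic (errorFun a hE₁ hE₂ S α i j p q) := by
  intro y b
  have h1 : ∀ c m, wave c (freq m) (y + EuclideanSpace.single b 1) = wave c (freq m) y :=
    fun c m => wave_isLatticePeriodic c m y b
  have h2 : ∀ i j k l, cellTensor a E₁ E₂ (y + EuclideanSpace.single b 1) i j k l =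
    cellTensor a E₁ E₂ y i j k l := fun i j k l => isLatticePeriodic_cellTensor a i j k l y b
  simp only [errorFun, Tensor4.app, Matrix.of_apply, Matrix.add_apply, rotStrain, Matrix.mulVec,
    dotProduct, gradOf_correctorFun, h1, h2]

lemma measurable_errorFun (S : Finset (Fin 2 → ℤ)) (α : ℝ) (i j p q : Fin 3) :
    Measurable (errorFun a hE₁ hE₂ S α i j p q) := by
  have hw : ∀ (c : ℂ) (κ : Fin 2 → ℝ), Measurable (wave c κ) := fun c κ =>
    (contDiff_wave c κ).continuous.measurable
  unfold errorFun
  simp only [Tensor4.app, Matrix.of_apply, Matrix.add_apply, rotStrain, Matrix.mulVec,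
    dotProduct, gradOf_correctorFun]
  refine (Finset.measurable_fun_sum _ fun k _ => Finset.measurable_fun_sum _ fun l _ =>
    (measurable_cellTensor a p q k l).mul (Measurable.const_add (Measurable.div_const
      (Measurable.add ?_ ?_) _) _)).sub (Finset.measurable_fun_sum _ fun m _ => hw _ _) <;>
  exact Finset.measurable_fun_sum _ fun b _ => Measurable.const_mul
    (Finset.measurable_fun_sum _ fun m _ => hw _ _) _

lemma lintegral_errorFun_sq (S : Finset (Fin 2 → ℤ)) (α : ℝ) (i j p q : Fin 3) :
    ∫⁻ y in unitSquare, ENNReal.ofReal (errorFun a hE₁ hE₂ S α i j p q y ^ 2) =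
      ENNReal.ofReal (‖cellError a hE₁ hE₂ S α i j p q‖ ^ 2) := by
  rw [norm_sq_eq_integral, ofReal_integral_eq_lintegral_ofReal (Lp.memLp _).integrable_sq
    (Eventually.of_forall fun _ => sq_nonneg _)]
  refine lintegral_congr_ae ?_
  filter_upwards [coeFn_cellError a hE₁ hE₂ S α i j p q] with y hy
  rw [hy]

end

noncomputable section

/-! ### Rescaled periodic functions on thin layers -/

variable {n : ℕ}

/-- The integral of a lattice periodic function of linear coordinates over a bounded set is
controlled by the number of cells that the set meets. -/
lemma lintegral_comp_matrix_le {f : Pt n → ENNReal} (hf : IsLatticePeriodic f) (hm : Measurable f)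
    {T : Matrix (Fin n) (Fin n) ℝ} (hT : T.det ≠ 0) {p q : Fin n → ℝ} (hpq : ∀ b, p b ≤ q b)
    {s : Set (Pt n)} (hs : ∀ x ∈ s, ∀ b, (T *ᵥ x.ofLp) b ∈ Icc (p b) (q b)) :
    ∫⁻ x in s, f (WithLp.toLp 2 (T *ᵥ x.ofLp)) ≤
      ENNReal.ofReal (|T.det|⁻¹ * ∏ b, (q b - p b + 2)) * ∫⁻ y in unitCube n, f y := by
  set L : Pt n →ₗ[ℝ] Pt n := Matrix.toLpLin 2 2 T with hL
  have hLa : ∀ x, L x = WithLp.toLp 2 (T *ᵥ x.ofLp) := fun x => Matrix.toLpLin_apply 2 2 T x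
  have hdet : LinearMap.det L = T.det := LinearMap.det_toLpLin 2 T
  have hLm : Measurable L := L.continuous_of_finiteDimensional.measurable
  have hmap := Measure.map_linearMap_addHaar_eq_smul_addHaar (volume : Measure (Pt n)) (f := L)
    (by rw [hdet]; exact hT)
  set B : Set (Pt n) := {y | ∀ b, y b ∈ Icc (p b) (q b)} with hB
  have hBm : MeasurableSet B := by
    rw [hB, show {y : Pt n | ∀ b, y b ∈ Icc (p b) (q b)} =
      ⋂ b, (fun y : Pt n => y b) ⁻¹' Icc (p b) (q b) by
        ext y; simp only [mem_iInter, mem_preimage]; rfl]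
    exact MeasurableSet.iInter fun b =>
      (by fun_prop : Measurable fun y : Pt n => y b) measurableSet_Icc
  have hsub : s ⊆ L ⁻¹' B := fun x hx b => by
    rw [hLa]
    exact hs x hx b
  calc ∫⁻ x in s, f (WithLp.toLp 2 (T *ᵥ x.ofLp)) ≤ ∫⁻ x in L ⁻¹' B, f (L x) := by
        simp only [hLa]
        exact lintegral_mono_set hsub
    _ = ∫⁻ y in B, f y ∂(Measure.map L volume) := (setLIntegral_map hBm hm hLm).symm
    _ = ENNReal.ofReal |T.det|⁻¹ * ∫⁻ y in B, f y := by
        rw [hmap, hdet, Measure.restrict_smul, lintegral_smul_measure, abs_inv, smul_eq_mul]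
    _ ≤ ENNReal.ofReal |T.det|⁻¹ * (ENNReal.ofReal (∏ b, (q b - p b + 2)) *
          ∫⁻ y in unitCube n, f y) := by
        gcongr
        exact lintegral_box_le hf hpq fun y hy => hy
    _ = _ := by
        rw [← mul_assoc, ← ENNReal.ofReal_mul (by positivity)]

lemma volume_restrict_unitCube :
    (volume : Measure (Pt n)).restrict (unitCube n) = Measure.map (WithLp.toLp 2)
      (Measure.pi fun _ : Fin n => (volume : Measure ℝ).restrict (Ico 0 1)) := by
  rw [← Measure.restrict_pi_pi, ← volume_pi,
    ← (PiLp.volume_preserving_toLp (Fin n)).map_eq,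
    Measure.restrict_map (PiLp.volume_preserving_toLp (Fin n)).measurable measurableSet_unitCube]
  congr 2
  ext y
  simp only [mem_preimage, Set.mem_pi, mem_univ, true_implies]
  rfl

instance isProbabilityMeasure_restrict_Ico :
    IsProbabilityMeasure ((volume : Measure ℝ).restrict (Ico 0 1)) := ⟨by simp⟩

lemma lintegral_unitCube_comp_last {f : ℝ → ENNReal} (hf : Measurable f) (b : Fin n) :
    ∫⁻ y in unitCube n, f (y b) = ∫⁻ t in Ico (0 : ℝ) 1, f t := by
  rw [volume_restrict_unitCube, lintegral_map (by fun_prop)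
    (PiLp.volume_preserving_toLp (Fin n)).measurable]
  exact (measurePreserving_eval (fun _ : Fin n => (volume : Measure ℝ).restrict (Ico 0 1))
    b).lintegral_comp hf

lemma lintegral_unitCube_comp_tail {f : Pt n → ENNReal} (hf : Measurable f) :
    ∫⁻ y in unitCube (n + 1), f (WithLp.toLp 2 fun b => y b.succ) = ∫⁻ y in unitCube n, f y := by
  have hm := (PiLp.volume_preserving_toLp (Fin n)).measurable
  have hF : Measurable fun y : Pt (n + 1) => f (WithLp.toLp 2 fun b => y b.succ) :=
    hf.comp (hm.comp (measurable_pi_lambda _ fun b => by fun_prop))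
  rw [volume_restrict_unitCube, volume_restrict_unitCube, lintegral_map hF
    (PiLp.volume_preserving_toLp (Fin (n + 1))).measurable, lintegral_map hf hm]
  have h1 := measurePreserving_piFinSuccAbove
    (fun _ : Fin (n + 1) => (volume : Measure ℝ).restrict (Ico 0 1)) 0
  have h2 := (measurePreserving_snd (μ := (volume : Measure ℝ).restrict (Ico 0 1))
    (ν := Measure.pi fun _ : Fin n => (volume : Measure ℝ).restrict (Ico 0 1))).comp h1
  exact h2.lintegral_comp (hf.comp hm)

/-- The cell coordinates of the point `x` in a layer with rotation angle `α`. -/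
def cellPt (α ε : ℝ) (x : Pt 3) : Pt 2 := WithLp.toLp 2 fun b => (rotHat α *ᵥ x.ofLp) b / ε

lemma cellPt_eq (α ε : ℝ) (x : Pt 3) :
    cellPt α ε x = WithLp.toLp 2 fun b => ((ε⁻¹ • rot α) *ᵥ x.ofLp) (Fin.succ b) := by
  unfold cellPt
  congr 1
  funext b
  rw [Matrix.smul_mulVec, Pi.smul_apply, smul_eq_mul, div_eq_inv_mul]
  rfl

lemma det_rot (α : ℝ) : (rot α).det = 1 := by
  rw [rot, Matrix.det_fin_three]
  simp [← sq]

/-- On a layer of thickness `ρ ≥ ε`, the integral of a lattice periodic function of the cell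
coordinates is at most a multiple of `ρ` times its integral over the unit cell. -/
lemma lintegral_comp_cellPt_le {f : Pt 2 → ENNReal} (hf : IsLatticePeriodic f) (hm : Measurable f)
    {M ε ρ t : ℝ} (hM : 0 ≤ M) (hε : 0 < ε) (hε1 : ε ≤ 1) (hρ : ε ≤ ρ) (α : ℝ) {s : Set (Pt 3)}
    (hs : ∀ x ∈ s, (∀ b, |x b| ≤ M) ∧ t ≤ x 2 ∧ x 2 ≤ t + ρ) :
    ∫⁻ x in s, f (cellPt α ε x) ≤
      ENNReal.ofReal ((4 * M + 2) ^ 2 * (3 * ρ)) * ∫⁻ y in unitSquare, f y := by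
  set F : Pt 3 → ENNReal := fun y => f (WithLp.toLp 2 fun b : Fin 2 => y b.succ) with hF
  have hFm : Measurable F := hm.comp ((PiLp.volume_preserving_toLp (Fin 2)).measurable.comp
    (measurable_pi_lambda _ fun b => by fun_prop))
  have hFp : IsLatticePeriodic F := by
    intro y c
    simp only [hF]
    induction c using Fin.cases with
    | zero =>
      congr 2
      funext b
      simp [Fin.succ_ne_zero]
    | succ c =>
      rw [← hf (WithLp.toLp 2 fun b : Fin 2 => y b.succ) c]
      congr 1
      ext b
      simp
  have hdet : (ε⁻¹ • rot α).det = ε⁻¹ ^ 3 := by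
    rw [Matrix.det_smul, det_rot, mul_one, Fintype.card_fin]
  have hρ0 : 0 < ρ := hε.trans_le hρ
  have h1 := lintegral_comp_matrix_le hFp hFm (T := ε⁻¹ • rot α)
    (by rw [hdet]; positivity)
    (p := ![-(2 * M / ε), -(2 * M / ε), t / ε]) (q := ![2 * M / ε, 2 * M / ε, (t + ρ) / ε])
    (fun b => by
      have : 0 ≤ 2 * M / ε := by positivity
      fin_cases b
      · simpa using by linarith
      · simpa using by linarith
      · simp only [Fin.reduceFinMk, Matrix.cons_val]
        gcongr
        linarith) (s := s) (fun x hx => by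
      obtain ⟨hxM, hx1, hx2⟩ := hs x hx
      have hsin := Real.abs_sin_le_one α
      have hcos := Real.abs_cos_le_one α
      have hp : ∀ c d : ℝ, |c| ≤ 1 → |d| ≤ M → |c * d| ≤ M := fun c d hc hd => by
        rw [abs_mul]
        nlinarith [abs_nonneg c, abs_nonneg d]
      have h0 := hp _ _ hsin (hxM 0)
      have h1 := hp _ _ hsin (hxM 1)
      have h2 := hp _ _ hcos (hxM 0)
      have h3 := hp _ _ hcos (hxM 1)
      rw [abs_le] at h0 h1 h2 h3
      intro b
      rw [Matrix.smul_mulVec, Pi.smul_apply, smul_eq_mul, ← div_eq_inv_mul, mem_Icc]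
      fin_cases b
      · simp only [rot, Fin.zero_eta, Matrix.mulVec, dotProduct, Fin.sum_univ_three, Matrix.of_apply,
          Matrix.cons_val]
        rw [← neg_div]
        constructor <;> gcongr <;> linarith
      · simp only [rot, Fin.mk_one, Matrix.mulVec, dotProduct, Fin.sum_univ_three, Matrix.of_apply,
          Matrix.cons_val]
        rw [← neg_div]
        constructor <;> gcongr <;> linarith
      · simp only [rot, Fin.reduceFinMk, Matrix.mulVec, dotProduct, Fin.sum_univ_three,
          Matrix.of_apply, Matrix.cons_val]
        constructor <;> rw [div_le_div_iff_of_pos_right hε] <;> linarith)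
  have h2 : ∫⁻ y in unitCube 3, F y = ∫⁻ y in unitSquare, f y := by
    rw [hF, lintegral_unitCube_comp_tail hm]
    exact (congrArg (fun ν => ∫⁻ y, f y ∂ν) sqVol_eq_unitCube).symm
  rw [h2] at h1
  simp only [cellPt_eq]
  refine h1.trans (mul_le_mul_left (ENNReal.ofReal_le_ofReal ?_) _)
  rw [hdet, Fin.prod_univ_three, abs_of_pos (by positivity)]
  simp only [Matrix.cons_val_zero, Matrix.cons_val_one, Matrix.cons_val]
  have e : (ε⁻¹ ^ 3)⁻¹ * ((2 * M / ε - -(2 * M / ε) + 2) * (2 * M / ε - -(2 * M / ε) + 2) *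
      ((t + ρ) / ε - t / ε + 2)) = (4 * M + 2 * ε) ^ 2 * (ρ + 2 * ε) := by
    field_simp
    ring
  rw [e]
  gcongr <;> linarith

/-- The integral of a periodic function of the rescaled third coordinate over a bounded set is
controlled by the integral over one period, uniformly in the scale. -/
lemma lintegral_comp_fract_le {f : ℝ → ENNReal} (hm : Measurable f)
    {M ρ : ℝ} (hM : 0 ≤ M) (hρ : 0 < ρ) (hρ1 : ρ ≤ 1) {s : Set (Pt 3)}
    (hs : ∀ x ∈ s, ∀ b, |x b| ≤ M) :
    ∫⁻ x in s, f (Int.fract (x 2 / ρ)) ≤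
      ENNReal.ofReal ((2 * M + 2) ^ 3) * ∫⁻ t in Ico (0 : ℝ) 1, f t := by
  set F : Pt 3 → ENNReal := fun y => f (Int.fract (y 2)) with hF
  have hFm : Measurable F := hm.comp (measurable_fract.comp (by fun_prop))
  have hFp : IsLatticePeriodic F := by
    intro y b
    simp only [hF]
    congr 1
    by_cases hb : 2 = b
    · subst hb; simp
    · simp [hb]
  have hdet : (Matrix.diagonal ![1, 1, ρ⁻¹]).det = ρ⁻¹ := by
    rw [Matrix.det_diagonal, Fin.prod_univ_three]
    simp
  have h1 := lintegral_comp_matrix_le hFp hFm (T := Matrix.diagonal ![1, 1, ρ⁻¹])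
    (by rw [hdet]; positivity) (p := ![-M, -M, -(M / ρ)]) (q := ![M, M, M / ρ])
    (fun b => by
      have : 0 ≤ M / ρ := by positivity
      fin_cases b
      · simpa using by linarith
      · simpa using by linarith
      · simpa using by linarith) (s := s) (fun x hx b => by
      have h := hs x hx
      have h0 := abs_le.1 (h 0)
      have h1 := abs_le.1 (h 1)
      have h2 := abs_le.1 (h 2)
      rw [Matrix.mulVec_diagonal]
      fin_cases b
      · simpa using h0
      · simpa using h1
      · simp only [Fin.reduceFinMk, Matrix.cons_val]
        rw [← div_eq_inv_mul, ← neg_div]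
        constructor <;> gcongr <;> linarith)
  have h2 : ∫⁻ y in unitCube 3, F y = ∫⁻ t in Ico (0 : ℝ) 1, f t := by
    rw [hF, lintegral_unitCube_comp_last (f := fun t => f (Int.fract t)) (hm.comp measurable_fract)]
    refine setLIntegral_congr_fun measurableSet_Ico fun t ht => ?_
    rw [Int.fract_eq_self.2 ht]
  rw [h2] at h1
  have h3 : ∀ x : Pt 3, F (WithLp.toLp 2 (Matrix.diagonal ![1, 1, ρ⁻¹] *ᵥ x.ofLp)) =
      f (Int.fract (x 2 / ρ)) := by
    intro x
    simp only [hF, Matrix.mulVec_diagonal, Matrix.cons_val]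
    rw [div_eq_inv_mul]
  simp only [h3] at h1
  refine h1.trans (mul_le_mul_left (ENNReal.ofReal_le_ofReal ?_) _)
  rw [hdet, Fin.prod_univ_three, abs_of_pos (by positivity)]
  simp only [Matrix.cons_val_zero, Matrix.cons_val_one, Matrix.cons_val]
  have e : (ρ⁻¹)⁻¹ * ((M - -M + 2) * (M - -M + 2) * (M / ρ - -(M / ρ) + 2)) =
      (2 * M + 2) ^ 2 * (2 * M + 2 * ρ) := by
    field_simp
    ring
  rw [e, pow_succ (2 * M + 2) 2]
  gcongr
  linarith

/-! ### The layer cutoff -/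

/-- A smooth function with values in `[0, 1]` that vanishes outside of the open unit interval. -/
structure IsLayerProfile (φ : ℝ → ℝ) : Prop where
  smooth : ContDiff ℝ ∞ φ
  nonneg : ∀ t, 0 ≤ φ t
  le_one : ∀ t, φ t ≤ 1
  eq_zero : ∀ t, t ∉ Ioo (0 : ℝ) 1 → φ t = 0

/-- There are layer profiles that are arbitrarily close to one on the unit interval, in `L²`. -/
lemma exists_layerProfile {δ : ℝ} (hδ : 0 < δ) : ∃ φ, IsLayerProfile φ ∧
    ∫⁻ t in Ico (0 : ℝ) 1, ENNReal.ofReal ((1 - φ t) ^ 2) ≤ ENNReal.ofReal δ := by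
  set d : ℝ := min (δ / 4) (1 / 8) with hd
  have hd0 : 0 < d := lt_min (by positivity) (by norm_num)
  have hd1 : d ≤ 1 / 8 := min_le_right _ _
  have hd2 : 4 * d ≤ δ := by linarith [min_le_left (δ / 4) (1 / 8)]
  let f : ContDiffBump (1 / 2 : ℝ) := ⟨1 / 2 - 2 * d, 1 / 2 - d, by linarith, by linarith⟩
  refine ⟨f, ⟨f.contDiff, fun t => f.nonneg, fun t => f.le_one, fun t ht => ?_⟩, ?_⟩
  · refine f.zero_of_le_dist ?_
    rw [Real.dist_eq]
    show 1 / 2 - d ≤ _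
    rw [mem_Ioo, not_and_or, not_lt, not_lt] at ht
    rcases ht with h | h
    · rw [abs_of_nonpos (by linarith)]; linarith
    · rw [abs_of_nonneg (by linarith)]; linarith
  · calc ∫⁻ t in Ico (0 : ℝ) 1, ENNReal.ofReal ((1 - f t) ^ 2)
        ≤ ∫⁻ t in Ico (0 : ℝ) 1, (Icc 0 (2 * d) ∪ Icc (1 - 2 * d) 1).indicator 1 t := by
          refine setLIntegral_mono (measurable_one.indicator
            (measurableSet_Icc.union measurableSet_Icc)) fun t ht => ?_
          by_cases h : t ∈ Icc 0 (2 * d) ∪ Icc (1 - 2 * d) 1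
          · rw [indicator_of_mem h]
            refine ENNReal.ofReal_le_one.2 ?_
            have h1 := f.nonneg (x := t)
            have h2 := f.le_one (x := t)
            nlinarith
          · rw [mem_union, not_or, mem_Icc, mem_Icc] at h
            have h1 : 2 * d < t := by
              by_contra hh
              exact h.1 ⟨ht.1, not_lt.1 hh⟩
            have h2 : t < 1 - 2 * d := by
              by_contra hh
              exact h.2 ⟨not_lt.1 hh, ht.2.le⟩
            rw [f.one_of_mem_closedBall]
            · simp
            · rw [Metric.mem_closedBall, Real.dist_eq, abs_le]
              show -(1 / 2 - 2 * d) ≤ _ ∧ _ ≤ 1 / 2 - 2 * d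
              constructor <;> linarith
      _ ≤ ∫⁻ t, (Icc 0 (2 * d) ∪ Icc (1 - 2 * d) 1).indicator 1 t := setLIntegral_le_lintegral _ _
      _ = volume (Icc 0 (2 * d) ∪ Icc (1 - 2 * d) 1) :=
          lintegral_indicator_one (measurableSet_Icc.union measurableSet_Icc)
      _ ≤ volume (Icc 0 (2 * d)) + volume (Icc (1 - 2 * d) 1) := measure_union_le _ _
      _ ≤ ENNReal.ofReal δ := by
          rw [Real.volume_Icc, Real.volume_Icc, ← ENNReal.ofReal_add (by linarith) (by linarith)]
          exact ENNReal.ofReal_le_ofReal (by linarith)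

/-- The cutoff function of the `k`-th layer of thickness `ρ`, that is `(k - 1) ρ < x₃ < k ρ`. -/
def layerCutoff (φ : ℝ → ℝ) (ρ : ℝ) (k : ℤ) (x : Pt 3) : ℝ := φ (x 2 / ρ - (k - 1))

lemma IsLayerProfile.floor_eq {φ : ℝ → ℝ} (hφ : IsLayerProfile φ) {t : ℝ} {k : ℤ}
    (h : φ (t - (k - 1)) ≠ 0) : ⌊t⌋ = k - 1 := by
  have h1 : t - (k - 1) ∈ Ioo (0 : ℝ) 1 := by
    by_contra hh
    exact h (hφ.eq_zero _ hh)
  rw [Int.floor_eq_iff]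
  push_cast
  exact ⟨by linarith [h1.1], by linarith [h1.2]⟩

lemma layerCutoff_eq_zero {φ : ℝ → ℝ} (hφ : IsLayerProfile φ) {ρ : ℝ} {k : ℤ} {x : Pt 3}
    (h : k ≠ ⌊x 2 / ρ⌋ + 1) : layerCutoff φ ρ k x = 0 := by
  by_contra hh
  have := hφ.floor_eq hh
  omega

lemma layerCutoff_floor (φ : ℝ → ℝ) (ρ : ℝ) (x : Pt 3) :
    layerCutoff φ ρ (⌊x 2 / ρ⌋ + 1) x = φ (Int.fract (x 2 / ρ)) := by
  unfold layerCutoff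
  push_cast
  rw [add_sub_cancel_right, Int.fract]

lemma sum_layerCutoff_mul {φ : ℝ → ℝ} (hφ : IsLayerProfile φ) {ρ : ℝ} {x : Pt 3} {K : Finset ℤ}
    (hx : ⌊x 2 / ρ⌋ + 1 ∈ K) (c : ℤ → ℝ) :
    ∑ k ∈ K, layerCutoff φ ρ k x * c k = φ (Int.fract (x 2 / ρ)) * c (⌊x 2 / ρ⌋ + 1) := by
  rw [Finset.sum_eq_single (⌊x 2 / ρ⌋ + 1), layerCutoff_floor]
  · intro k _ hk
    rw [layerCutoff_eq_zero hφ hk, zero_mul]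
  · exact fun h => (h hx).elim

lemma mem_layer_of_layerCutoff_ne_zero {φ : ℝ → ℝ} (hφ : IsLayerProfile φ) {r ε : ℝ} (hε : 0 < ε)
    {k : ℤ} {x : Pt 3} (h : layerCutoff φ (ε ^ r) k x ≠ 0) : x ∈ layer r ε k := by
  have h1 : x 2 / ε ^ r - (k - 1) ∈ Ioo (0 : ℝ) 1 := by
    by_contra hh
    exact h (hφ.eq_zero _ hh)
  have hρ : 0 < ε ^ r := Real.rpow_pos_of_pos hε r
  have h2 : (k : ℝ) - 1 < x 2 / ε ^ r := by linarith [h1.1]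
  have h3 : x 2 / ε ^ r < k := by linarith [h1.2]
  exact ⟨(lt_div_iff₀ hρ).1 h2, (div_lt_iff₀ hρ).1 h3⟩

lemma contDiff_layerCutoff {φ : ℝ → ℝ} (hφ : ContDiff ℝ ∞ φ) (ρ : ℝ) (k : ℤ) :
    ContDiff ℝ ∞ (layerCutoff φ ρ k) := by
  unfold layerCutoff
  fun_prop

lemma pderiv_layerCutoff {φ : ℝ → ℝ} (hφ : ContDiff ℝ ∞ φ) (ρ : ℝ) (k : ℤ) (q : Fin 3) (x : Pt 3) :
    pderiv q (layerCutoff φ ρ k) x =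
      deriv φ (x 2 / ρ - (k - 1)) * (if q = 2 then ρ⁻¹ else 0) := by
  have h1 : HasDerivAt φ (deriv φ (x 2 / ρ - (k - 1))) (x 2 / ρ - (k - 1)) :=
    ((hφ.differentiable (by simp)) _).hasDerivAt
  let P : Pt 3 →L[ℝ] ℝ := ρ⁻¹ • EuclideanSpace.proj 2
  have hP : ∀ y : Pt 3, P y = y 2 / ρ := fun y => by simp [P, div_eq_inv_mul]
  have h2 : HasFDerivAt (fun y : Pt 3 => y 2 / ρ - (k - 1)) P x := by
    have := (P.hasFDerivAt (x := x)).sub_const ((k : ℝ) - 1)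
    simpa only [hP] using this
  have h3 := h1.comp_hasFDerivAt x h2
  have h4 : fderiv ℝ (layerCutoff φ ρ k) x = deriv φ (x 2 / ρ - (k - 1)) • P := h3.fderiv
  rw [pderiv, h4]
  simp [P, eq_comm]

/-- A layer cutoff has derivatives of order `1 / ρ`. -/
lemma IsLayerProfile.exists_pderiv_bound {φ : ℝ → ℝ} (hφ : IsLayerProfile φ) :
    ∃ L, 0 ≤ L ∧ ∀ ρ, 0 < ρ → ∀ (k : ℤ) (q : Fin 3) (x : Pt 3),
      |pderiv q (layerCutoff φ ρ k) x| ≤ if k = ⌊x 2 / ρ⌋ + 1 then L / ρ else 0 := by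
  have hsupp : ∀ t, t ∉ Ioo (0 : ℝ) 1 → deriv φ t = 0 := by
    intro t ht
    -- a nonnegative function has derivative zero where it vanishes
    have h0 := hφ.eq_zero t ht
    have hmin : IsLocalMin φ t := Eventually.of_forall fun s => by
      rw [h0]; exact hφ.nonneg s
    exact hmin.deriv_eq_zero
  obtain ⟨L, hL⟩ := isCompact_Icc.exists_bound_of_continuousOn (s := Icc (0 : ℝ) 1)
    (hφ.smooth.continuous_deriv (by simp)).continuousOn
  refine ⟨|L|, abs_nonneg _, fun ρ hρ k q x => ?_⟩
  rw [pderiv_layerCutoff hφ.smooth]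
  by_cases hx : x 2 / ρ - (k - 1) ∈ Ioo (0 : ℝ) 1
  · have hk : k = ⌊x 2 / ρ⌋ + 1 := by
      have : ⌊x 2 / ρ⌋ = k - 1 := by
        rw [Int.floor_eq_iff]
        push_cast
        exact ⟨by linarith [hx.1], by linarith [hx.2]⟩
      omega
    rw [if_pos hk, abs_mul, div_eq_mul_inv]
    refine mul_le_mul ?_ ?_ (abs_nonneg _) (abs_nonneg _)
    · exact (hL _ (Ioo_subset_Icc_self hx)).trans (le_abs_self L)
    · split_ifs
      · rw [abs_of_pos (by positivity)]
      · simp only [abs_zero]; positivity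
  · rw [hsupp _ hx, zero_mul, abs_zero]
    split_ifs <;> positivity

/-! ### The plywood structure -/

variable {Ω : Set (Pt 3)} {a : ℝ} {γ : ℝ → ℝ} {r ε : ℝ} {p : ℤ → Pt 3} {E₁ E₂ : Tensor4}

lemma layer_disjoint {k l : ℤ} (hε : 0 < ε) {x : Pt 3} (hk : x ∈ layer r ε k)
    (hl : x ∈ layer r ε l) : k = l := by
  have hρ : 0 < ε ^ r := Real.rpow_pos_of_pos hε r
  have h1 : (k : ℝ) - 1 < l := lt_of_mul_lt_mul_right (hk.1.trans hl.2) hρ.le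
  have h2 : (l : ℝ) - 1 < k := lt_of_mul_lt_mul_right (hl.1.trans hk.2) hρ.le
  have h3 : k < l + 1 := by exact_mod_cast (by linarith : (k : ℝ) < l + 1)
  have h4 : l < k + 1 := by exact_mod_cast (by linarith : (l : ℝ) < k + 1)
  omega

lemma rot_mulVec_succ (α : ℝ) (x : Fin 3 → ℝ) :
    (rot α *ᵥ x) 1 = (rotHat α *ᵥ x) 0 ∧ (rot α *ᵥ x) 2 = (rotHat α *ᵥ x) 1 := by
  simp [rot, rotHat, Matrix.mulVec, dotProduct, Fin.sum_univ_three]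

lemma plywoodChar_of_mem_layer (hε : 0 < ε) {k : ℤ} {x : Pt 3} (hx : x ∈ layer r ε k)
    (hxΩ : x ∈ Ω) :
    plywoodChar Ω a γ r ε p x =
      fibreChar a (cellPt (γ (p k 2)) ε x 0) (cellPt (γ (p k 2)) ε x 1) := by
  rw [plywoodChar, indicator_of_mem hxΩ, one_mul, tsum_eq_single k]
  · rw [indicator_of_mem hx, mul_one, (rot_mulVec_succ _ _).1, (rot_mulVec_succ _ _).2]
    rfl
  · intro l hl
    rw [indicator_of_notMem fun h => hl (layer_disjoint hε h hx), mul_zero]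

lemma plywoodChar_zero_or_one (hε : 0 < ε) (x : Pt 3) :
    plywoodChar Ω a γ r ε p x = 0 ∨ plywoodChar Ω a γ r ε p x = 1 := by
  by_cases hxΩ : x ∈ Ω
  · by_cases hx : ∃ k, x ∈ layer r ε k
    · obtain ⟨k, hk⟩ := hx
      rw [plywoodChar_of_mem_layer hε hk hxΩ]
      exact fibreChar_zero_or_one _ _ _
    · left
      push Not at hx
      rw [plywoodChar, tsum_congr fun k => by rw [indicator_of_notMem (hx k), mul_zero], tsum_zero,
        mul_zero]
  · left
    rw [plywoodChar, indicator_of_notMem hxΩ, zero_mul]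

lemma plywoodTensor_twoPhase (hε : 0 < ε) (x : Pt 3) :
    plywoodTensor Ω a γ E₁ E₂ r ε p x = E₁ ∨ plywoodTensor Ω a γ E₁ E₂ r ε p x = E₂ :=
  mix_zero_or_one (plywoodChar_zero_or_one hε x)

lemma plywoodTensor_of_mem_layer (hε : 0 < ε) {k : ℤ} {x : Pt 3} (hx : x ∈ layer r ε k)
    (hxΩ : x ∈ Ω) : plywoodTensor Ω a γ E₁ E₂ r ε p x =
      cellTensor a E₁ E₂ (cellPt (γ (p k 2)) ε x) := by
  rw [plywoodTensor, plywoodChar_of_mem_layer hε hx hxΩ]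
  rfl

lemma measurableSet_layer (k : ℤ) : MeasurableSet (layer r ε k) := by
  have h : Measurable fun x : Pt 3 => x 2 := by fun_prop
  exact (measurableSet_lt measurable_const h).inter (measurableSet_lt h measurable_const)

lemma measurable_plywoodChar (hΩ : MeasurableSet Ω) : Measurable (plywoodChar Ω a γ r ε p) := by
  unfold plywoodChar
  refine (measurable_one.indicator hΩ).mul ?_
  have hc : ∀ (k : ℤ) (b : Fin 3),
      Measurable fun x : Pt 3 => (rot (γ (p k 2)) *ᵥ x.ofLp) b / ε := by
    intro k b
    simp only [Matrix.mulVec, dotProduct]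
    fun_prop
  refine Measurable.tsum fun k => ?_
  exact ((measurable_fibreChar a).comp ((hc k 1).prodMk (hc k 2))).mul
    (measurable_const.indicator (measurableSet_layer k))

lemma isBddTensor_plywoodTensor (hΩ : IsOpen Ω) (hε : 0 < ε) :
    IsBddTensor (volume.restrict Ω) (plywoodTensor Ω a γ E₁ E₂ r ε p) := by
  refine isBddTensor_of_twoPhase (plywoodTensor_twoPhase hε) fun i j k l => ?_
  have h := measurable_plywoodChar (a := a) (γ := γ) (r := r) (ε := ε) (p := p) hΩ.measurableSet
  exact ((h.const_mul _).add ((h.const_sub 1).const_mul _)).aestronglyMeasurable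

end

noncomputable section

/-! ### Weak solutions of elasticity problems -/

variable {n : ℕ} {μ : Measure (Pt n)}

lemma norm_mulL_le {a : Pt n → ℝ} (h : MemLp a ⊤ μ) {T : ℝ} (hT : ∀ x, |a x| ≤ T)
    (f : Lp ℝ 2 μ) : ‖mulL μ a f‖ ≤ T * ‖f‖ := by
  refine Lp.norm_le_mul_norm_of_ae_le_mul ?_
  filter_upwards [coeFn_mulL h f] with x hx
  rw [hx, norm_mul]
  exact mul_le_mul_of_nonneg_right (hT x) (norm_nonneg _)

/-- The energy form is bounded in terms of a bound of the tensor field. -/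
lemma exists_abs_elForm_le (R : Matrix (Fin n) (Fin 3) ℝ) : ∃ K : ℝ, 0 ≤ K ∧
    ∀ (C : Pt n → Tensor4) (T : ℝ), IsBddTensor μ C → (∀ x i j k l, |C x i j k l| ≤ T) →
      ∀ z v : Jet n μ, |elForm μ C R z v| ≤ K * T * ‖z‖ * ‖v‖ := by
  refine ⟨∑ i, ∑ j, ∑ k, ∑ l, ‖strainL μ R k l‖ * ‖strainL μ R i j‖, by positivity,
    fun C T hC hT z v => ?_⟩
  have h1 : ∀ i j k l,
      |inner ℝ (mulL μ (fun x => C x i j k l) (strainL μ R k l z)) (strainL μ R i j v)| ≤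
        ‖strainL μ R k l‖ * ‖strainL μ R i j‖ * T * ‖z‖ * ‖v‖ := by
    intro i j k l
    have hT0 : 0 ≤ T := (abs_nonneg _).trans (hT 0 i j k l)
    calc _ ≤ ‖mulL μ (fun x => C x i j k l) (strainL μ R k l z)‖ * ‖strainL μ R i j v‖ :=
          abs_real_inner_le_norm _ _
      _ ≤ (T * (‖strainL μ R k l‖ * ‖z‖)) * (‖strainL μ R i j‖ * ‖v‖) := by
          refine mul_le_mul ?_ ((strainL μ R i j).le_opNorm v) (norm_nonneg _) (by positivity)
          exact (norm_mulL_le (hC i j k l) (fun x => hT x i j k l) _).trans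
            (mul_le_mul_of_nonneg_left ((strainL μ R k l).le_opNorm z) hT0)
      _ = _ := by ring
  rw [elForm_apply]
  simp only [Finset.sum_mul]
  refine (Finset.abs_sum_le_sum_abs _ _).trans (Finset.sum_le_sum fun i _ => ?_)
  refine (Finset.abs_sum_le_sum_abs _ _).trans (Finset.sum_le_sum fun j _ => ?_)
  refine (Finset.abs_sum_le_sum_abs _ _).trans (Finset.sum_le_sum fun k _ => ?_)
  exact (Finset.abs_sum_le_sum_abs _ _).trans (Finset.sum_le_sum fun l _ => h1 i j k l)

variable {Ω : Set (Pt 3)} {C : Pt 3 → Tensor4} {G g : Field3 3} {Dg : Grad3 3}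

lemma IsH1.add (hΩ : IsOpen Ω) {u v : Field3 3} {Du Dv : Grad3 3} (hu : IsH1 Ω u Du)
    (hv : IsH1 Ω v Dv) : IsH1 Ω (u + v) (Du + Dv) := by
  rw [isH1_iff_inner hΩ (hu.isL2Jet.add hv.isL2Jet), IsL2Jet.toJet_add hu.isL2Jet hv.isL2Jet]
  intro k j φ hφ
  have h1 := (isH1_iff_inner hΩ hu.isL2Jet).1 hu k j φ hφ
  have h2 := (isH1_iff_inner hΩ hv.isL2Jet).1 hv k j φ hφ
  rw [PiLp.add_apply, PiLp.add_apply, inner_add_left, inner_add_left]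
  linarith

/-- The functional of a body force. -/
def loadL (hG : ∀ k, MemLp (fun x => G x k) 2 (volume.restrict Ω)) :
    Jet 3 (volume.restrict Ω) →L[ℝ] ℝ :=
  ∑ k, innerSL ℝ ((hG k).toLp _) ∘L
    PiLp.proj 2 (fun _ : Fin 3 × Option (Fin 3) => Lp ℝ 2 (volume.restrict Ω)) (k, none)

lemma loadL_toJet (hG : ∀ k, MemLp (fun x => G x k) 2 (volume.restrict Ω))
    {ψ : Field3 3} {Dψ : Grad3 3} (hψ : IsL2Jet (volume.restrict Ω) ψ Dψ) :
    loadL hG hψ.toJet = ∫ x in Ω, ∑ k, G x k * ψ x k := by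
  have hi : ∀ k, Integrable (fun x => G x k * ψ x k) (volume.restrict Ω) := fun k =>
    (hG k).integrable_mul (hψ.memLp k)
  rw [integral_finsetSum _ fun k _ => hi k]
  simp only [loadL, sum_apply, ContinuousLinearMap.comp_apply, PiLp.proj_apply, innerSL_apply_apply]
  exact Finset.sum_congr rfl fun k _ => inner_toLp (hG k) (hψ.memLp k)

lemma elForm_one_toJet (hC : IsBddTensor (volume.restrict Ω) C) {u v : Field3 3} {Du Dv : Grad3 3}
    (hu : IsL2Jet (volume.restrict Ω) u Du) (hv : IsL2Jet (volume.restrict Ω) v Dv) :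
    elForm (volume.restrict Ω) C 1 hu.toJet hv.toJet =
      ∫ x in Ω, ddot ((C x).app (strain (Du x))) (strain (Dv x)) := by
  rw [elForm_toJet hC]
  simp only [Matrix.transpose_one, Matrix.one_mulVec]

lemma isWeakSolution_iff (hG : ∀ k, MemLp (fun x => G x k) 2 (volume.restrict Ω))
    (hΩ : IsOpen Ω) (hC : IsBddTensor (volume.restrict Ω) C)
    (hg : IsH1 Ω g Dg) {u : Field3 3} {Du : Grad3 3} :
    IsWeakSolution Ω C G g Dg u Du ↔ ∃ hu : IsH1 Ω u Du,
      hu.isL2Jet.toJet - hg.isL2Jet.toJet ∈ zeroTraceJets Ω ∧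
      ∀ v ∈ zeroTraceJets Ω, elForm (volume.restrict Ω) C 1 hu.isL2Jet.toJet v = loadL hG v := by
  constructor
  · rintro ⟨h1, h2, h3⟩
    refine ⟨h1, ?_, fun v hv => ?_⟩
    · rw [← IsL2Jet.toJet_sub]
      exact (toJet_mem_zeroTraceJets_iff hΩ _).2 h2
    · have h4 := h3 _ _ ((mem_zeroTraceJets_iff hΩ v).1 hv)
      rw [← elForm_one_toJet hC h1.isL2Jet v.isL2Jet, ← loadL_toJet hG v.isL2Jet,
        Jet.toJet_isL2Jet] at h4
      exact h4
  · rintro ⟨h1, h2, h3⟩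
    refine ⟨h1, ?_, fun ψ Dψ hψ => ?_⟩
    · rw [← IsL2Jet.toJet_sub] at h2
      exact (toJet_mem_zeroTraceJets_iff hΩ _).1 h2
    · rw [← elForm_one_toJet hC h1.isL2Jet hψ.isH1.isL2Jet, ← loadL_toJet hG hψ.isH1.isL2Jet]
      exact h3 _ ((toJet_mem_zeroTraceJets_iff hΩ _).2 hψ)

/-- By Korn's and Poincaré's inequalities the energy is coercive on fields of zero trace. -/
lemma exists_le_elForm_zeroTrace (hΩ : IsOpen Ω) (hΩb : Bornology.IsBounded Ω) {c : ℝ}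
    (hc0 : 0 < c) : ∃ κ : ℝ, 0 < κ ∧ ∀ C : Pt 3 → Tensor4, IsBddTensor (volume.restrict Ω) C →
      (∀ x, ∀ ξ : Matrix (Fin 3) (Fin 3) ℝ, ξ.IsSymm → c * ddot ξ ξ ≤ ddot ((C x).app ξ) ξ) →
      ∀ z ∈ zeroTraceJets Ω, κ * ‖z‖ ^ 2 ≤ elForm (volume.restrict Ω) C 1 z z := by
  obtain ⟨K, hK0, hK⟩ := exists_norm_sq_le_strain hΩ hΩb
  refine ⟨c / K, by positivity, fun C hC hc z hz => ?_⟩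
  refine le_trans ?_ (le_elForm_self hC (Eventually.of_forall hc) 1 z)
  rw [div_mul_eq_mul_div, div_le_iff₀ hK0]
  nlinarith [hK z hz]

lemma exists_isWeakSolution (hG : ∀ k, MemLp (fun x => G x k) 2 (volume.restrict Ω))
    (hΩ : IsOpen Ω) (hΩb : Bornology.IsBounded Ω) (hg : IsH1 Ω g Dg)
    (hC : IsBddTensor (volume.restrict Ω) C) {c : ℝ} (hc0 : 0 < c)
    (hc : ∀ x, ∀ ξ : Matrix (Fin 3) (Fin 3) ℝ, ξ.IsSymm → c * ddot ξ ξ ≤ ddot ((C x).app ξ) ξ) :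
    ∃ u Du, IsWeakSolution Ω C G g Dg u Du := by
  obtain ⟨κ, hκ0, hκ⟩ := exists_le_elForm_zeroTrace hΩ hΩb hc0
  obtain ⟨z, hz, hzv⟩ := exists_mem_form_eq (zeroTraceJets Ω) isClosed_zeroTraceJets
    (elForm (volume.restrict Ω) C 1) hκ0 (hκ C hC hc)
    (loadL hG - elForm (volume.restrict Ω) C 1 hg.isL2Jet.toJet)
  have hz1 := ((mem_zeroTraceJets_iff hΩ z).1 hz).isH1
  refine ⟨g + z.val, Dg + z.grad, (isWeakSolution_iff hG hΩ hC hg).2 ⟨hg.add hΩ hz1, ?_, ?_⟩⟩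
  · rw [IsL2Jet.toJet_add hg.isL2Jet hz1.isL2Jet, add_sub_cancel_left, Jet.toJet_isL2Jet]
    exact hz
  · intro v hv
    rw [IsL2Jet.toJet_add hg.isL2Jet hz1.isL2Jet, Jet.toJet_isL2Jet, map_add, _root_.add_apply,
      hzv v hv, _root_.sub_apply]
    ring

lemma IsWeakSolution.ae_eq (hG : ∀ k, MemLp (fun x => G x k) 2 (volume.restrict Ω))
    (hΩ : IsOpen Ω) (hΩb : Bornology.IsBounded Ω) (hg : IsH1 Ω g Dg)
    (hC : IsBddTensor (volume.restrict Ω) C) {c : ℝ} (hc0 : 0 < c)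
    (hc : ∀ x, ∀ ξ : Matrix (Fin 3) (Fin 3) ℝ, ξ.IsSymm → c * ddot ξ ξ ≤ ddot ((C x).app ξ) ξ)
    {u v : Field3 3} {Du Dv : Grad3 3} (hu : IsWeakSolution Ω C G g Dg u Du)
    (hv : IsWeakSolution Ω C G g Dg v Dv) : v =ᵐ[volume.restrict Ω] u := by
  obtain ⟨κ, hκ0, hκ⟩ := exists_le_elForm_zeroTrace hΩ hΩb hc0
  obtain ⟨hu1, hu2, hu3⟩ := (isWeakSolution_iff hG hΩ hC hg).1 hu
  obtain ⟨hv1, hv2, hv3⟩ := (isWeakSolution_iff hG hΩ hC hg).1 hv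
  set d := hv1.isL2Jet.toJet - hu1.isL2Jet.toJet with hd
  have hdm : d ∈ zeroTraceJets Ω := by
    have := (zeroTraceJets Ω).sub_mem hv2 hu2
    rwa [sub_sub_sub_cancel_right] at this
  have h0 : elForm (volume.restrict Ω) C 1 d d = 0 := by
    have e : elForm (volume.restrict Ω) C 1 d = elForm (volume.restrict Ω) C 1 hv1.isL2Jet.toJet -
      elForm (volume.restrict Ω) C 1 hu1.isL2Jet.toJet := map_sub _ _ _
    rw [e, _root_.sub_apply, hu3 d hdm, hv3 d hdm, sub_self]
  have h1 := hκ C hC hc d hdm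
  rw [h0] at h1
  have h2 : ‖d‖ ^ 2 ≤ 0 := by
    by_contra hne
    have := mul_pos hκ0 (not_le.1 hne)
    linarith
  have h3 : d = 0 :=
    norm_eq_zero.1 (pow_eq_zero_iff (two_ne_zero) |>.1 (le_antisymm h2 (sq_nonneg _)))
  have h4 : hv1.isL2Jet.toJet = hu1.isL2Jet.toJet := sub_eq_zero.1 h3
  filter_upwards [hv1.isL2Jet.val_toJet, hu1.isL2Jet.val_toJet] with x hx hx'
  rw [← hx, ← hx', h4]

/-- Weak solutions are bounded in `H¹`, uniformly over tensor fields with the same bounds. -/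
lemma exists_norm_isWeakSolution_le (hG : ∀ k, MemLp (fun x => G x k) 2 (volume.restrict Ω))
    (hΩ : IsOpen Ω) (hΩb : Bornology.IsBounded Ω)
    (hg : IsH1 Ω g Dg) {c : ℝ} (hc0 : 0 < c) (T : ℝ) : ∃ B : ℝ, ∀ C : Pt 3 → Tensor4,
      IsBddTensor (volume.restrict Ω) C → (∀ x i j k l, |C x i j k l| ≤ T) →
      (∀ x, ∀ ξ : Matrix (Fin 3) (Fin 3) ℝ, ξ.IsSymm → c * ddot ξ ξ ≤ ddot ((C x).app ξ) ξ) →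
      ∀ u Du (hu : IsWeakSolution Ω C G g Dg u Du), ‖hu.isH1.isL2Jet.toJet‖ ≤ B := by
  obtain ⟨κ, hκ0, hκ⟩ := exists_le_elForm_zeroTrace hΩ hΩb hc0
  obtain ⟨K, hK0, hK⟩ := exists_abs_elForm_le (μ := (volume : Measure (Pt 3)).restrict Ω) 1
  set zg := hg.isL2Jet.toJet with hzg
  refine ⟨‖zg‖ + κ⁻¹ * (‖loadL hG‖ + K * T * ‖zg‖), fun C hC hT hc u Du hu => ?_⟩
  obtain ⟨hu1, hu2, hu3⟩ := (isWeakSolution_iff hG hΩ hC hg).1 hu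
  set d := hu1.isL2Jet.toJet - zg with hd
  have h0 : elForm (volume.restrict Ω) C 1 d d =
      loadL hG d - elForm (volume.restrict Ω) C 1 zg d := by
    have e : elForm (volume.restrict Ω) C 1 d = elForm (volume.restrict Ω) C 1 hu1.isL2Jet.toJet -
      elForm (volume.restrict Ω) C 1 zg := map_sub _ _ _
    rw [e, _root_.sub_apply, hu3 d hu2]
  have h1 := hκ C hC hc d hu2
  rw [h0] at h1
  have h2 := (le_abs_self _).trans ((loadL hG).le_opNorm d)
  have h3 := (abs_le.1 (hK C T hC hT zg d)).1
  have h4 : κ * ‖d‖ ≤ ‖loadL hG‖ + K * T * ‖zg‖ := by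
    rcases (norm_nonneg d).eq_or_lt with h | h
    · rw [← h, mul_zero]
      have hT0 : 0 ≤ T := (abs_nonneg _).trans (hT 0 0 0 0 0)
      positivity
    · refine le_of_mul_le_mul_right ?_ h
      rw [mul_assoc, ← sq, add_mul]
      linarith
  have h5 : ‖d‖ ≤ κ⁻¹ * (‖loadL hG‖ + K * T * ‖zg‖) := by
    rw [← div_eq_inv_mul, le_div_iff₀ hκ0]
    linarith
  have h6 : hu1.isL2Jet.toJet = zg + d := by rw [hd]; abel
  calc ‖hu1.isL2Jet.toJet‖ = ‖zg + d‖ := by rw [h6]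
    _ ≤ _ := (norm_add_le _ _).trans (by linarith)

/-! ### The homogenized tensor field -/

variable {E₁ E₂ : Tensor4} (a : ℝ) (hE₁ : IsStiffness E₁) (hE₂ : IsStiffness E₂)

lemma exists_abs_homA_le : ∃ T : ℝ, 0 ≤ T ∧ ∀ α ∈ Icc 0 Real.pi, ∀ i j k l,
    |homA a hE₁ hE₂ α i j k l| ≤ T := by
  have h : ∀ i j k l, ∃ T, ∀ α ∈ Icc 0 Real.pi, |homA a hE₁ hE₂ α i j k l| ≤ T := fun i j k l =>
    isCompact_Icc.exists_bound_of_continuousOn (continuous_homA a hE₁ hE₂ i j k l).continuousOn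
  choose T hT using h
  refine ⟨tensorBound T T, tensorBound_nonneg, fun α hα i j k l => ?_⟩
  exact (hT i j k l α hα).trans ((le_abs_self _).trans (abs_le_tensorBound (Or.inl rfl) i j k l))

lemma isBddTensor_homA {γ : ℝ → ℝ} (hγ : Continuous γ) (hγr : ∀ t, γ t ∈ Icc 0 Real.pi) :
    IsBddTensor (volume.restrict Ω) fun x => homA a hE₁ hE₂ (γ (x 2)) := by
  intro i j k l
  obtain ⟨T, -, hT⟩ := exists_abs_homA_le a hE₁ hE₂
  refine memLp_top_of_bound (Continuous.aestronglyMeasurable ?_) T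
    (Eventually.of_forall fun x => hT _ (hγr _) i j k l)
  exact (continuous_homA a hE₁ hE₂ i j k l).comp (hγ.comp (by fun_prop))

end

noncomputable section

/-! ### The corrected test function on one layer -/

variable {n : ℕ} {μ : Measure (Pt n)}

/-- The `ℓ¹` norm of the value of a gradient field. -/
def absGrad (Du : Grad3 n) (x : Pt n) : ℝ := ∑ k, ∑ q, |Du x k q|

/-- The `ℓ¹` norm of the classical gradient of a scalar function. -/
def absPderiv (Φ : Pt n → ℝ) (x : Pt n) : ℝ := ∑ q, |pderiv q Φ x|

lemma absGrad_nonneg (Du : Grad3 n) (x : Pt n) : 0 ≤ absGrad Du x :=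
  Finset.sum_nonneg fun _ _ => Finset.sum_nonneg fun _ _ => abs_nonneg _

lemma absPderiv_nonneg (Φ : Pt n → ℝ) (x : Pt n) : 0 ≤ absPderiv Φ x :=
  Finset.sum_nonneg fun _ _ => abs_nonneg _

lemma abs_le_absGrad (Du : Grad3 n) (x : Pt n) (k : Fin 3) (q : Fin n) :
    |Du x k q| ≤ absGrad Du x :=
  (Finset.single_le_sum (f := fun q => |Du x k q|) (fun _ _ => abs_nonneg _)
    (Finset.mem_univ q)).trans (Finset.single_le_sum (f := fun k => ∑ q, |Du x k q|)
      (fun _ _ => Finset.sum_nonneg fun _ _ => abs_nonneg _) (Finset.mem_univ k))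

lemma memLp_finsetSum_abs {ι : Type*} (s : Finset ι) {f : ι → Pt n → ℝ}
    (hf : ∀ i ∈ s, MemLp (f i) 2 μ) : MemLp (fun x => ∑ i ∈ s, |f i x|) 2 μ :=
  memLp_finsetSum s fun i hi => (hf i hi).abs

lemma memLp_absGrad {u : Field3 n} {Du : Grad3 n} (h : IsL2Jet μ u Du) :
    MemLp (absGrad Du) 2 μ :=
  memLp_finsetSum _ fun k _ => memLp_finsetSum_abs _ fun q _ => h.memLp_grad k q

lemma memLp_absPderiv {Ω : Set (Pt n)} {Φ : Pt n → ℝ} (hΦ : IsTestFunction Ω Φ) :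
    MemLp (absPderiv Φ) 2 (volume.restrict Ω) :=
  memLp_finsetSum_abs _ fun q _ => (hΦ.pderiv q).memLp 2 Ω

/-- The pairing of a divergence-free wave of wave length `O(ε)` with a gradient is `O(ε)`. -/
lemma abs_integral_wave_grad_le {Ω : Set (Pt n)} {c : Fin n → ℂ} {κ : Fin n → ℝ}
    (hc : ∑ q, (κ q : ℂ) * c q = 0) {B ε : ℝ} (hB : ∀ q, ‖c q‖ ≤ B) (hB0 : 0 ≤ B) (hε : 0 < ε)
    (hκ : 1 ≤ ε ^ 2 * ∑ q, κ q ^ 2) {v : Pt n → ℝ} {Dv : Pt n → Fin n → ℝ}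
    (hv : ∀ q, IsWeakPartial Ω q v (fun x => Dv x q))
    (hDv : ∀ q, MemLp (fun x => Dv x q) 2 (volume.restrict Ω))
    {Φ : Pt n → ℝ} (hΦ : IsTestFunction Ω Φ) :
    |∫ x in Ω, Φ x * ∑ q, wave (c q) κ x * Dv x q| ≤
      2 * B * ε * ∫ x in Ω, absPderiv Φ x * ∑ q, |Dv x q| := by
  set I := ∫ x in Ω, Φ x * ∑ q, wave (c q) κ x * Dv x q with hI
  set J := ∫ x in Ω, absPderiv Φ x * ∑ q, |Dv x q| with hJ
  set s := ∑ q, κ q ^ 2 with hs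
  have hs0 : 0 < s := by
    by_contra h
    have : ε ^ 2 * s ≤ 0 := mul_nonpos_of_nonneg_of_nonpos (sq_nonneg _) (not_lt.1 h)
    linarith
  have hint : ∀ q m, Integrable (fun x => |pderiv q Φ x| * |Dv x m|) (volume.restrict Ω) :=
    fun q m => ((hΦ.pderiv q).memLp 2 Ω).abs.integrable_mul (hDv m).abs
  have hκs : ∀ m, |κ m| ≤ √s := fun m => Real.abs_le_sqrt
    (Finset.single_le_sum (f := fun q => κ q ^ 2) (fun _ _ => sq_nonneg _) (Finset.mem_univ m))
  have hJ' : J = ∑ q, ∑ m, ∫ x in Ω, |pderiv q Φ x| * |Dv x m| := by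
    rw [hJ]
    simp only [absPderiv, Finset.sum_mul_sum]
    rw [integral_finsetSum _ fun q _ => integrable_finsetSum _ fun m _ => hint q m]
    exact Finset.sum_congr rfl fun q _ => integral_finsetSum _ fun m _ => hint q m
  have h1 : s * |I| ≤ √s * (2 * B * J) := by
    rw [← abs_of_pos hs0, ← abs_mul, hI, sq_mul_integral_wave_grad hc hv hDv hΦ]
    have h2 : ∀ q m, |κ m * ∫ x in Ω, wave (-Complex.I * c q) κ x *
        (pderiv q Φ x * Dv x m - pderiv m Φ x * Dv x q)| ≤
        √s * (B * ((∫ x in Ω, |pderiv q Φ x| * |Dv x m|) +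
          ∫ x in Ω, |pderiv m Φ x| * |Dv x q|)) := by
      intro q m
      rw [abs_mul]
      refine mul_le_mul (hκs m) ?_ (abs_nonneg _) (Real.sqrt_nonneg _)
      rw [← integral_add (hint q m) (hint m q), ← integral_const_mul, ← Real.norm_eq_abs]
      refine norm_integral_le_of_norm_le (((hint q m).add (hint m q)).const_mul B)
        (Eventually.of_forall fun x => ?_)
      rw [Real.norm_eq_abs, abs_mul]
      refine mul_le_mul ?_ ?_ (abs_nonneg _) hB0
      · refine (abs_wave_le _ _ _).trans ?_
        rw [norm_mul, norm_neg, Complex.norm_I, one_mul]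
        exact hB q
      · refine (abs_sub _ _).trans ?_
        rw [abs_mul, abs_mul]
    refine (Finset.abs_sum_le_sum_abs _ _).trans ((Finset.sum_le_sum fun q _ =>
      (Finset.abs_sum_le_sum_abs _ _).trans (Finset.sum_le_sum fun m _ => h2 q m)).trans ?_)
    rw [abs_of_pos hs0]
    simp only [← Finset.mul_sum, Finset.sum_add_distrib]
    rw [Finset.sum_comm (f := fun q m => ∫ x in Ω, |pderiv m Φ x| * |Dv x q|), ← hJ']
    refine le_of_eq ?_
    ring
  have h3 : √s * |I| ≤ 2 * B * J := by
    refine le_of_mul_le_mul_left ?_ (Real.sqrt_pos.2 hs0)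
    rwa [← mul_assoc, Real.mul_self_sqrt hs0.le]
  have h4 : 1 ≤ ε * √s := by
    refine le_of_sq_le_sq ?_ (by positivity)
    rw [mul_pow, Real.sq_sqrt hs0.le, one_pow]
    exact hκ
  have h5 := mul_le_mul_of_nonneg_left h3 hε.le
  calc |I| ≤ ε * √s * |I| := le_mul_of_one_le_left (abs_nonneg _) h4
    _ = ε * (√s * |I|) := by ring
    _ ≤ ε * (2 * B * J) := h5
    _ = _ := by ring

/-- The frequency of the `m`-th Fourier mode in the coordinates of the body. -/
def layerFreq (α ε : ℝ) (m : Fin 2 → ℤ) (q : Fin 3) : ℝ := (∑ b, rotHat α b q * freq m b) / ε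

lemma wave_comp_cellPt (c : ℂ) (m : Fin 2 → ℤ) (α ε : ℝ) (x : Pt 3) :
    wave c (freq m) (cellPt α ε x) = wave c (layerFreq α ε m) x := by
  have h : ∑ b, freq m b * cellPt α ε x b = ∑ q, layerFreq α ε m q * x q := by
    simp only [cellPt, layerFreq, Matrix.mulVec, dotProduct, Fin.sum_univ_two, Fin.sum_univ_three]
    ring
  rw [wave_eq, wave_eq, h]

/-- In the coordinates of the body a nonzero mode has a frequency of at least `1 / ε`. -/
lemma one_le_sq_mul_layerFreq {m : Fin 2 → ℤ} (hm : m ≠ 0) (α : ℝ) {ε : ℝ} (hε : 0 < ε) :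
    1 ≤ ε ^ 2 * ∑ q, layerFreq α ε m q ^ 2 := by
  have h1 : ε ^ 2 * ∑ q, layerFreq α ε m q ^ 2 = ∑ b, freq m b ^ 2 := by
    rw [← rotHat_row_sq α, Finset.mul_sum]
    refine Finset.sum_congr rfl fun q _ => ?_
    rw [layerFreq, div_pow]
    field_simp
  obtain ⟨b, hb⟩ := Function.ne_iff.1 hm
  have h2 : (1 : ℝ) ≤ (m b : ℝ) ^ 2 := by
    have : (1 : ℤ) ≤ m b ^ 2 := by
      have h3 : m b ≠ 0 := hb
      have := sq_pos_of_ne_zero h3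
      omega
    exact_mod_cast this
  rw [h1]
  refine le_trans ?_ (Finset.single_le_sum (f := fun b => freq m b ^ 2) (fun _ _ => sq_nonneg _)
    (Finset.mem_univ b))
  simp only [freq]
  rw [mul_pow, mul_pow]
  nlinarith [Real.pi_gt_three, sq_nonneg (Real.pi - 3)]

variable {E₁ E₂ : Tensor4} (a : ℝ) (hE₁ : IsStiffness E₁) (hE₂ : IsStiffness E₂)

lemma sum_layerFreq_mul_stress (α ε : ℝ) (i j p : Fin 3) (m : Fin 2 → ℤ) :
    ∑ q, (layerFreq α ε m q : ℂ) *
      fcL m (cellStress E₁ E₂ a α i j (cellJet a hE₁ hE₂ α i j) p q) = 0 := by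
  have h := sum_mul_fcL_cellStress a hE₁ hE₂ α i j p m
  rw [← zero_div (ε : ℂ), ← h, Finset.sum_div]
  refine Finset.sum_congr rfl fun q _ => ?_
  rw [layerFreq, Complex.ofReal_div]
  ring

/-- Correctors and cell stresses are bounded uniformly in the angle. -/
lemma exists_cell_bound : ∃ B : ℝ, 0 ≤ B ∧ ∀ α ∈ Icc 0 Real.pi, ∀ i j,
    ‖cellJet a hE₁ hE₂ α i j‖ ≤ B ∧
      ∀ p q, ‖cellStress E₁ E₂ a α i j (cellJet a hE₁ hE₂ α i j) p q‖ ≤ B := by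
  have h : ∀ i j, ∃ B, ∀ α ∈ Icc 0 Real.pi, ‖‖cellJet a hE₁ hE₂ α i j‖ +
      ∑ p, ∑ q, ‖cellStress E₁ E₂ a α i j (cellJet a hE₁ hE₂ α i j) p q‖‖ ≤ B := fun i j =>
    isCompact_Icc.exists_bound_of_continuousOn (((continuous_cellJet a hE₁ hE₂ i j).norm.add
      (continuous_finsetSum _ fun p _ => continuous_finsetSum _ fun q _ =>
        (continuous_cellStress a i j p q (continuous_cellJet a hE₁ hE₂ i j)).norm)).continuousOn)
  choose B hB using h
  refine ⟨∑ i, ∑ j, |B i j|, by positivity, fun α hα i j => ?_⟩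
  have h1 : |B i j| ≤ ∑ i, ∑ j, |B i j| :=
    (Finset.single_le_sum (f := fun j => |B i j|) (fun _ _ => abs_nonneg _)
      (Finset.mem_univ j)).trans (Finset.single_le_sum (f := fun i => ∑ j, |B i j|)
        (fun _ _ => Finset.sum_nonneg fun _ _ => abs_nonneg _) (Finset.mem_univ i))
  have h2 := ((le_abs_self _).trans (hB i j α hα)).trans ((le_abs_self _).trans h1)
  have h3 : ∀ p q, ‖cellStress E₁ E₂ a α i j (cellJet a hE₁ hE₂ α i j) p q‖ ≤
      ∑ p, ∑ q, ‖cellStress E₁ E₂ a α i j (cellJet a hE₁ hE₂ α i j) p q‖ := fun p q =>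
    (Finset.single_le_sum (f := fun q => ‖cellStress E₁ E₂ a α i j (cellJet a hE₁ hE₂ α i j) p q‖)
      (fun _ _ => norm_nonneg _) (Finset.mem_univ q)).trans
      (Finset.single_le_sum
        (f := fun p => ∑ q, ‖cellStress E₁ E₂ a α i j (cellJet a hE₁ hE₂ α i j) p q‖)
        (fun _ _ => Finset.sum_nonneg fun _ _ => norm_nonneg _) (Finset.mem_univ p))
  refine ⟨?_, fun p q => ?_⟩
  · refine le_trans ?_ h2
    exact le_add_of_nonneg_right (Finset.sum_nonneg fun _ _ => Finset.sum_nonneg fun _ _ =>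
      norm_nonneg _)
  · refine le_trans (h3 p q) (le_trans ?_ h2)
    exact le_add_of_nonneg_left (norm_nonneg _)

/-- The test function `ε Φ w(ŷ)`, with the truncated corrector `w` and the cell coordinates `ŷ`. -/
def layerTest (S : Finset (Fin 2 → ℤ)) (z : Jet 2 sqVol) (α ε : ℝ) (Φ : Pt 3 → ℝ) : Field3 3 :=
  fun x k => ε * (Φ x * correctorFun S z (cellPt α ε x) k)

lemma correctorFun_cellPt (S : Finset (Fin 2 → ℤ)) (z : Jet 2 sqVol) (α ε : ℝ) (k : Fin 3) :
    (fun x => correctorFun S z (cellPt α ε x) k) =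
      fun x => ∑ m ∈ S, wave (fcL m (z (k, none))) (layerFreq α ε m) x := by
  funext x
  simp only [correctorFun, wave_comp_cellPt]

lemma contDiff_correctorFun_cellPt (S : Finset (Fin 2 → ℤ)) (z : Jet 2 sqVol) (α ε : ℝ)
    (k : Fin 3) : ContDiff ℝ ∞ fun x => correctorFun S z (cellPt α ε x) k := by
  rw [correctorFun_cellPt]
  exact ContDiff.sum fun m _ => contDiff_wave _ _

lemma isTestFunction_layerTest (S : Finset (Fin 2 → ℤ)) (z : Jet 2 sqVol) (α ε : ℝ)
    {Ω : Set (Pt 3)} {Φ : Pt 3 → ℝ} (hΦ : IsTestFunction Ω Φ) (k : Fin 3) :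
    IsTestFunction Ω fun x => layerTest S z α ε Φ x k :=
  (hΦ.mul_right (contDiff_correctorFun_cellPt S z α ε k)).const_mul ε

lemma gradOf_layerTest (S : Finset (Fin 2 → ℤ)) (z : Jet 2 sqVol) (α : ℝ) {ε : ℝ} (hε : ε ≠ 0)
    {Φ : Pt 3 → ℝ} (hΦ : ContDiff ℝ ∞ Φ) (x : Pt 3) (k q : Fin 3) :
    gradOf (layerTest S z α ε Φ) x k q =
      ε * (pderiv q Φ x * correctorFun S z (cellPt α ε x) k) +
        Φ x * ((rotHat α)ᵀ *ᵥ gradOf (correctorFun S z) (cellPt α ε x) k) q := by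
  have hw := contDiff_correctorFun_cellPt S z α ε k
  simp only [gradOf, layerTest]
  rw [pderiv_const_mul (hΦ.mul hw), pderiv_mul hΦ hw, mul_add]
  congr 1
  rw [correctorFun_cellPt, pderiv_finsetSum _ fun m _ => contDiff_wave _ _]
  have h1 : ∀ b, gradOf (correctorFun S z) (cellPt α ε x) k b =
      ∑ m ∈ S, freq m b * wave (Complex.I * fcL m (z (k, none))) (layerFreq α ε m) x := by
    intro b
    rw [gradOf_correctorFun]
    simp only [wave_comp_cellPt, wave_real_mul]
  simp only [pderiv_wave, wave_real_mul, Matrix.mulVec, dotProduct, Matrix.transpose_apply, h1]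
  rw [mul_left_comm]
  congr 1
  simp only [Finset.mul_sum]
  rw [Finset.sum_comm]
  refine Finset.sum_congr rfl fun m _ => ?_
  rw [layerFreq, ← mul_assoc, mul_div_cancel₀ _ hε, Finset.sum_mul]
  exact Finset.sum_congr rfl fun b _ => by ring

lemma abs_correctorFun_le (S : Finset (Fin 2 → ℤ)) {z : Jet 2 sqVol} {B : ℝ} (hz : ‖z‖ ≤ B)
    (y : Pt 2) (k : Fin 3) : |correctorFun S z y k| ≤ S.card * B := by
  refine (Finset.abs_sum_le_sum_abs _ _).trans ?_
  rw [← nsmul_eq_mul]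
  refine Finset.sum_le_card_nsmul _ _ _ fun m _ => ?_
  exact (abs_wave_le _ _ _).trans
    ((norm_fcL_le _ _).trans ((PiLp.norm_apply_le z (k, none)).trans hz))

lemma ddot_comm_app {E : Tensor4} (hE : ∀ i j k l, E i j k l = E k l i j)
    (ξ ζ : Matrix (Fin 3) (Fin 3) ℝ) : ddot (E.app ξ) ζ = ddot (E.app ζ) ξ := by
  simp only [ddot, Tensor4.app, Matrix.of_apply, Finset.sum_mul]
  have h1 : ∀ i j, ∑ k, ∑ l, E i j k l * ξ k l * ζ i j = ∑ k, ∑ l, E k l i j * ζ i j * ξ k l :=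
    fun i j => Finset.sum_congr rfl fun k _ => Finset.sum_congr rfl fun l _ => by
      rw [hE i j k l]; ring
  simp only [h1]
  rw [Finset.sum_congr rfl fun i _ => Finset.sum_comm, Finset.sum_comm]
  refine Finset.sum_congr rfl fun k _ => ?_
  rw [Finset.sum_congr rfl fun i _ => Finset.sum_comm, Finset.sum_comm]

lemma ddot_add_left (ξ ξ' ζ : Matrix (Fin 3) (Fin 3) ℝ) :
    ddot (ξ + ξ') ζ = ddot ξ ζ + ddot ξ' ζ := by
  simp only [ddot, Matrix.add_apply, add_mul, Finset.sum_add_distrib]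

lemma ddot_add_right (ξ ζ ζ' : Matrix (Fin 3) (Fin 3) ℝ) :
    ddot ξ (ζ + ζ') = ddot ξ ζ + ddot ξ ζ' := by
  simp only [ddot, Matrix.add_apply, mul_add, Finset.sum_add_distrib]

lemma ddot_smul_right (c : ℝ) (ξ ζ : Matrix (Fin 3) (Fin 3) ℝ) :
    ddot ξ (c • ζ) = c * ddot ξ ζ := by
  simp only [ddot, Matrix.smul_apply, smul_eq_mul, Finset.mul_sum]
  exact Finset.sum_congr rfl fun i _ => Finset.sum_congr rfl fun j _ => by ring

lemma app_add (E : Tensor4) (ξ ζ : Matrix (Fin 3) (Fin 3) ℝ) :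
    E.app (ξ + ζ) = E.app ξ + E.app ζ := by
  ext i j
  simp only [Tensor4.app, Matrix.of_apply, Matrix.add_apply, mul_add, Finset.sum_add_distrib]

lemma ddot_app_symUnit {E : Tensor4} (hE : ∀ i j k l, E i j k l = E k l i j)
    (hE' : ∀ i j k l, E i j k l = E i j l k) {e : Matrix (Fin 3) (Fin 3) ℝ} (i j : Fin 3) :
    ddot (E.app (symUnit i j)) e = E.app e i j := by
  simp only [ddot, Tensor4.app, Matrix.of_apply]
  refine Finset.sum_congr rfl fun k _ => Finset.sum_congr rfl fun l _ => ?_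
  rw [sum_mul_symUnit (fun p q => E k l p q), ← hE' k l i j, hE k l i j]
  ring

/-- By the symmetry of the tensor, a component of the stress of a strain `e` is the pairing of `e`
with the stress of `l_{ij}`. Adding and subtracting the corrector expresses it by the cell stress
and by the strain of the corrected test function, whose gradient appears on the right. Here `Φ`,
`P`, `w` and `gc` stand for the values of a cutoff, of its gradient, of the corrector and of the gradient
of the corrector at a point. -/
lemma stress_eq_corrected {E : Tensor4} (hE : ∀ i j k l, E i j k l = E k l i j)
    (hE' : ∀ i j k l, E i j k l = E i j l k) (e : Matrix (Fin 3) (Fin 3) ℝ) (i j : Fin 3)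
    (α ε Φ : ℝ) (P w : Fin 3 → ℝ) (gc : Fin 3 → Fin 2 → ℝ) :
    Φ * E.app e i j = Φ * ddot (E.app (symUnit i j + rotStrain α gc)) e -
      ddot (E.app e) (strain fun k q => ε * (P q * w k) + Φ * ((rotHat α)ᵀ *ᵥ gc k) q) +
      ε * ddot (E.app e) (strain fun k q => P q * w k) := by
  have h1 : (strain fun k q => ε * (P q * w k) + Φ * ((rotHat α)ᵀ *ᵥ gc k) q) =
      ε • strain (fun k q => P q * w k) + Φ • rotStrain α gc := by
    rw [← strain_rotHat]
    ext k l
    simp only [strain, Matrix.of_apply, Matrix.add_apply, Matrix.smul_apply, smul_eq_mul]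
    ring
  rw [h1, app_add, ddot_add_left, ddot_app_symUnit hE hE', ddot_add_right, ddot_smul_right,
    ddot_smul_right, ddot_comm_app hE (rotStrain α gc)]
  ring

lemma abs_strain_le (Du : Grad3 3) (x : Pt 3) (k l : Fin 3) :
    |strain (Du x) k l| ≤ absGrad Du x := by
  simp only [strain, Matrix.of_apply]
  rw [abs_div, abs_two, div_le_iff₀ (by norm_num)]
  have := abs_add_le (Du x k l) (Du x l k)
  linarith [abs_le_absGrad Du x k l, abs_le_absGrad Du x l k]

lemma sum_abs_strain_le (d : Fin 3 → Fin 3 → ℝ) :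
    ∑ k, ∑ l, |strain d k l| ≤ ∑ k, ∑ l, |d k l| := by
  have h1 : ∀ k l, |strain d k l| ≤ |d k l| / 2 + |d l k| / 2 := by
    intro k l
    simp only [strain, Matrix.of_apply]
    rw [abs_div, abs_two, ← add_div]
    gcongr
    exact abs_add_le _ _
  refine (Finset.sum_le_sum fun k _ => Finset.sum_le_sum fun l _ => h1 k l).trans (le_of_eq ?_)
  simp only [Finset.sum_add_distrib]
  rw [Finset.sum_comm (f := fun k l => |d l k| / 2)]
  simp only [← Finset.sum_div]
  ring

lemma abs_app_le {E : Tensor4} {T : ℝ} (hE : ∀ i j k l, |E i j k l| ≤ T) (Du : Grad3 3) (x : Pt 3)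
    (i j : Fin 3) : |E.app (strain (Du x)) i j| ≤ T * absGrad Du x := by
  have hT : 0 ≤ T := (abs_nonneg _).trans (hE 0 0 0 0)
  simp only [Tensor4.app, Matrix.of_apply]
  refine (Finset.abs_sum_le_sum_abs _ _).trans ((Finset.sum_le_sum fun k _ =>
    (Finset.abs_sum_le_sum_abs _ _).trans (Finset.sum_le_sum fun l _ => ?_)).trans
    (?_ : ∑ k, ∑ l, T * |strain (Du x) k l| ≤ _))
  · rw [abs_mul]
    exact mul_le_mul_of_nonneg_right (hE i j k l) (abs_nonneg _)
  · simp only [← Finset.mul_sum]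
    exact mul_le_mul_of_nonneg_left (sum_abs_strain_le (Du x)) hT

lemma abs_ddot_le {ξ ζ : Matrix (Fin 3) (Fin 3) ℝ} {b : ℝ} (h : ∀ i j, |ζ i j| ≤ b) :
    |ddot ξ ζ| ≤ (∑ i, ∑ j, |ξ i j|) * b := by
  simp only [ddot, Finset.sum_mul]
  refine (Finset.abs_sum_le_sum_abs _ _).trans (Finset.sum_le_sum fun i _ =>
    (Finset.abs_sum_le_sum_abs _ _).trans (Finset.sum_le_sum fun j _ => ?_))
  rw [abs_mul]
  exact mul_le_mul_of_nonneg_left (h i j) (abs_nonneg _)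

end

noncomputable section

/-! ### The estimate on one layer -/

variable {n : ℕ} {μ : Measure (Pt n)}

lemma memLp_app {C : Pt 3 → Tensor4} {μ : Measure (Pt 3)} (hC : IsBddTensor μ C) {u : Field3 3}
    {Du : Grad3 3} (hu : IsL2Jet μ u Du) (i j : Fin 3) :
    MemLp (fun x => (C x).app (strain (Du x)) i j) 2 μ := by
  simp only [Tensor4.app, Matrix.of_apply]
  refine memLp_finsetSum _ fun k _ => memLp_finsetSum _ fun l _ => ?_
  refine MemLp.mul' (p := ⊤) (q := 2) ?_ (hC i j k l)
  simp only [strain, Matrix.of_apply, div_eq_mul_inv]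
  exact ((hu.memLp_grad k l).add (hu.memLp_grad l k)).mul_const _

lemma integrable_ddot_app {C : Pt 3 → Tensor4} {μ : Measure (Pt 3)} (hC : IsBddTensor μ C)
    {u v : Field3 3} {Du Dv : Grad3 3} (hu : IsL2Jet μ u Du) (hv : IsL2Jet μ v Dv) :
    Integrable (fun x => ddot ((C x).app (strain (Du x))) (strain (Dv x))) μ := by
  unfold ddot
  refine integrable_finsetSum _ fun i _ => integrable_finsetSum _ fun j _ => ?_
  refine (memLp_app hC hu i j).integrable_mul (q := 2) ?_
  simp only [strain, Matrix.of_apply, div_eq_mul_inv]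
  exact ((hv.memLp_grad i j).add (hv.memLp_grad j i)).mul_const _

lemma exists_bound_finsetSum {ι X : Type*} (s : Finset ι) {f : ι → X → ℝ}
    (h : ∀ i ∈ s, ∃ b, ∀ y, |f i y| ≤ b) : ∃ b, ∀ y, |∑ i ∈ s, f i y| ≤ b := by
  choose! b hb using h
  exact ⟨∑ i ∈ s, b i, fun y => (Finset.abs_sum_le_sum_abs _ _).trans
    (Finset.sum_le_sum fun i hi => hb i hi y)⟩

variable {E₁ E₂ : Tensor4} (a : ℝ) (hE₁ : IsStiffness E₁) (hE₂ : IsStiffness E₂)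

lemma exists_abs_errorFun_le (S : Finset (Fin 2 → ℤ)) (α : ℝ) (i j p q : Fin 3) :
    ∃ b, ∀ y, |errorFun a hE₁ hE₂ S α i j p q y| ≤ b := by
  have hw : ∀ (c : (Fin 2 → ℤ) → ℂ), ∃ b, ∀ y, |∑ m ∈ S, wave (c m) (freq m) y| ≤ b := fun c =>
    exists_bound_finsetSum _ fun m _ => ⟨‖c m‖, fun y => abs_wave_le _ _ _⟩
  have hmul : ∀ (c : ℝ) (f : Pt 2 → ℝ), (∃ b, ∀ y, |f y| ≤ b) → ∃ b, ∀ y, |c * f y| ≤ b := by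
    rintro c f ⟨b, hb⟩
    exact ⟨|c| * b, fun y => by
      rw [abs_mul]; exact mul_le_mul_of_nonneg_left (hb y) (abs_nonneg _)⟩
  obtain ⟨b₂, hb₂⟩ := hw fun m =>
    fcL m (cellStress E₁ E₂ a α i j (cellJet a hE₁ hE₂ α i j) p q)
  have h1 : ∃ b, ∀ y, |(cellTensor a E₁ E₂ y).app (symUnit i j + rotStrain α
      (gradOf (correctorFun S (cellJet a hE₁ hE₂ α i j)) y)) p q| ≤ b := by
    simp only [Tensor4.app, Matrix.of_apply, Matrix.add_apply, rotStrain, Matrix.mulVec,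
      dotProduct, gradOf_correctorFun]
    refine exists_bound_finsetSum _ fun k _ => exists_bound_finsetSum _ fun l _ => ?_
    obtain ⟨b, hb⟩ := exists_bound_finsetSum Finset.univ fun b _ =>
      hmul ((rotHat α)ᵀ k b) _ (hw fun m =>
        freq m b * (Complex.I * fcL m (cellJet a hE₁ hE₂ α i j (l, none))))
    obtain ⟨b', hb'⟩ := exists_bound_finsetSum Finset.univ fun b _ =>
      hmul ((rotHat α)ᵀ l b) _ (hw fun m =>
        freq m b * (Complex.I * fcL m (cellJet a hE₁ hE₂ α i j (k, none))))
    refine ⟨tensorBound E₁ E₂ * (|symUnit i j k l| + (b + b') / 2), fun y => ?_⟩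
    rw [abs_mul]
    refine mul_le_mul (abs_le_tensorBound (cellTensor_twoPhase a y) p q k l) ?_ (abs_nonneg _)
      tensorBound_nonneg
    refine (abs_add_le _ _).trans (add_le_add_right ?_ _)
    rw [abs_div, abs_two]
    have := (abs_add_le _ _).trans (add_le_add (hb y) (hb' y))
    linarith
  obtain ⟨b₁, hb₁⟩ := h1
  exact ⟨b₁ + b₂, fun y => (abs_sub _ _).trans (add_le_add (hb₁ y) (hb₂ y))⟩

/-- The sum of the errors in all components of the stress. -/
def absError (S : Finset (Fin 2 → ℤ)) (α : ℝ) (i j : Fin 3) (y : Pt 2) : ℝ :=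
  ∑ p, ∑ q, |errorFun a hE₁ hE₂ S α i j p q y|

lemma absError_nonneg (S : Finset (Fin 2 → ℤ)) (α : ℝ) (i j : Fin 3) (y : Pt 2) :
    0 ≤ absError a hE₁ hE₂ S α i j y :=
  Finset.sum_nonneg fun _ _ => Finset.sum_nonneg fun _ _ => abs_nonneg _

lemma measurable_absError (S : Finset (Fin 2 → ℤ)) (α : ℝ) (i j : Fin 3) :
    Measurable (absError a hE₁ hE₂ S α i j) :=
  Finset.measurable_fun_sum _ fun p _ => Finset.measurable_fun_sum _ fun q _ =>
    (measurable_errorFun a hE₁ hE₂ S α i j p q).abs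

lemma measurable_cellPt (α ε : ℝ) : Measurable (cellPt α ε) := by
  unfold cellPt
  refine (PiLp.volume_preserving_toLp (Fin 2)).measurable.comp (measurable_pi_lambda _ fun b => ?_)
  simp only [Matrix.mulVec, dotProduct]
  fun_prop

lemma exists_absError_le (S : Finset (Fin 2 → ℤ)) (α : ℝ) (i j : Fin 3) :
    ∃ b, ∀ y, |absError a hE₁ hE₂ S α i j y| ≤ b :=
  exists_bound_finsetSum _ fun p _ => exists_bound_finsetSum _ fun q _ => by
    simpa only [abs_abs] using exists_abs_errorFun_le a hE₁ hE₂ S α i j p q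

/-- The pointwise decomposition behind the estimate on one layer: up to the integrand of the weak
formulation for the corrected test function, the difference between the microscopic and the
homogenized stress consists of oscillating divergence-free modes and of small terms. -/
lemma abs_layer_integrand_le {S : Finset (Fin 2 → ℤ)} (h0 : 0 ∈ S) {α ε : ℝ} (hε : 0 < ε)
    {E : Tensor4} (hE : E = E₁ ∨ E = E₂) {Φ : Pt 3 → ℝ} (hΦ : ContDiff ℝ ∞ Φ) {x : Pt 3}
    (hEx : Φ x ≠ 0 → E = cellTensor a E₁ E₂ (cellPt α ε x)) (Du : Grad3 3) (i j : Fin 3) {B : ℝ}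
    (hB : ‖cellJet a hE₁ hE₂ α i j‖ ≤ B) (hB0 : 0 ≤ B) :
    |Φ x * (E.app (strain (Du x)) i j - (homA a hE₁ hE₂ α).app (strain (Du x)) i j) -
      (∑ m ∈ S.erase 0, ∑ p, Φ x * ∑ q,
        wave (fcL m (cellStress E₁ E₂ a α i j (cellJet a hE₁ hE₂ α i j) p q))
          (layerFreq α ε m) x * Du x p q) +
      ddot (E.app (strain (Du x)))
        (strain (gradOf (layerTest S (cellJet a hE₁ hE₂ α i j) α ε Φ) x))| ≤
    |Φ x| * absError a hE₁ hE₂ S α i j (cellPt α ε x) * absGrad Du x +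
      ε * (9 * tensorBound E₁ E₂ * (S.card * B)) * (absPderiv Φ x * absGrad Du x) := by
  set z := cellJet a hE₁ hE₂ α i j with hz
  set τ := cellStress E₁ E₂ a α i j z with hτ
  set e := strain (Du x) with he
  set y := cellPt α ε x with hy
  have hsymm : ∀ k l, τ k l = τ l k := fun k l => stressL_comm (fun x i j k l =>
    minor_left_of_twoPhase hE₁ hE₂ (cellTensor_twoPhase a x) i j k l) _ k l
  have h1 := stress_eq_corrected (major_of_twoPhase hE₁ hE₂ hE) (minor_right_of_twoPhase hE₁ hE₂ hE)
    e i j α ε (Φ x) (fun q => pderiv q Φ x) (fun k => correctorFun S z y k)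
    (gradOf (correctorFun S z) y)
  have h2 : gradOf (layerTest S z α ε Φ) x = fun k q =>
      ε * (pderiv q Φ x * correctorFun S z y k) +
        Φ x * ((rotHat α)ᵀ *ᵥ gradOf (correctorFun S z) y k) q :=
    funext fun k => funext fun q => gradOf_layerTest S z α hε.ne' hΦ x k q
  -- the truncated stress is the homogenized stress plus the oscillating modes
  have h3 : ∑ p, ∑ q, (∑ m ∈ S, wave (fcL m (τ p q)) (freq m) y) * e p q =
      (homA a hE₁ hE₂ α).app e i j + ∑ m ∈ S.erase 0, ∑ p, ∑ q,
        wave (fcL m (τ p q)) (layerFreq α ε m) x * Du x p q := by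
    have h4 : ∀ m, ∑ p, ∑ q, wave (fcL m (τ p q)) (freq m) y * e p q =
        ∑ p, ∑ q, wave (fcL m (τ p q)) (layerFreq α ε m) x * Du x p q := by
      intro m
      have h5 : ∀ p q, wave (fcL m (τ p q)) (freq m) y * e p q =
          wave (fcL m (τ p q)) (layerFreq α ε m) x * Du x p q / 2 +
          wave (fcL m (τ q p)) (layerFreq α ε m) x * Du x q p / 2 := by
        intro p q
        rw [hy, wave_comp_cellPt, hsymm q p, he]
        simp only [strain, Matrix.of_apply]
        ring
      simp only [h5, Finset.sum_add_distrib]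
      rw [Finset.sum_comm (f := fun p q =>
        wave (fcL m (τ q p)) (layerFreq α ε m) x * Du x q p / 2)]
      simp only [← Finset.sum_div]
      ring
    have h6 : ∑ p, ∑ q, wave (fcL 0 (τ p q)) (freq 0) y * e p q =
        (homA a hE₁ hE₂ α).app e i j := by
      simp only [Tensor4.app, Matrix.of_apply]
      refine Finset.sum_congr rfl fun p _ => Finset.sum_congr rfl fun q _ => ?_
      rw [fcL_zero_cellStress, wave_eq]
      simp [freq]
    simp only [Finset.sum_mul]
    rw [Finset.sum_congr rfl fun p _ => Finset.sum_comm, Finset.sum_comm,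
      ← Finset.add_sum_erase _ _ h0, h6]
    simp only [h4]
  have h7 : Φ x * ddot (E.app (symUnit i j + rotStrain α (gradOf (correctorFun S z) y))) e =
      Φ x * (∑ p, ∑ q, errorFun a hE₁ hE₂ S α i j p q y * e p q) +
      Φ x * (∑ p, ∑ q, (∑ m ∈ S, wave (fcL m (τ p q)) (freq m) y) * e p q) := by
    by_cases hx : Φ x = 0
    · rw [hx]; ring
    · rw [← mul_add, hEx hx]
      congr 1
      simp only [ddot, ← Finset.sum_add_distrib, errorFun]
      refine Finset.sum_congr rfl fun p _ => Finset.sum_congr rfl fun q _ => ?_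
      ring
  have h8 : Φ x * (E.app e i j - (homA a hE₁ hE₂ α).app e i j) -
      (∑ m ∈ S.erase 0, ∑ p, Φ x * ∑ q, wave (fcL m (τ p q)) (layerFreq α ε m) x * Du x p q) +
      ddot (E.app e) (strain (gradOf (layerTest S z α ε Φ) x)) =
      Φ x * (∑ p, ∑ q, errorFun a hE₁ hE₂ S α i j p q y * e p q) +
      ε * ddot (E.app e) (strain fun k q => pderiv q Φ x * correctorFun S z y k) := by
    have h9 : ∑ m ∈ S.erase 0, ∑ p, Φ x * ∑ q,
        wave (fcL m (τ p q)) (layerFreq α ε m) x * Du x p q = Φ x * ∑ m ∈ S.erase 0, ∑ p, ∑ q,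
        wave (fcL m (τ p q)) (layerFreq α ε m) x * Du x p q := by
      simp only [Finset.mul_sum]
    rw [h2, mul_sub, h1, h7, h3, h9]
    ring
  rw [h8]
  refine (abs_add_le _ _).trans (add_le_add ?_ ?_)
  · rw [abs_mul, mul_assoc]
    refine mul_le_mul_of_nonneg_left ?_ (abs_nonneg _)
    exact abs_ddot_le (ξ := fun p q => errorFun a hE₁ hE₂ S α i j p q y) (ζ := e)
      fun k l => abs_strain_le Du x k l
  · rw [abs_mul, abs_of_pos hε, mul_assoc ε]
    refine mul_le_mul_of_nonneg_left ?_ hε.le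
    have h9 : ∀ k l, |strain (fun k q => pderiv q Φ x * correctorFun S z y k) k l| ≤
        absPderiv Φ x * (S.card * B) := by
      intro k l
      have h10 : ∀ k q, |pderiv q Φ x * correctorFun S z y k| ≤ absPderiv Φ x * (S.card * B) := by
        intro k q
        rw [abs_mul]
        refine mul_le_mul ?_ (abs_correctorFun_le S hB y k) (abs_nonneg _) (absPderiv_nonneg _ _)
        exact Finset.single_le_sum (f := fun q => |pderiv q Φ x|) (fun _ _ => abs_nonneg _)
          (Finset.mem_univ q)
      simp only [strain, Matrix.of_apply]
      rw [abs_div, abs_two, div_le_iff₀ (by norm_num)]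
      linarith [abs_add_le (pderiv l Φ x * correctorFun S z y k)
        (pderiv k Φ x * correctorFun S z y l), h10 k l, h10 l k]
    refine (abs_ddot_le h9).trans ?_
    have h11 : ∑ p, ∑ q, |E.app e p q| ≤ 9 * (tensorBound E₁ E₂ * absGrad Du x) := by
      refine (Finset.sum_le_sum fun p _ => Finset.sum_le_sum fun q _ =>
        abs_app_le (fun i j k l => abs_le_tensorBound hE i j k l) Du x p q).trans (le_of_eq ?_)
      simp only [Finset.sum_const, Finset.card_univ, Fintype.card_fin, nsmul_eq_mul]
      push_cast
      ring
    refine (mul_le_mul_of_nonneg_right h11 ?_).trans (le_of_eq ?_)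
    · exact mul_nonneg (absPderiv_nonneg _ _) (by positivity)
    · ring

variable {Ω : Set (Pt 3)} {G : Field3 3}

/-- On a region where the microscopic tensor is that of the cell with angle `α`, the microscopic
stress is close to the homogenized one in the weak sense. -/
lemma exists_layer_estimate (hΩ : IsOpen Ω) (hG : ∀ k, MemLp (fun x => G x k) 2 (volume.restrict Ω))
    {S : Finset (Fin 2 → ℤ)} (h0 : 0 ∈ S) : ∃ K : ℝ, 0 ≤ K ∧
    ∀ α ∈ Icc 0 Real.pi, ∀ ε, 0 < ε → ∀ C : Pt 3 → Tensor4, IsBddTensor (volume.restrict Ω) C →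
    (∀ x, C x = E₁ ∨ C x = E₂) → ∀ u Du, IsH1 Ω u Du →
    (∀ ψ : Field3 3, (∀ k, IsTestFunction Ω fun x => ψ x k) →
      ∫ x in Ω, ddot ((C x).app (strain (Du x))) (strain (gradOf ψ x)) =
        ∫ x in Ω, ∑ k, G x k * ψ x k) →
    ∀ Φ, IsTestFunction Ω Φ → (∀ x ∈ Ω, Φ x ≠ 0 → C x = cellTensor a E₁ E₂ (cellPt α ε x)) →
    ∀ i j, |∫ x in Ω, Φ x * ((C x).app (strain (Du x)) i j -
        (homA a hE₁ hE₂ α).app (strain (Du x)) i j)| ≤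
      K * ε * (∫ x in Ω, (|Φ x| + absPderiv Φ x) * (absGrad Du x + ∑ k, |G x k|)) +
      ∫ x in Ω, |Φ x| * absError a hE₁ hE₂ S α i j (cellPt α ε x) * absGrad Du x := by
  obtain ⟨B, hB0, hB⟩ := exists_cell_bound a hE₁ hE₂
  refine ⟨9 * tensorBound E₁ E₂ * (S.card * B) + S.card * (3 * (2 * B)) + S.card * B, ?_, ?_⟩
  · have := tensorBound_nonneg (E₁ := E₁) (E₂ := E₂)
    positivity
  intro α hα ε hε C hC hC2 u Du hu hweak Φ hΦ hCΦ i j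
  set z := cellJet a hE₁ hE₂ α i j with hz
  set τ := cellStress E₁ E₂ a α i j z with hτ
  set ν := (volume : Measure (Pt 3)).restrict Ω with hν
  have hψ := isTestFunction_layerTest S z α ε hΦ
  set ψ := layerTest S z α ε Φ with hψdef
  have hT0 := tensorBound_nonneg (E₁ := E₁) (E₂ := E₂)
  have hΦ2 : MemLp Φ 2 ν := hΦ.memLp 2 Ω
  have hd2 : MemLp (absGrad Du) 2 ν := memLp_absGrad hu.isL2Jet
  have hG2 : MemLp (fun x => ∑ k, |G x k|) 2 ν := memLp_finsetSum_abs _ fun k _ => hG k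
  have hP2 : MemLp (absPderiv Φ) 2 ν := memLp_absPderiv hΦ
  have hhom : IsBddTensor ν fun _ => homA a hE₁ hE₂ α := fun i j k l => memLp_top_const _
  have hX : Integrable (fun x => Φ x * ((C x).app (strain (Du x)) i j -
      (homA a hE₁ hE₂ α).app (strain (Du x)) i j)) ν :=
    hΦ2.integrable_mul ((memLp_app hC hu.isL2Jet i j).sub (memLp_app hhom hu.isL2Jet i j))
  have hA : ∀ m p, Integrable (fun x => Φ x * ∑ q,
      wave (fcL m (τ p q)) (layerFreq α ε m) x * Du x p q) ν := by
    intro m p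
    simp only [Finset.mul_sum]
    refine integrable_finsetSum _ fun q _ => ?_
    simp only [← mul_assoc]
    exact ((hΦ.mul_right (contDiff_wave _ _)).memLp 2 Ω).integrable_mul (hu.memLp_grad p q)
  have hA' : Integrable (fun x => ∑ m ∈ S.erase 0, ∑ p, Φ x * ∑ q,
      wave (fcL m (τ p q)) (layerFreq α ε m) x * Du x p q) ν :=
    integrable_finsetSum _ fun m _ => integrable_finsetSum _ fun p _ => hA m p
  have hW : Integrable (fun x => ddot ((C x).app (strain (Du x))) (strain (gradOf ψ x))) ν :=
    integrable_ddot_app hC hu.isL2Jet (isL2Jet_of_test hψ)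
  have hJ : Integrable (fun x => (|Φ x| + absPderiv Φ x) * (absGrad Du x + ∑ k, |G x k|)) ν :=
    (hΦ2.abs.add hP2).integrable_mul (hd2.add hG2)
  have hR : Integrable (fun x => |Φ x| * absError a hE₁ hE₂ S α i j (cellPt α ε x) *
      absGrad Du x) ν := by
    obtain ⟨b, hb⟩ := exists_absError_le a hE₁ hE₂ S α i j
    have : MemLp (fun x => absError a hE₁ hE₂ S α i j (cellPt α ε x)) ⊤ ν :=
      memLp_top_of_bound ((measurable_absError a hE₁ hE₂ S α i j).comp
        (measurable_cellPt α ε)).aestronglyMeasurable b (Eventually.of_forall fun x => hb _)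
    exact (MemLp.mul' (r := 2) this hΦ2.abs).integrable_mul hd2
  have hPd : Integrable (fun x => absPderiv Φ x * absGrad Du x) ν := hP2.integrable_mul hd2
  set J := ∫ x in Ω, (|Φ x| + absPderiv Φ x) * (absGrad Du x + ∑ k, |G x k|) with hJdef
  have hG0 : ∀ x, 0 ≤ ∑ k, |G x k| := fun x => Finset.sum_nonneg fun _ _ => abs_nonneg _
  have hJ1 : ∫ x in Ω, absPderiv Φ x * absGrad Du x ≤ J := by
    refine integral_mono hPd hJ fun x => ?_
    exact mul_le_mul (le_add_of_nonneg_left (abs_nonneg _)) (le_add_of_nonneg_right (hG0 x))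
      (absGrad_nonneg _ _) (add_nonneg (abs_nonneg _) (absPderiv_nonneg _ _))
  -- the three terms are the truncation error with the terms of order `ε`, the oscillating modes,
  -- and the weak equation for the corrected test function, which leaves `∫ G · ψ`
  have e1 : |∫ x in Ω, (Φ x * ((C x).app (strain (Du x)) i j -
      (homA a hE₁ hE₂ α).app (strain (Du x)) i j) - (∑ m ∈ S.erase 0, ∑ p, Φ x * ∑ q,
        wave (fcL m (τ p q)) (layerFreq α ε m) x * Du x p q) +
      ddot ((C x).app (strain (Du x))) (strain (gradOf ψ x)))| ≤
      (∫ x in Ω, |Φ x| * absError a hE₁ hE₂ S α i j (cellPt α ε x) * absGrad Du x) +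
        ε * (9 * tensorBound E₁ E₂ * (S.card * B)) * J := by
    refine le_trans ?_ (add_le_add_right (mul_le_mul_of_nonneg_left hJ1 (by positivity)) _)
    rw [← integral_const_mul, ← integral_add hR (hPd.const_mul _), ← Real.norm_eq_abs]
    refine norm_integral_le_of_norm_le (hR.add (hPd.const_mul _)) ?_
    filter_upwards [ae_restrict_mem hΩ.measurableSet] with x hx
    exact abs_layer_integrand_le a hE₁ hE₂ h0 hε (hC2 x) hΦ.smooth (hCΦ x hx) Du i j
      (hB α hα i j).1 hB0
  have e2 : |∫ x in Ω, ∑ m ∈ S.erase 0, ∑ p, Φ x * ∑ q,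
      wave (fcL m (τ p q)) (layerFreq α ε m) x * Du x p q| ≤ S.card * (3 * (2 * B)) * ε * J := by
    have h1 : ∀ m ∈ S.erase 0, ∀ p, |∫ x in Ω, Φ x * ∑ q,
        wave (fcL m (τ p q)) (layerFreq α ε m) x * Du x p q| ≤ 2 * B * ε * J := by
      intro m hm p
      refine (abs_integral_wave_grad_le (sum_layerFreq_mul_stress a hE₁ hE₂ α ε i j p m)
        (fun q => (norm_fcL_le _ _).trans ((hB α hα i j).2 p q)) hB0 hε
        (one_le_sq_mul_layerFreq (Finset.ne_of_mem_erase hm) α hε) (hu.weak p) (hu.memLp_grad p)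
        hΦ).trans (mul_le_mul_of_nonneg_left (le_trans ?_ hJ1) (by positivity))
      refine integral_mono (hP2.integrable_mul (memLp_finsetSum_abs _ fun q _ => hu.memLp_grad p q))
        hPd fun x => mul_le_mul_of_nonneg_left ?_ (absPderiv_nonneg _ _)
      exact Finset.single_le_sum (f := fun k => ∑ q, |Du x k q|)
        (fun _ _ => Finset.sum_nonneg fun _ _ => abs_nonneg _) (Finset.mem_univ p)
    rw [integral_finsetSum _ fun m _ => integrable_finsetSum _ fun p _ => hA m p]
    have hJ0 : 0 ≤ J := (integral_nonneg fun x =>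
      mul_nonneg (absPderiv_nonneg _ _) (absGrad_nonneg _ _)).trans hJ1
    calc _ ≤ ∑ m ∈ S.erase 0, 3 * (2 * B * ε * J) := by
          refine (Finset.abs_sum_le_sum_abs _ _).trans (Finset.sum_le_sum fun m hm => ?_)
          rw [integral_finsetSum _ fun p _ => hA m p]
          refine (Finset.abs_sum_le_sum_abs _ _).trans
            ((Finset.sum_le_sum fun p _ => h1 m hm p).trans (le_of_eq ?_))
          simp
      _ = (S.erase 0).card * (3 * (2 * B * ε * J)) := by rw [Finset.sum_const, nsmul_eq_mul]
      _ ≤ S.card * (3 * (2 * B * ε * J)) := by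
          refine mul_le_mul_of_nonneg_right ?_ (by positivity)
          exact_mod_cast Finset.card_erase_le
      _ = _ := by ring
  have e3 : |∫ x in Ω, ddot ((C x).app (strain (Du x))) (strain (gradOf ψ x))| ≤
      S.card * B * ε * J := by
    rw [hweak ψ hψ, hJdef, ← integral_const_mul, ← Real.norm_eq_abs]
    refine norm_integral_le_of_norm_le (hJ.const_mul _) (Eventually.of_forall fun x => ?_)
    rw [Real.norm_eq_abs]
    have h1 : ∀ k, |G x k * ψ x k| ≤ |G x k| * (S.card * B * ε * |Φ x|) := by
      intro k
      rw [abs_mul]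
      refine mul_le_mul_of_nonneg_left ?_ (abs_nonneg _)
      rw [hψdef, layerTest, abs_mul, abs_mul, abs_of_pos hε]
      have := mul_le_mul_of_nonneg_left (abs_correctorFun_le S (hB α hα i j).1 (cellPt α ε x) k)
        (mul_nonneg hε.le (abs_nonneg (Φ x)))
      linarith
    refine (Finset.abs_sum_le_sum_abs _ _).trans ((Finset.sum_le_sum fun k _ => h1 k).trans ?_)
    rw [← Finset.sum_mul]
    have h2 : |Φ x| * (∑ k, |G x k|) ≤ (|Φ x| + absPderiv Φ x) * (absGrad Du x + ∑ k, |G x k|) :=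
      mul_le_mul (le_add_of_nonneg_right (absPderiv_nonneg _ _))
        (le_add_of_nonneg_left (absGrad_nonneg _ _)) (hG0 x)
        (add_nonneg (abs_nonneg _) (absPderiv_nonneg _ _))
    have h3 := mul_le_mul_of_nonneg_left h2 (show 0 ≤ S.card * B * ε by positivity)
    linarith
  have e4 : ∫ x in Ω, Φ x * ((C x).app (strain (Du x)) i j -
      (homA a hE₁ hE₂ α).app (strain (Du x)) i j) =
      (∫ x in Ω, (Φ x * ((C x).app (strain (Du x)) i j -
      (homA a hE₁ hE₂ α).app (strain (Du x)) i j) - (∑ m ∈ S.erase 0, ∑ p, Φ x * ∑ q,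
        wave (fcL m (τ p q)) (layerFreq α ε m) x * Du x p q) +
      ddot ((C x).app (strain (Du x))) (strain (gradOf ψ x)))) +
      (∫ x in Ω, ∑ m ∈ S.erase 0, ∑ p, Φ x * ∑ q,
        wave (fcL m (τ p q)) (layerFreq α ε m) x * Du x p q) -
      ∫ x in Ω, ddot ((C x).app (strain (Du x))) (strain (gradOf ψ x)) := by
    have hXA : Integrable (fun x => Φ x * ((C x).app (strain (Du x)) i j -
      (homA a hE₁ hE₂ α).app (strain (Du x)) i j) - ∑ m ∈ S.erase 0, ∑ p, Φ x * ∑ q,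
        wave (fcL m (τ p q)) (layerFreq α ε m) x * Du x p q) ν := hX.sub hA'
    rw [integral_add hXA hW, integral_sub hX hA']
    ring
  rw [e4]
  have e5 := abs_le.1 e1
  have e6 := abs_le.1 e2
  have e7 := abs_le.1 e3
  rw [abs_le]
  constructor <;> linarith

end

noncomputable section

/-! ### Summation over the layers -/

variable {E₁ E₂ : Tensor4} (a : ℝ) (hE₁ : IsStiffness E₁) (hE₂ : IsStiffness E₂)
  {Ω : Set (Pt 3)}

lemma integrable_and_integral_le_of_lintegral_le {n : ℕ} {μ : Measure (Pt n)} {f : Pt n → ℝ}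
    (hm : Measurable f) (hf : ∀ x, 0 ≤ f x) {c : ℝ} (hc : 0 ≤ c)
    (h : ∫⁻ x, ENNReal.ofReal (f x) ∂μ ≤ ENNReal.ofReal c) :
    Integrable f μ ∧ ∫ x, f x ∂μ ≤ c := by
  constructor
  · refine ⟨hm.aestronglyMeasurable, ?_⟩
    rw [hasFiniteIntegral_iff_ofReal (Eventually.of_forall hf)]
    exact h.trans_lt ENNReal.ofReal_lt_top
  · rw [integral_eq_lintegral_of_nonneg_ae (Eventually.of_forall hf) hm.aestronglyMeasurable]
    exact ENNReal.toReal_le_of_le_ofReal hc h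

/-- On a layer the squared error has an integral of the order of the thickness of the layer. -/
lemma integral_absError_sq_le {S : Finset (Fin 2 → ℤ)} {α η : ℝ} (i j : Fin 3)
    (hS : ∀ p q, ‖cellError a hE₁ hE₂ S α i j p q‖ ≤ η)
    {M ε ρ t : ℝ} (hM : 0 ≤ M) (hε : 0 < ε) (hε1 : ε ≤ 1) (hρ : ε ≤ ρ) {s : Set (Pt 3)}
    (hs : ∀ x ∈ s, (∀ b, |x b| ≤ M) ∧ t ≤ x 2 ∧ x 2 ≤ t + ρ) :
    IntegrableOn (fun x => absError a hE₁ hE₂ S α i j (cellPt α ε x) ^ 2) s ∧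
    ∫ x in s, absError a hE₁ hE₂ S α i j (cellPt α ε x) ^ 2 ≤
      (4 * M + 2) ^ 2 * (3 * ρ) * (81 * η ^ 2) := by
  have hρ0 : 0 < ρ := hε.trans_le hρ
  have hm : Measurable fun y => absError a hE₁ hE₂ S α i j y ^ 2 :=
    (measurable_absError a hE₁ hE₂ S α i j).pow_const 2
  refine integrable_and_integral_le_of_lintegral_le (hm.comp (measurable_cellPt α ε))
    (fun _ => sq_nonneg _) (by positivity) ?_
  have hper : IsLatticePeriodic fun y => ENNReal.ofReal (absError a hE₁ hE₂ S α i j y ^ 2) := by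
    intro y b
    have h : ∀ p q, errorFun a hE₁ hE₂ S α i j p q (y + EuclideanSpace.single b 1) =
        errorFun a hE₁ hE₂ S α i j p q y :=
      fun p q => isLatticePeriodic_errorFun a hE₁ hE₂ S α i j p q y b
    simp only [absError, h]
  refine (lintegral_comp_cellPt_le hper hm.ennreal_ofReal hM hε hε1 hρ α hs).trans ?_
  rw [ENNReal.ofReal_mul (by positivity) (q := 81 * η ^ 2)]
  refine mul_le_mul_right ?_ _
  calc ∫⁻ y in unitSquare, ENNReal.ofReal (absError a hE₁ hE₂ S α i j y ^ 2)
      ≤ ∫⁻ y in unitSquare, ∑ p, ∑ q,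
          9 * ENNReal.ofReal (errorFun a hE₁ hE₂ S α i j p q y ^ 2) := by
        refine lintegral_mono fun y => ?_
        have h1 : absError a hE₁ hE₂ S α i j y ^ 2 ≤
            ∑ p, ∑ q, 9 * errorFun a hE₁ hE₂ S α i j p q y ^ 2 := by
          unfold absError
          refine sq_sum_le_card_mul_sum_sq.trans ?_
          rw [Finset.card_univ, Fintype.card_fin, Finset.mul_sum]
          refine Finset.sum_le_sum fun p _ => ?_
          have h2 := sq_sum_le_card_mul_sum_sq (s := (Finset.univ : Finset (Fin 3)))
            (f := fun q => |errorFun a hE₁ hE₂ S α i j p q y|)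
          simp only [Finset.card_univ, Fintype.card_fin, sq_abs] at h2
          rw [← Finset.mul_sum]
          push_cast at h2 ⊢
          linarith
        refine (ENNReal.ofReal_le_ofReal h1).trans (le_of_eq ?_)
        rw [ENNReal.ofReal_sum_of_nonneg fun p _ => Finset.sum_nonneg fun q _ => by positivity]
        refine Finset.sum_congr rfl fun p _ => ?_
        rw [ENNReal.ofReal_sum_of_nonneg fun q _ => by positivity]
        refine Finset.sum_congr rfl fun q _ => ?_
        rw [ENNReal.ofReal_mul (by norm_num)]
        norm_num
    _ = ∑ p, ∑ q, 9 * ENNReal.ofReal (‖cellError a hE₁ hE₂ S α i j p q‖ ^ 2) := by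
        have hme : ∀ p q, Measurable fun y =>
            ENNReal.ofReal (errorFun a hE₁ hE₂ S α i j p q y ^ 2) := fun p q =>
          ((measurable_errorFun a hE₁ hE₂ S α i j p q).pow_const 2).ennreal_ofReal
        rw [lintegral_finsetSum _ fun p _ => Finset.measurable_fun_sum _ fun q _ =>
          (hme p q).const_mul 9]
        refine Finset.sum_congr rfl fun p _ => ?_
        rw [lintegral_finsetSum _ fun q _ => (hme p q).const_mul 9]
        refine Finset.sum_congr rfl fun q _ => ?_
        rw [lintegral_const_mul _ (hme p q), lintegral_errorFun_sq]
    _ ≤ ∑ _p : Fin 3, ∑ _q : Fin 3, 9 * ENNReal.ofReal (η ^ 2) := by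
        refine Finset.sum_le_sum fun p _ => Finset.sum_le_sum fun q _ => ?_
        gcongr
        exact hS p q
    _ = ENNReal.ofReal (81 * η ^ 2) := by
        rw [ENNReal.ofReal_mul (by norm_num)]
        simp only [Finset.sum_const, Finset.card_univ, Fintype.card_fin, nsmul_eq_mul]
        rw [← mul_assoc, ← mul_assoc]
        norm_num

lemma integral_one_sub_profile_sq_le {φ : ℝ → ℝ} (hφ : IsLayerProfile φ) {η : ℝ}
    (hφη : ∫⁻ t in Ico (0 : ℝ) 1, ENNReal.ofReal ((1 - φ t) ^ 2) ≤ ENNReal.ofReal (η ^ 2))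
    {M ρ : ℝ} (hM : 0 ≤ M) (hρ : 0 < ρ) (hρ1 : ρ ≤ 1) (hs : ∀ x ∈ Ω, ∀ b, |x b| ≤ M) :
    IntegrableOn (fun x : Pt 3 => (1 - φ (Int.fract (x 2 / ρ))) ^ 2) Ω ∧
    ∫ x in Ω, (1 - φ (Int.fract (x 2 / ρ))) ^ 2 ≤ (2 * M + 2) ^ 3 * η ^ 2 := by
  have hm : Measurable fun t => (1 - φ t) ^ 2 :=
    (measurable_const.sub hφ.smooth.continuous.measurable).pow_const 2
  refine integrable_and_integral_le_of_lintegral_le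
    (hm.comp (measurable_fract.comp (by fun_prop : Measurable fun x : Pt 3 => x 2 / ρ)))
    (fun _ => sq_nonneg _) (by positivity) ?_
  refine (lintegral_comp_fract_le hm.ennreal_ofReal hM hρ hρ1 hs).trans ?_
  rw [ENNReal.ofReal_mul (by positivity)]
  exact mul_le_mul_right hφη _

/-- Indices of the layers of thickness `ρ` that meet the region `|x₃| ≤ M`. -/
def layerIndices (M ρ : ℝ) : Finset ℤ := Finset.Icc (-(⌈M / ρ⌉ + 1)) (⌈M / ρ⌉ + 1)

lemma floor_add_one_mem_layerIndices {M ρ : ℝ} (hρ : 0 < ρ) {x : Pt 3} (hx : |x 2| ≤ M) :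
    ⌊x 2 / ρ⌋ + 1 ∈ layerIndices M ρ := by
  have h1 := abs_le.1 hx
  have h2 : x 2 / ρ ≤ M / ρ := by gcongr; exact h1.2
  have h3 : -(M / ρ) ≤ x 2 / ρ := by rw [← neg_div]; gcongr; exact h1.1
  have h4 : (⌊x 2 / ρ⌋ : ℝ) ≤ ⌈M / ρ⌉ := (Int.floor_le _).trans (h2.trans (Int.le_ceil _))
  have h5 : -(⌈M / ρ⌉ : ℝ) - 1 < ⌊x 2 / ρ⌋ := by
    linarith [Int.le_ceil (M / ρ), Int.sub_one_lt_floor (x 2 / ρ)]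
  have h6 : ⌊x 2 / ρ⌋ ≤ ⌈M / ρ⌉ := by exact_mod_cast h4
  have h7 : -⌈M / ρ⌉ - 1 < ⌊x 2 / ρ⌋ := by exact_mod_cast h5
  rw [layerIndices, Finset.mem_Icc]
  omega

lemma card_layerIndices_le {M ρ : ℝ} (hM : 0 ≤ M) (hρ : 0 < ρ) (hρ1 : ρ ≤ 1) :
    (layerIndices M ρ).card * ρ ≤ 2 * M + 5 := by
  have h0 : 0 ≤ ⌈M / ρ⌉ := Int.ceil_nonneg (by positivity)
  have h1 : ((layerIndices M ρ).card : ℤ) = 2 * ⌈M / ρ⌉ + 3 := by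
    rw [layerIndices, Int.card_Icc, Int.toNat_of_nonneg (by omega)]
    ring
  have h2 : ((layerIndices M ρ).card : ℝ) = 2 * ⌈M / ρ⌉ + 3 := by exact_mod_cast h1
  have h3 : (⌈M / ρ⌉ : ℝ) < M / ρ + 1 := Int.ceil_lt_add_one _
  have h4 : M / ρ * ρ = M := div_mul_cancel₀ M hρ.ne'
  rw [h2]
  nlinarith

lemma abs_mul_layerCutoff_le {φ : ℝ → ℝ} (hφ : IsLayerProfile φ) {ζ : Pt 3 → ℝ} {Z : ℝ}
    (hZ : ∀ x, |ζ x| ≤ Z) (ρ : ℝ) (k : ℤ) (x : Pt 3) :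
    |ζ x * layerCutoff φ ρ k x| ≤ if k = ⌊x 2 / ρ⌋ + 1 then Z else 0 := by
  split_ifs with hk
  · rw [abs_mul, layerCutoff, abs_of_nonneg (hφ.nonneg _)]
    exact (mul_le_of_le_one_right (abs_nonneg _) (hφ.le_one _)).trans (hZ x)
  · rw [layerCutoff_eq_zero hφ hk, mul_zero, abs_zero]

lemma absPderiv_mul_layerCutoff_le {φ : ℝ → ℝ} (hφ : IsLayerProfile φ) {L : ℝ}
    (hL : ∀ ρ, 0 < ρ → ∀ (k : ℤ) (q : Fin 3) (x : Pt 3),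
      |pderiv q (layerCutoff φ ρ k) x| ≤ if k = ⌊x 2 / ρ⌋ + 1 then L / ρ else 0)
    {ζ : Pt 3 → ℝ} (hζ : ContDiff ℝ ∞ ζ) {Z : ℝ} (hZ : ∀ x, |ζ x| ≤ Z)
    (hZ' : ∀ x, absPderiv ζ x ≤ Z) {ρ : ℝ} (hρ : 0 < ρ) (k : ℤ) (x : Pt 3) :
    absPderiv (fun x => ζ x * layerCutoff φ ρ k x) x ≤
      if k = ⌊x 2 / ρ⌋ + 1 then Z + 3 * (Z * (L / ρ)) else 0 := by
  have h1 : ∀ q, |pderiv q (fun x => ζ x * layerCutoff φ ρ k x) x| ≤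
      if k = ⌊x 2 / ρ⌋ + 1 then |pderiv q ζ x| + Z * (L / ρ) else 0 := by
    intro q
    rw [pderiv_mul hζ (contDiff_layerCutoff hφ.smooth ρ k)]
    refine (abs_add_le _ _).trans ?_
    rw [abs_mul, abs_mul]
    have h2 := hL ρ hρ k q x
    split_ifs with hk
    · rw [if_pos hk] at h2
      refine add_le_add ?_ (mul_le_mul (hZ x) h2 (abs_nonneg _) ((abs_nonneg _).trans (hZ x)))
      rw [layerCutoff, abs_of_nonneg (hφ.nonneg _)]
      exact mul_le_of_le_one_right (abs_nonneg _) (hφ.le_one _)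
    · rw [if_neg hk] at h2
      rw [layerCutoff_eq_zero hφ hk, le_antisymm h2 (abs_nonneg _)]
      simp
  refine (Finset.sum_le_sum fun q _ => h1 q).trans ?_
  split_ifs with hk
  · rw [Finset.sum_add_distrib, Finset.sum_const, Finset.card_univ, Fintype.card_fin, nsmul_eq_mul]
    have := hZ' x
    unfold absPderiv at this
    push_cast
    linarith
  · simp

lemma app_sub_left (E F : Tensor4) (ξ : Matrix (Fin 3) (Fin 3) ℝ) (i j : Fin 3) :
    (E - F).app ξ i j = E.app ξ i j - F.app ξ i j := by
  simp only [Tensor4.app, Matrix.of_apply, Pi.sub_apply, sub_mul, Finset.sum_sub_distrib]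

/-- The remainder outside of the cutoffs and the one due to the variation of the angle inside of a
layer. -/
lemma abs_sub_sum_layers_le {φ : ℝ → ℝ} (hφ : IsLayerProfile φ) {ζ : Pt 3 → ℝ} {Z : ℝ}
    (hZ : ∀ x, |ζ x| ≤ Z) {ρ T η θ : ℝ} (hη : 0 < η) {K : Finset ℤ} {x : Pt 3}
    (hx : ⌊x 2 / ρ⌋ + 1 ∈ K) {E : Tensor4} {A : Tensor4} {Ak : ℤ → Tensor4}
    (hE : ∀ i j k l, |E i j k l| ≤ T) (hA : ∀ i j k l, |A i j k l| ≤ T) (hθ : 0 ≤ θ)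
    (hAk : ∀ k, layerCutoff φ ρ k x ≠ 0 → ∀ i j l m, |Ak k i j l m - A i j l m| ≤ θ)
    (Du : Grad3 3) (i j : Fin 3) :
    |ζ x * (E.app (strain (Du x)) i j - A.app (strain (Du x)) i j) -
      ∑ k ∈ K, ζ x * layerCutoff φ ρ k x *
        (E.app (strain (Du x)) i j - (Ak k).app (strain (Du x)) i j)| ≤
      Z * (2 * T) * ((1 - φ (Int.fract (x 2 / ρ))) ^ 2 / (2 * η) + η / 2 * absGrad Du x ^ 2) +
      Z * θ * (1 / 2 + absGrad Du x ^ 2 / 2) := by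
  set e := strain (Du x) with he
  set d := absGrad Du x with hd
  set b := φ (Int.fract (x 2 / ρ)) with hb
  set k₀ := ⌊x 2 / ρ⌋ + 1 with hk₀
  have hZ0 : 0 ≤ Z := (abs_nonneg _).trans (hZ x)
  have hT0 : 0 ≤ T := (abs_nonneg _).trans (hE 0 0 0 0)
  have hd0 : 0 ≤ d := absGrad_nonneg _ _
  have h1 : ∑ k ∈ K, ζ x * layerCutoff φ ρ k x * (E.app e i j - (Ak k).app e i j) =
      ζ x * (b * (E.app e i j - (Ak k₀).app e i j)) := by
    simp only [mul_assoc, ← Finset.mul_sum]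
    rw [sum_layerCutoff_mul hφ hx]
  have h2 : ζ x * (E.app e i j - A.app e i j) - ζ x * (b * (E.app e i j - (Ak k₀).app e i j)) =
      ζ x * ((1 - b) * (E.app e i j - A.app e i j)) + ζ x * (b * ((Ak k₀ - A).app e i j)) := by
    rw [app_sub_left]
    ring
  have hb0 : 0 ≤ b := hφ.nonneg _
  have hb1 : b ≤ 1 := hφ.le_one _
  rw [h1, h2]
  refine (abs_add_le _ _).trans (add_le_add ?_ ?_)
  · have h3 : |E.app e i j - A.app e i j| ≤ 2 * T * d := by
      refine (abs_sub _ _).trans ?_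
      linarith [abs_app_le hE Du x i j, abs_app_le hA Du x i j]
    rw [abs_mul, abs_mul, abs_of_nonneg (by linarith : 0 ≤ 1 - b), mul_assoc Z]
    refine mul_le_mul (hZ x) ?_ (by positivity) hZ0
    have h4 : (1 - b) * d ≤ (1 - b) ^ 2 / (2 * η) + η / 2 * d ^ 2 := by
      have h5 : 0 ≤ ((1 - b) - η * d) ^ 2 / (2 * η) := by positivity
      have h6 : ((1 - b) - η * d) ^ 2 / (2 * η) =
          (1 - b) ^ 2 / (2 * η) + η / 2 * d ^ 2 - (1 - b) * d := by
        field_simp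
        ring
      linarith
    calc (1 - b) * |E.app e i j - A.app e i j| ≤ (1 - b) * (2 * T * d) :=
          mul_le_mul_of_nonneg_left h3 (by linarith)
      _ = 2 * T * ((1 - b) * d) := by ring
      _ ≤ _ := mul_le_mul_of_nonneg_left h4 (by positivity)
  · have h3 : |b * (Ak k₀ - A).app e i j| ≤ θ * d := by
      by_cases hb' : b = 0
      · rw [hb', zero_mul, abs_zero]; positivity
      · have h4 : layerCutoff φ ρ k₀ x ≠ 0 := by rwa [hk₀, layerCutoff_floor]
        rw [abs_mul, abs_of_nonneg hb0]
        exact (mul_le_of_le_one_left (abs_nonneg _) hb1).trans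
          (abs_app_le (E := Ak k₀ - A) (hAk k₀ h4) Du x i j)
    rw [abs_mul, mul_assoc Z]
    refine mul_le_mul (hZ x) (h3.trans (mul_le_mul_of_nonneg_left ?_ hθ)) (abs_nonneg _) hZ0
    nlinarith [sq_nonneg (d - 1)]

set_option maxHeartbeats 600000 in
/-- The central estimate: in the weak sense the microscopic stress differs little from the
homogenized tensor applied to the microscopic strain. Here `η` measures the truncation of Fourier
series and of layers, and `θ` the variation of the homogenized tensor inside of a layer. -/
lemma exists_plywood_estimate (hΩ : IsOpen Ω) {M : ℝ} (hM : ∀ x ∈ Ω, ∀ b, |x b| ≤ M) (hM0 : 0 ≤ M)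
    (hV : volume Ω ≠ ⊤)
    {G : Field3 3} (hG : ∀ k, MemLp (fun x => G x k) 2 (volume.restrict Ω))
    {γ : ℝ → ℝ} (hγ : Continuous γ) (hγr : ∀ t, γ t ∈ Icc 0 Real.pi) {r : ℝ} (hr0 : 0 < r)
    (hr1 : r < 1) {D : ℝ} (hD : 0 ≤ D) {ζ : Pt 3 → ℝ} (hζ : IsTestFunction Ω ζ) (i j : Fin 3) :
    ∃ C₁ : ℝ, 0 ≤ C₁ ∧ ∀ η, 0 < η → ∃ C₂ : ℝ, 0 ≤ C₂ ∧ ∀ ε, 0 < ε → ε ≤ 1 → ∀ θ, 0 ≤ θ →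
    ∀ p : ℤ → Pt 3, (∀ k, ∀ x ∈ layer r ε k, x ∈ Ω → ∀ i j l m,
      |homA a hE₁ hE₂ (γ (p k 2)) i j l m - homA a hE₁ hE₂ (γ (x 2)) i j l m| ≤ θ) →
    ∀ u Du, IsH1 Ω u Du → (∀ ψ : Field3 3, (∀ k, IsTestFunction Ω fun x => ψ x k) →
      ∫ x in Ω, ddot ((plywoodTensor Ω a γ E₁ E₂ r ε p x).app (strain (Du x)))
        (strain (gradOf ψ x)) = ∫ x in Ω, ∑ k, G x k * ψ x k) →
    ∫ x in Ω, absGrad Du x ^ 2 ≤ D →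
    |∫ x in Ω, ζ x * ((plywoodTensor Ω a γ E₁ E₂ r ε p x).app (strain (Du x)) i j -
      (homA a hE₁ hE₂ (γ (x 2))).app (strain (Du x)) i j)| ≤
      C₁ * (η + θ) + C₂ * ε ^ (1 - r) := by
  obtain ⟨Z₁, hZ₁0, hZ₁⟩ := hζ.exists_bound
  have hZ₂ : ∃ Z, ∀ x, |absPderiv ζ x| ≤ Z := exists_bound_finsetSum _ fun q _ => by
    obtain ⟨Z, -, hZ⟩ := (hζ.pderiv q).exists_bound
    exact ⟨Z, fun x => by rw [abs_abs]; exact hZ x⟩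
  obtain ⟨Z₂, hZ₂⟩ := hZ₂
  set Z := max Z₁ Z₂ with hZdef
  have hZ : ∀ x, |ζ x| ≤ Z := fun x => (hZ₁ x).trans (le_max_left _ _)
  have hZ' : ∀ x, absPderiv ζ x ≤ Z := fun x =>
    (le_abs_self _).trans ((hZ₂ x).trans (le_max_right _ _))
  have hZ0 : 0 ≤ Z := hZ₁0.trans (le_max_left _ _)
  obtain ⟨T₁, hT₁0, hT₁⟩ := exists_abs_homA_le a hE₁ hE₂
  set T := max T₁ (tensorBound E₁ E₂) with hTdef
  have hT0 : 0 ≤ T := hT₁0.trans (le_max_left _ _)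
  set ν := (volume : Measure (Pt 3)).restrict Ω with hν
  have : IsFiniteMeasure ν := isFiniteMeasure_restrict.2 hV
  set V := ν.real univ with hVdef
  have hV0 : 0 ≤ V := measureReal_nonneg
  have hG2 : MemLp (fun x => ∑ k, |G x k|) 2 ν := memLp_finsetSum_abs _ fun k _ => hG k
  set Q := ∫ x in Ω, (∑ k, |G x k|) ^ 2 with hQdef
  have hQ0 : 0 ≤ Q := integral_nonneg fun _ => sq_nonneg _
  set c₁ := (2 * M + 5) * ((4 * M + 2) ^ 2 * 3 * 81) with hc₁
  have hc₁0 : 0 ≤ c₁ := by positivity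
  refine ⟨Z * (c₁ + D) / 2 + Z * (2 * T) * ((2 * M + 2) ^ 3 + D) / 2 + Z * (V + D) / 2,
    by positivity, fun η hη => ?_⟩
  obtain ⟨S, h0S, hS⟩ := exists_norm_cellError_le a hE₁ hE₂ hη
  obtain ⟨φ, hφ, hφη⟩ := exists_layerProfile (show 0 < η ^ 2 by positivity)
  obtain ⟨L, hL0, hL⟩ := hφ.exists_pderiv_bound
  obtain ⟨K, hK0, hK⟩ := exists_layer_estimate a hE₁ hE₂ hΩ hG h0S
  refine ⟨K * ((2 * Z + 3 * (Z * L)) * (V + D / 2 + Q / 2)), by positivity,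
    fun ε hε hε1 θ hθ p hp u Du hu hweak hDu => ?_⟩
  set C := plywoodTensor Ω a γ E₁ E₂ r ε p with hCdef
  set ρ := ε ^ r with hρdef
  have hρ : 0 < ρ := Real.rpow_pos_of_pos hε r
  have hρ1 : ρ ≤ 1 := Real.rpow_le_one hε.le hε1 hr0.le
  have hερ : ε ≤ ρ := by
    calc ε = ε ^ (1 : ℝ) := (Real.rpow_one ε).symm
      _ ≤ ε ^ r := Real.rpow_le_rpow_of_exponent_ge hε hε1 hr1.le
  have hερ' : ε / ρ = ε ^ (1 - r) := by rw [Real.rpow_sub hε, Real.rpow_one]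
  have hC2 : ∀ x, C x = E₁ ∨ C x = E₂ := plywoodTensor_twoPhase hε
  have hC : IsBddTensor ν C := isBddTensor_plywoodTensor hΩ hε
  have hA : IsBddTensor ν fun x => homA a hE₁ hE₂ (γ (x 2)) := isBddTensor_homA a hE₁ hE₂ hγ hγr
  set d := absGrad Du with hd
  have hd2 : MemLp d 2 ν := memLp_absGrad hu.isL2Jet
  have hd0 : ∀ x, 0 ≤ d x := absGrad_nonneg _
  set Φ : ℤ → Pt 3 → ℝ := fun k x => ζ x * layerCutoff φ ρ k x with hΦdef
  have hΦ : ∀ k, IsTestFunction Ω (Φ k) := fun k =>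
    hζ.mul_right (contDiff_layerCutoff hφ.smooth ρ k)
  set I := layerIndices M ρ with hI
  have hxI : ∀ x ∈ Ω, ⌊x 2 / ρ⌋ + 1 ∈ I := fun x hx =>
    floor_add_one_mem_layerIndices hρ (hM x hx 2)
  have hlayer : ∀ k x, Φ k x ≠ 0 → x ∈ layer r ε k := fun k x hx =>
    mem_layer_of_layerCutoff_ne_zero hφ hε (right_ne_zero_of_mul hx)
  have hk : ∀ k, |∫ x in Ω, Φ k x * ((C x).app (strain (Du x)) i j -
      (homA a hE₁ hE₂ (γ (p k 2))).app (strain (Du x)) i j)| ≤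
      K * ε * (∫ x in Ω, (|Φ k x| + absPderiv (Φ k) x) * (d x + ∑ k, |G x k|)) +
      ∫ x in Ω, |Φ k x| * absError a hE₁ hE₂ S (γ (p k 2)) i j (cellPt (γ (p k 2)) ε x) * d x :=
    fun k => hK _ (hγr _) ε hε C hC hC2 u Du hu hweak (Φ k) (hΦ k)
      (fun x hx hne => plywoodTensor_of_mem_layer hε (hlayer k x hne) hx) i j
  have hint1 : ∀ k, Integrable (fun x => (|Φ k x| + absPderiv (Φ k) x) *
      (d x + ∑ k, |G x k|)) ν := fun k =>
    (((hΦ k).memLp 2 Ω).abs.add (memLp_absPderiv (hΦ k))).integrable_mul (hd2.add hG2)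
  have hdG : Integrable (fun x => d x + ∑ k, |G x k|) ν :=
    (hd2.integrable one_le_two).add (hG2.integrable one_le_two)
  have hdsq : Integrable (fun x => d x ^ 2) ν := hd2.integrable_sq
  have hsum1 : ∑ k ∈ I, ∫ x in Ω, (|Φ k x| + absPderiv (Φ k) x) * (d x + ∑ k, |G x k|) ≤
      (2 * Z + 3 * (Z * L)) / ρ * (V + D / 2 + Q / 2) := by
    rw [← integral_finsetSum _ fun k _ => hint1 k]
    have h1 : ∫ x in Ω, (d x + ∑ k, |G x k|) ≤ V + D / 2 + Q / 2 := by
      have h2 : Integrable (fun x => 1 + d x ^ 2 / 2 + (∑ k, |G x k|) ^ 2 / 2) ν :=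
        ((integrable_const 1).add (hdsq.div_const 2)).add (hG2.integrable_sq.div_const 2)
      have h3 : ∫ x in Ω, (1 + d x ^ 2 / 2 + (∑ k, |G x k|) ^ 2 / 2) =
          V + (∫ x in Ω, d x ^ 2) / 2 + Q / 2 := by
        have h4 : Integrable (fun x => 1 + d x ^ 2 / 2) ν :=
          (integrable_const 1).add (hdsq.div_const 2)
        rw [integral_add h4 (hG2.integrable_sq.div_const 2),
          integral_add (integrable_const 1) (hdsq.div_const 2), integral_div, integral_div,
          integral_const, smul_eq_mul, mul_one]
      refine (integral_mono hdG h2 fun x => ?_).trans ?_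
      · have := sq_nonneg (d x - 1)
        have := sq_nonneg (∑ k, |G x k| - 1)
        simp only
        nlinarith
      · rw [h3]
        linarith
    refine le_trans ?_ (mul_le_mul_of_nonneg_left h1 (by positivity))
    rw [← integral_const_mul]
    refine integral_mono_ae (integrable_finsetSum _ fun k _ => hint1 k) (hdG.const_mul _) ?_
    filter_upwards [ae_restrict_mem hΩ.measurableSet] with x hx
    rw [← Finset.sum_mul]
    refine mul_le_mul_of_nonneg_right ?_
      (add_nonneg (hd0 x) (Finset.sum_nonneg fun _ _ => abs_nonneg _))
    calc ∑ k ∈ I, (|Φ k x| + absPderiv (Φ k) x)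
        ≤ ∑ k ∈ I, if k = ⌊x 2 / ρ⌋ + 1 then Z + (Z + 3 * (Z * (L / ρ))) else 0 := by
          refine Finset.sum_le_sum fun k _ => ?_
          have h1 := abs_mul_layerCutoff_le hφ hZ ρ k x
          have h2 := absPderiv_mul_layerCutoff_le hφ hL hζ.smooth hZ hZ' hρ k x
          split_ifs at h1 h2 ⊢ with h3
          · exact add_le_add h1 h2
          · linarith
      _ = Z + (Z + 3 * (Z * (L / ρ))) := by
          rw [Finset.sum_ite_eq' I, if_pos (hxI x hx)]
      _ ≤ (2 * Z + 3 * (Z * L)) / ρ := by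
          rw [le_div_iff₀ hρ]
          have h1 : L / ρ * ρ = L := div_mul_cancel₀ L hρ.ne'
          have h2 : Z * ρ ≤ Z := mul_le_of_le_one_right hZ0 hρ1
          calc (Z + (Z + 3 * (Z * (L / ρ)))) * ρ = 2 * (Z * ρ) + 3 * (Z * (L / ρ * ρ)) := by ring
            _ ≤ _ := by rw [h1]; linarith
  have hsum2 : ∑ k ∈ I, ∫ x in Ω, |Φ k x| *
      absError a hE₁ hE₂ S (γ (p k 2)) i j (cellPt (γ (p k 2)) ε x) * d x ≤
      Z * (c₁ + D) / 2 * η := by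
    set er : ℤ → Pt 3 → ℝ := fun k x =>
      absError a hE₁ hE₂ S (γ (p k 2)) i j (cellPt (γ (p k 2)) ε x) with her
    have her2 : ∀ k, IntegrableOn (fun x => er k x ^ 2) (Ω ∩ layer r ε k) ∧
        ∫ x in Ω ∩ layer r ε k, er k x ^ 2 ≤ (4 * M + 2) ^ 2 * (3 * ρ) * (81 * η ^ 2) := fun k =>
      integral_absError_sq_le a hE₁ hE₂ i j (fun p' q => hS _ (hγr _) i j p' q) hM0 hε hε1 hερ
        (t := ((k : ℝ) - 1) * ρ) fun x hx => ⟨hM x hx.1, hx.2.1.le, by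
          have := hx.2.2.le
          linarith⟩
    have hΦd : ∀ k, Integrable (fun x => |Φ k x| * (η / 2 * d x ^ 2)) ν := by
      intro k
      obtain ⟨b, -, hb⟩ := (hΦ k).exists_bound
      exact (hdsq.const_mul (η / 2)).bdd_mul (c := b) (hΦ k).continuous.abs.aestronglyMeasurable
        (Eventually.of_forall fun x => by rw [Real.norm_eq_abs, abs_abs]; exact hb x)
    have hind : ∀ k, Integrable ((layer r ε k).indicator fun x => Z / (2 * η) * er k x ^ 2) ν := by
      intro k
      rw [integrable_indicator_iff (measurableSet_layer k), IntegrableOn,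
        Measure.restrict_restrict (measurableSet_layer k), inter_comm]
      exact (her2 k).1.const_mul _
    have h1 : ∀ k, ∫ x in Ω, |Φ k x| * er k x * d x ≤
        (∫ x in Ω, |Φ k x| * (η / 2 * d x ^ 2)) +
          Z / (2 * η) * ((4 * M + 2) ^ 2 * (3 * ρ) * (81 * η ^ 2)) := by
      intro k
      have h2 : ∫ x in Ω, |Φ k x| * er k x * d x ≤ ∫ x in Ω, (|Φ k x| * (η / 2 * d x ^ 2) +
          (layer r ε k).indicator (fun x => Z / (2 * η) * er k x ^ 2) x) := by
        refine integral_mono_of_nonneg (Eventually.of_forall fun x => ?_) ((hΦd k).add (hind k))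
          (Eventually.of_forall fun x => ?_)
        · exact mul_nonneg (mul_nonneg (abs_nonneg _) (absError_nonneg a hE₁ hE₂ _ _ _ _ _)) (hd0 x)
        · simp only
          by_cases hx : Φ k x = 0
          · rw [hx, abs_zero, zero_mul, zero_mul, zero_mul, zero_add]
            exact indicator_nonneg (fun x _ => by positivity) x
          · rw [indicator_of_mem (hlayer k x hx)]
            have h3 : er k x * d x ≤ er k x ^ 2 / (2 * η) + η / 2 * d x ^ 2 := by
              have h5 : 0 ≤ (er k x - η * d x) ^ 2 / (2 * η) := by positivity
              have h6 : (er k x - η * d x) ^ 2 / (2 * η) =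
                  er k x ^ 2 / (2 * η) + η / 2 * d x ^ 2 - er k x * d x := by
                field_simp
                ring
              linarith
            have h4 : |Φ k x| ≤ Z := by
              have := abs_mul_layerCutoff_le hφ hZ ρ k x
              split_ifs at this
              · exact this
              · exact this.trans hZ0
            have h5 := mul_le_mul_of_nonneg_left h3 (abs_nonneg (Φ k x))
            have h6 := mul_le_mul_of_nonneg_right h4
              (show 0 ≤ er k x ^ 2 / (2 * η) by positivity)
            calc |Φ k x| * er k x * d x = |Φ k x| * (er k x * d x) := by ring
              _ ≤ |Φ k x| * (er k x ^ 2 / (2 * η)) + |Φ k x| * (η / 2 * d x ^ 2) := by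
                  rw [← mul_add]; exact h5
              _ ≤ Z * (er k x ^ 2 / (2 * η)) + |Φ k x| * (η / 2 * d x ^ 2) := by gcongr
              _ = _ := by ring
      refine h2.trans ?_
      rw [integral_add (hΦd k) (hind k), integral_indicator (measurableSet_layer k),
        Measure.restrict_restrict (measurableSet_layer k), inter_comm, integral_const_mul]
      exact add_le_add_right (mul_le_mul_of_nonneg_left (her2 k).2 (by positivity)) _
    refine (Finset.sum_le_sum fun k _ => h1 k).trans ?_
    rw [Finset.sum_add_distrib, ← integral_finsetSum _ fun k _ => hΦd k, Finset.sum_const,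
      nsmul_eq_mul]
    have h2 : ∫ x in Ω, ∑ k ∈ I, |Φ k x| * (η / 2 * d x ^ 2) ≤ Z * (η / 2) * D := by
      refine le_trans (b := ∫ x in Ω, Z * (η / 2) * d x ^ 2) ?_ ?_
      · refine integral_mono_ae (integrable_finsetSum _ fun k _ => hΦd k) (hdsq.const_mul _) ?_
        filter_upwards [ae_restrict_mem hΩ.measurableSet] with x hx
        rw [← Finset.sum_mul, mul_assoc Z]
        refine mul_le_mul_of_nonneg_right ?_ (by positivity)
        refine (Finset.sum_le_sum fun k _ => abs_mul_layerCutoff_le hφ hZ ρ k x).trans ?_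
        rw [Finset.sum_ite_eq' I, if_pos (hxI x hx)]
      · rw [integral_const_mul]
        exact mul_le_mul_of_nonneg_left hDu (by positivity)
    have h3 : I.card * (Z / (2 * η) * ((4 * M + 2) ^ 2 * (3 * ρ) * (81 * η ^ 2))) ≤
        Z * c₁ / 2 * η := by
      have h4 := card_layerIndices_le hM0 hρ hρ1
      calc I.card * (Z / (2 * η) * ((4 * M + 2) ^ 2 * (3 * ρ) * (81 * η ^ 2)))
          = (I.card * ρ) * ((Z * ((4 * M + 2) ^ 2 * 3 * 81)) / 2 * η) := by field_simp
        _ ≤ (2 * M + 5) * ((Z * ((4 * M + 2) ^ 2 * 3 * 81)) / 2 * η) :=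
            mul_le_mul_of_nonneg_right h4 (by positivity)
        _ = _ := by rw [hc₁]; ring
    calc _ ≤ Z * (η / 2) * D + Z * c₁ / 2 * η := add_le_add h2 h3
      _ = _ := by ring
  -- what remains after the sum over the layers comes from the region where the cutoffs are not one
  -- and from the variation of the angle inside of a layer
  have hAk : ∀ k, IsBddTensor ν fun _ => homA a hE₁ hE₂ (γ (p k 2)) := fun k _ _ _ _ =>
    memLp_top_const _
  have hXk : ∀ k, Integrable (fun x => Φ k x * ((C x).app (strain (Du x)) i j -
      (homA a hE₁ hE₂ (γ (p k 2))).app (strain (Du x)) i j)) ν := fun k =>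
    ((hΦ k).memLp 2 Ω).integrable_mul ((memLp_app hC hu.isL2Jet i j).sub
      (memLp_app (hAk k) hu.isL2Jet i j))
  have hX : Integrable (fun x => ζ x * ((C x).app (strain (Du x)) i j -
      (homA a hE₁ hE₂ (γ (x 2))).app (strain (Du x)) i j)) ν :=
    (hζ.memLp 2 Ω).integrable_mul ((memLp_app hC hu.isL2Jet i j).sub
      (memLp_app hA hu.isL2Jet i j))
  have hφ2 := integral_one_sub_profile_sq_le hφ hφη hM0 hρ hρ1 hM
  have hrem : |∫ x in Ω, (ζ x * ((C x).app (strain (Du x)) i j -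
      (homA a hE₁ hE₂ (γ (x 2))).app (strain (Du x)) i j) - ∑ k ∈ I, Φ k x *
        ((C x).app (strain (Du x)) i j -
          (homA a hE₁ hE₂ (γ (p k 2))).app (strain (Du x)) i j))| ≤
      Z * (2 * T) * ((2 * M + 2) ^ 3 + D) / 2 * η + Z * (V + D) / 2 * θ := by
    have h1 : Integrable (fun x : Pt 3 => (1 - φ (Int.fract (x 2 / ρ))) ^ 2 / (2 * η) +
        η / 2 * d x ^ 2) ν := (hφ2.1.div_const _).add (hdsq.const_mul _)
    have h2 : Integrable (fun x : Pt 3 => 1 / 2 + d x ^ 2 / 2) ν :=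
      (integrable_const _).add (hdsq.div_const _)
    have h3 : ∫ x in Ω, (Z * (2 * T) * ((1 - φ (Int.fract (x 2 / ρ))) ^ 2 / (2 * η) +
        η / 2 * d x ^ 2) + Z * θ * (1 / 2 + d x ^ 2 / 2)) ≤
        Z * (2 * T) * ((2 * M + 2) ^ 3 + D) / 2 * η + Z * (V + D) / 2 * θ := by
      rw [integral_add (h1.const_mul _) (h2.const_mul _), integral_const_mul, integral_const_mul,
        integral_add (hφ2.1.div_const _) (hdsq.const_mul _), integral_div, integral_const_mul,
        integral_add (integrable_const _) (hdsq.div_const _), integral_div, integral_div,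
        integral_const, smul_eq_mul, ← hVdef]
      refine add_le_add ?_ ?_
      · calc _ ≤ Z * (2 * T) * ((2 * M + 2) ^ 3 * η ^ 2 / (2 * η) + η / 2 * D) := by
              gcongr
              exact hφ2.2
          _ = _ := by field_simp
      · calc _ ≤ Z * θ * (V * 1 / 2 + D / 2) := by gcongr
          _ = _ := by ring
    refine le_trans ?_ h3
    rw [← Real.norm_eq_abs]
    refine norm_integral_le_of_norm_le ((h1.const_mul _).add (h2.const_mul _)) ?_
    filter_upwards [ae_restrict_mem hΩ.measurableSet] with x hx
    refine abs_sub_sum_layers_le hφ hZ hη (hxI x hx)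
      (fun i j k l => (abs_le_tensorBound (hC2 x) i j k l).trans (le_max_right _ _))
      (fun i j k l => (hT₁ _ (hγr _) i j k l).trans (le_max_left _ _)) hθ (fun k hk => ?_) Du i j
    exact hp k x (mem_layer_of_layerCutoff_ne_zero hφ hε hk) hx
  have hsplit : ∫ x in Ω, ζ x * ((C x).app (strain (Du x)) i j -
      (homA a hE₁ hE₂ (γ (x 2))).app (strain (Du x)) i j) =
      (∫ x in Ω, (ζ x * ((C x).app (strain (Du x)) i j -
      (homA a hE₁ hE₂ (γ (x 2))).app (strain (Du x)) i j) - ∑ k ∈ I, Φ k x *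
        ((C x).app (strain (Du x)) i j -
          (homA a hE₁ hE₂ (γ (p k 2))).app (strain (Du x)) i j))) +
      ∑ k ∈ I, ∫ x in Ω, Φ k x * ((C x).app (strain (Du x)) i j -
          (homA a hE₁ hE₂ (γ (p k 2))).app (strain (Du x)) i j) := by
    rw [integral_sub hX (integrable_finsetSum _ fun k _ => hXk k),
      integral_finsetSum _ fun k _ => hXk k]
    ring
  rw [hsplit]
  have hlayers : |∑ k ∈ I, ∫ x in Ω, Φ k x * ((C x).app (strain (Du x)) i j -
      (homA a hE₁ hE₂ (γ (p k 2))).app (strain (Du x)) i j)| ≤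
      K * ((2 * Z + 3 * (Z * L)) * (V + D / 2 + Q / 2)) * ε ^ (1 - r) +
        Z * (c₁ + D) / 2 * η := by
    refine (Finset.abs_sum_le_sum_abs _ _).trans ((Finset.sum_le_sum fun k _ => hk k).trans ?_)
    rw [Finset.sum_add_distrib, ← Finset.mul_sum]
    refine add_le_add ?_ hsum2
    calc _ ≤ K * ε * ((2 * Z + 3 * (Z * L)) / ρ * (V + D / 2 + Q / 2)) :=
          mul_le_mul_of_nonneg_left hsum1 (by positivity)
      _ = K * ((2 * Z + 3 * (Z * L)) * (V + D / 2 + Q / 2)) * (ε / ρ) := by ring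
      _ = _ := by rw [hερ']
  have hfin : Z * (c₁ + D) / 2 * θ + Z * (2 * T) * ((2 * M + 2) ^ 3 + D) / 2 * θ +
      Z * (V + D) / 2 * η ≥ 0 := by positivity
  refine (abs_add_le _ _).trans ((add_le_add hrem hlayers).trans ?_)
  linarith

end

noncomputable section

/-! ### Passage to the limit -/

variable {E₁ E₂ : Tensor4} (a : ℝ) (hE₁ : IsStiffness E₁) (hE₂ : IsStiffness E₂)
  {Ω : Set (Pt 3)}

lemma tendsto_rpow_nhdsGT_zero {s : ℝ} (hs : 0 < s) :
    Tendsto (fun ε : ℝ => ε ^ s) (𝓝[>] 0) (𝓝 0) := by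
  have h := (Real.continuousAt_rpow_const 0 s (Or.inr hs.le)).tendsto
  rw [Real.zero_rpow hs.ne'] at h
  exact h.mono_left nhdsWithin_le_nhds

/-- The homogenized tensor varies little inside of thin layers. -/
lemma eventually_abs_homA_sub_le {M : ℝ} (hM : ∀ x ∈ Ω, ∀ b, |x b| ≤ M) {γ : ℝ → ℝ}
    (hγ : Continuous γ) {r : ℝ} (hr0 : 0 < r) {θ : ℝ} (hθ : 0 < θ) :
    ∀ᶠ ε in 𝓝[>] (0 : ℝ), ∀ p : ℤ → Pt 3, (∀ k, p k ∈ layer r ε k) →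
      ∀ k, ∀ x ∈ layer r ε k, x ∈ Ω → ∀ i j l m,
        |homA a hE₁ hE₂ (γ (p k 2)) i j l m - homA a hE₁ hE₂ (γ (x 2)) i j l m| ≤ θ := by
  have hF : Continuous fun t => homA a hE₁ hE₂ (γ t) :=
    continuous_pi fun i => continuous_pi fun j => continuous_pi fun l => continuous_pi fun m =>
      (continuous_homA a hE₁ hE₂ i j l m).comp hγ
  obtain ⟨δ, hδ, h⟩ := Metric.uniformContinuousOn_iff.1
    ((isCompact_Icc (a := -(M + 1)) (b := M + 1)).uniformContinuousOn_of_continuous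
      hF.continuousOn) θ hθ
  filter_upwards [(tendsto_rpow_nhdsGT_zero hr0).eventually_lt_const
    (show (0 : ℝ) < min δ 1 from lt_min hδ one_pos)] with ε hε p hp k x hx hxΩ i j l m
  have h1 := hp k
  have h2 := abs_le.1 (hM x hxΩ 2)
  obtain ⟨h3, h4⟩ := h1
  obtain ⟨h5, h6⟩ := hx
  have h7 := lt_min_iff.1 hε
  have h8 : dist (p k 2) (x 2) < δ := by
    rw [Real.dist_eq, abs_lt]
    constructor <;> linarith
  have h9 := h _ (show p k 2 ∈ Icc (-(M + 1)) (M + 1) from ⟨by linarith, by linarith⟩) _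
    (show x 2 ∈ Icc (-(M + 1)) (M + 1) from ⟨by linarith, by linarith⟩) h8
  rw [← Real.dist_eq]
  exact ((dist_le_pi_dist _ _ m).trans <| (dist_le_pi_dist _ _ l).trans <|
    (dist_le_pi_dist _ _ j).trans <| dist_le_pi_dist _ _ i).trans h9.le

lemma integral_absGrad_sq_le {n : ℕ} {μ : Measure (Pt n)} {u : Field3 n} {Du : Grad3 n}
    (h : IsL2Jet μ u Du) : ∫ x, absGrad Du x ^ 2 ∂μ ≤ 3 * n * ‖h.toJet‖ ^ 2 := by
  have hi : ∀ k q, Integrable (fun x => Du x k q ^ 2) μ := fun k q =>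
    (h.memLp_grad k q).integrable_sq
  have h1 : ∀ x, absGrad Du x ^ 2 ≤ 3 * n * ∑ k, ∑ q, Du x k q ^ 2 := by
    intro x
    unfold absGrad
    refine sq_sum_le_card_mul_sum_sq.trans ?_
    rw [Finset.card_univ, Fintype.card_fin, mul_assoc]
    push_cast
    refine mul_le_mul_of_nonneg_left ?_ (by norm_num)
    rw [Finset.mul_sum]
    refine Finset.sum_le_sum fun k _ => ?_
    have h2 := sq_sum_le_card_mul_sum_sq (s := (Finset.univ : Finset (Fin n)))
      (f := fun q => |Du x k q|)
    simpa only [Finset.card_univ, Fintype.card_fin, sq_abs] using h2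
  have hi' : Integrable (fun x => ∑ k, ∑ q, Du x k q ^ 2) μ :=
    integrable_finsetSum _ fun k _ => integrable_finsetSum _ fun q _ => hi k q
  refine (integral_mono (memLp_absGrad h).integrable_sq (hi'.const_mul _) h1).trans ?_
  rw [integral_const_mul]
  refine mul_le_mul_of_nonneg_left ?_ (by positivity)
  rw [integral_finsetSum _ fun k _ => integrable_finsetSum _ fun q _ => hi k q, Jet.norm_sq]
  refine Finset.sum_le_sum fun k _ => ?_
  rw [integral_finsetSum _ fun q _ => hi k q]
  refine le_trans (Finset.sum_le_sum fun q _ => ?_) (le_add_of_nonneg_left (sq_nonneg _))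
  rw [h.toJet_some, norm_toLp_sq]

/-- The difference of the microscopic stress and of the homogenized tensor applied to the
microscopic strain tends to zero in the sense of distributions. -/
lemma tendsto_integral_plywood_sub (hΩ : IsOpen Ω) (hΩb : Bornology.IsBounded Ω)
    {G : Field3 3} (hG : ∀ k, MemLp (fun x => G x k) 2 (volume.restrict Ω))
    {γ : ℝ → ℝ} (hγ : Continuous γ) (hγr : ∀ t, γ t ∈ Icc 0 Real.pi) {r : ℝ} (hr0 : 0 < r)
    (hr1 : r < 1) {D : ℝ} {ζ : Pt 3 → ℝ} (hζ : IsTestFunction Ω ζ) (i j : Fin 3)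
    {p : ℝ → ℤ → Pt 3} (hp : ∀ ε, 0 < ε → ∀ k, p ε k ∈ layer r ε k)
    {u : ℝ → Field3 3} {Du : ℝ → Grad3 3} (hu : ∀ ε, 0 < ε → IsH1 Ω (u ε) (Du ε))
    (hweak : ∀ ε, 0 < ε → ∀ ψ : Field3 3, (∀ k, IsTestFunction Ω fun x => ψ x k) →
      ∫ x in Ω, ddot ((plywoodTensor Ω a γ E₁ E₂ r ε (p ε) x).app (strain (Du ε x)))
        (strain (gradOf ψ x)) = ∫ x in Ω, ∑ k, G x k * ψ x k)
    (hD : ∀ ε, 0 < ε → ∫ x in Ω, absGrad (Du ε) x ^ 2 ≤ D) :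
    Tendsto (fun ε => ∫ x in Ω, ζ x *
      ((plywoodTensor Ω a γ E₁ E₂ r ε (p ε) x).app (strain (Du ε x)) i j -
        (homA a hE₁ hE₂ (γ (x 2))).app (strain (Du ε x)) i j)) (𝓝[>] 0) (𝓝 0) := by
  have hD0 : 0 ≤ D := le_trans (integral_nonneg fun _ => sq_nonneg _) (hD 1 one_pos)
  obtain ⟨M, hM0, hM⟩ := hΩb.exists_pos_norm_le
  have hM' : ∀ x ∈ Ω, ∀ b, |x b| ≤ M := fun x hx b => (PiLp.norm_apply_le x b).trans (hM x hx)
  obtain ⟨C₁, hC₁, h⟩ := exists_plywood_estimate a hE₁ hE₂ hΩ hM' hM0.le hΩb.measure_lt_top.ne hG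
    hγ hγr hr0 hr1 hD0 hζ i j
  rw [Metric.tendsto_nhds]
  intro δ hδ
  set η := δ / (4 * (C₁ + 1)) with hη
  have hη0 : 0 < η := by positivity
  obtain ⟨C₂, hC₂, h⟩ := h η hη0
  have hlim : Tendsto (fun ε : ℝ => C₂ * ε ^ (1 - r)) (𝓝[>] 0) (𝓝 0) := by
    simpa using (tendsto_rpow_nhdsGT_zero (sub_pos.2 hr1)).const_mul C₂
  filter_upwards [eventually_abs_homA_sub_le a hE₁ hE₂ hM' hγ hr0 hη0, self_mem_nhdsWithin,
    (tendsto_nhdsWithin_of_tendsto_nhds tendsto_id).eventually_lt_const (one_pos (α := ℝ)),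
    hlim.eventually_lt_const (half_pos hδ)] with ε h1 hε h2 h3
  have h4 := h ε hε (le_of_lt h2) η hη0.le (p ε) (h1 (p ε) (hp ε hε)) (u ε) (Du ε) (hu ε hε)
    (hweak ε hε) (hD ε hε)
  rw [Real.dist_eq, sub_zero]
  have h5 : C₁ * (η + η) ≤ δ / 2 := by
    have h6 : δ / 2 = (C₁ + 1) * (η + η) := by
      rw [hη]
      field_simp
      ring
    rw [h6]
    gcongr
    linarith
  linarith

/-- A bounded family in `H¹₀` converges weakly to zero as soon as it does so when tested, through
a coercive form, with test functions: by the Lax–Milgram theorem for the transposed form every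
functional is represented by an element of `H¹₀`. -/
lemma tendsto_apply_of_form {n : ℕ} {Ω : Set (Pt n)}
    {B : Jet n (volume.restrict Ω) →L[ℝ] Jet n (volume.restrict Ω) →L[ℝ] ℝ} {κ : ℝ} (hκ : 0 < κ)
    (hB : ∀ z ∈ zeroTraceJets Ω, κ * ‖z‖ ^ 2 ≤ B z z) {l : Filter ℝ}
    {z : ℝ → Jet n (volume.restrict Ω)} (hz : ∀ ε, z ε ∈ zeroTraceJets Ω) {b : ℝ}
    (hzb : ∀ ε, ‖z ε‖ ≤ b)
    (h : ∀ (φ : Field3 n) (hφ : ∀ k, IsTestFunction Ω (fun x => φ x k)),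
      Tendsto (fun ε => B (z ε) (isL2Jet_of_test hφ).toJet) l (𝓝 0))
    (F : Jet n (volume.restrict Ω) →L[ℝ] ℝ) : Tendsto (fun ε => F (z ε)) l (𝓝 0) := by
  obtain ⟨v, hv, hvF⟩ := exists_mem_form_eq (zeroTraceJets Ω) isClosed_zeroTraceJets B.flip hκ
    (fun z hz => by rw [ContinuousLinearMap.flip_apply]; exact hB z hz) F
  have h1 : ∀ ε, F (z ε) = B (z ε) v := fun ε => by
    rw [← hvF _ (hz ε), ContinuousLinearMap.flip_apply]
  simp only [h1]
  refine zeroTraceJets_induction (P := fun v => Tendsto (fun ε => B (z ε) v) l (𝓝 0)) ?_ h hv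
  have hb : 0 ≤ b := (norm_nonneg _).trans (hzb 0)
  refine isClosed_of_closure_subset fun v hv => ?_
  rw [mem_ofPred_eq, Metric.tendsto_nhds]
  intro δ hδ
  obtain ⟨w, hw, hvw⟩ := Metric.mem_closure_iff.1 hv (δ / (2 * (‖B‖ * b + 1))) (by positivity)
  filter_upwards [(Metric.tendsto_nhds.1 hw) (δ / 2) (half_pos hδ)] with ε hε
  rw [Real.dist_eq, sub_zero] at hε ⊢
  have h2 : |B (z ε) (v - w)| ≤ ‖B‖ * b * ‖v - w‖ := by
    refine (B.le_opNorm₂ (z ε) (v - w)).trans ?_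
    gcongr
    exact hzb ε
  have h3 : ‖B‖ * b * ‖v - w‖ ≤ δ / 2 := by
    rw [dist_eq_norm] at hvw
    calc ‖B‖ * b * ‖v - w‖ ≤ (‖B‖ * b + 1) * (δ / (2 * (‖B‖ * b + 1))) := by
          gcongr
          linarith
      _ = δ / 2 := by field_simp
  have h4 : B (z ε) v = B (z ε) (v - w) + B (z ε) w := by rw [← map_add, sub_add_cancel]
  rw [h4]
  exact (abs_add_le _ _).trans_lt (by linarith)

lemma isTestFunction_strain {φ : Field3 3} (hφ : ∀ k, IsTestFunction Ω (fun x => φ x k))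
    (i j : Fin 3) : IsTestFunction Ω fun x => strain (gradOf φ x) i j := by
  have h := (((hφ i).pderiv j).add ((hφ j).pderiv i)).const_mul (1 / 2)
  have e : (fun x => strain (gradOf φ x) i j) = fun x =>
      1 / 2 * (pderiv j (fun z => φ z i) x + pderiv i (fun z => φ z j) x) := by
    funext x
    simp only [strain, gradOf, Matrix.of_apply]
    ring
  rw [e]
  exact h

lemma elForm_sub_elForm_test {C A : Pt 3 → Tensor4} (hC : IsBddTensor (volume.restrict Ω) C)
    (hA : IsBddTensor (volume.restrict Ω) A) {u : Field3 3} {Du : Grad3 3}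
    (hu : IsL2Jet (volume.restrict Ω) u Du) {φ : Field3 3}
    (hφ : ∀ k, IsTestFunction Ω (fun x => φ x k)) :
    elForm (volume.restrict Ω) C 1 hu.toJet (isL2Jet_of_test hφ).toJet -
      elForm (volume.restrict Ω) A 1 hu.toJet (isL2Jet_of_test hφ).toJet =
    ∑ i, ∑ j, ∫ x in Ω, strain (gradOf φ x) i j *
      ((C x).app (strain (Du x)) i j - (A x).app (strain (Du x)) i j) := by
  have hi : ∀ {F : Pt 3 → Tensor4}, IsBddTensor (volume.restrict Ω) F → ∀ i j,
      Integrable (fun x => (F x).app (strain (Du x)) i j * strain (gradOf φ x) i j)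
        (volume.restrict Ω) := fun hF i j =>
    (memLp_app hF hu i j).integrable_mul ((isTestFunction_strain hφ i j).memLp 2 Ω)
  have key : ∀ {F : Pt 3 → Tensor4}, IsBddTensor (volume.restrict Ω) F →
      elForm (volume.restrict Ω) F 1 hu.toJet (isL2Jet_of_test hφ).toJet =
      ∑ i, ∑ j, ∫ x in Ω, (F x).app (strain (Du x)) i j * strain (gradOf φ x) i j := by
    intro F hF
    rw [elForm_one_toJet hF]
    simp only [ddot]
    rw [integral_finsetSum _ fun i _ => integrable_finsetSum _ fun j _ => hi hF i j]
    exact Finset.sum_congr rfl fun i _ => integral_finsetSum _ fun j _ => hi hF i j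
  rw [key hC, key hA, ← Finset.sum_sub_distrib]
  refine Finset.sum_congr rfl fun i _ => ?_
  rw [← Finset.sum_sub_distrib]
  refine Finset.sum_congr rfl fun j _ => ?_
  rw [← integral_sub (hi hC i j) (hi hA i j)]
  refine integral_congr_ae (Eventually.of_forall fun x => ?_)
  simp only
  ring

/-- The difference of the solutions for two tensor fields `C` and `A`, tested through the form of
`A`, is the work of the difference of the stresses that the two tensors produce from the strain of
the solution for `C`. -/
lemma elForm_sub_weakSolution {G g : Field3 3} {Dg : Grad3 3}
    (hG : ∀ k, MemLp (fun x => G x k) 2 (volume.restrict Ω)) (hΩ : IsOpen Ω) (hg : IsH1 Ω g Dg)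
    {C A : Pt 3 → Tensor4} (hC : IsBddTensor (volume.restrict Ω) C)
    (hA : IsBddTensor (volume.restrict Ω) A) {u u₀ : Field3 3} {Du Du₀ : Grad3 3}
    (hu : IsWeakSolution Ω C G g Dg u Du) (hu₀ : IsWeakSolution Ω A G g Dg u₀ Du₀) {φ : Field3 3}
    (hφ : ∀ k, IsTestFunction Ω (fun x => φ x k)) :
    elForm (volume.restrict Ω) A 1 (hu.isH1.isL2Jet.toJet - hu₀.isH1.isL2Jet.toJet)
      (isL2Jet_of_test hφ).toJet =
    -∑ i, ∑ j, ∫ x in Ω, strain (gradOf φ x) i j *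
      ((C x).app (strain (Du x)) i j - (A x).app (strain (Du x)) i j) := by
  have hφm := toJet_test_mem hφ
  obtain ⟨_, _, h3⟩ := (isWeakSolution_iff hG hΩ hC hg).1 hu
  obtain ⟨_, _, h4⟩ := (isWeakSolution_iff hG hΩ hA hg).1 hu₀
  have e : elForm (volume.restrict Ω) A 1 (hu.isH1.isL2Jet.toJet - hu₀.isH1.isL2Jet.toJet) =
      elForm (volume.restrict Ω) A 1 hu.isH1.isL2Jet.toJet -
        elForm (volume.restrict Ω) A 1 hu₀.isH1.isL2Jet.toJet := map_sub _ _ _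
  rw [e, _root_.sub_apply, h4 _ hφm, ← h3 _ hφm, ← elForm_sub_elForm_test hC hA _ hφ, neg_sub]

/-- Weak convergence in `H¹` in terms of jets. -/
lemma weakH1Tendsto_of_toJet {n : ℕ} {Ω : Set (Pt n)} {u : ℝ → Field3 n} {Du : ℝ → Grad3 n}
    {u₀ : Field3 n} {Du₀ : Grad3 n} (hu : ∀ ε, 0 < ε → IsL2Jet (volume.restrict Ω) (u ε) (Du ε))
    (hu₀ : IsL2Jet (volume.restrict Ω) u₀ Du₀) {z : ℝ → Jet n (volume.restrict Ω)}
    (hz : ∀ ε (hε : 0 < ε), z ε = (hu ε hε).toJet - hu₀.toJet)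
    (h : ∀ F : Jet n (volume.restrict Ω) →L[ℝ] ℝ, Tendsto (fun ε => F (z ε)) (𝓝[>] 0) (𝓝 0)) :
    WeakH1Tendsto Ω u Du u₀ Du₀ := by
  intro v hv
  have hF : ∀ q (f : ℝ → Pt n → ℝ) (f₀ : Pt n → ℝ) (hf : ∀ ε, 0 < ε →
      MemLp (f ε) 2 (volume.restrict Ω)) (hf₀ : MemLp f₀ 2 (volume.restrict Ω)),
      (∀ ε (hε : 0 < ε), (hu ε hε).toJet q = (hf ε hε).toLp _) → hu₀.toJet q = hf₀.toLp _ →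
      Tendsto (fun ε => ∫ x in Ω, f ε x * v x) (𝓝[>] 0) (𝓝 (∫ x in Ω, f₀ x * v x)) := by
    intro q f f₀ hf hf₀ h1 h2
    have h3 := h (innerSL ℝ (hv.toLp v) ∘L
      PiLp.proj 2 (fun _ : Fin 3 × Option (Fin n) => Lp ℝ 2 (volume.restrict Ω)) q)
    rw [← tendsto_sub_nhds_zero_iff]
    refine h3.congr' ?_
    filter_upwards [self_mem_nhdsWithin] with ε hε
    rw [ContinuousLinearMap.comp_apply, PiLp.proj_apply, innerSL_apply_apply, hz ε hε,
      PiLp.sub_apply, h1 ε hε, h2, inner_sub_right, real_inner_comm, real_inner_comm (hf₀.toLp _),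
      inner_toLp, inner_toLp]
  exact ⟨fun k => hF (k, none) _ _ (fun ε hε => (hu ε hε).memLp k) (hu₀.memLp k)
      (fun ε hε => rfl) rfl,
    fun k j => hF (k, some j) _ _ (fun ε hε => (hu ε hε).memLp_grad k j) (hu₀.memLp_grad k j)
      (fun ε hε => rfl) rfl⟩

/-- Bounded solutions for tensor fields `C ε` converge weakly to the solution for `A` if the
difference of the stresses that `C ε` and `A` produce from the strain of the solution for `C ε`
tends to zero in the sense of distributions. -/
lemma weakH1Tendsto_of_tendsto_stress (hΩ : IsOpen Ω) {G g : Field3 3} {Dg : Grad3 3}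
    (hG : ∀ k, MemLp (fun x => G x k) 2 (volume.restrict Ω)) (hg : IsH1 Ω g Dg)
    {C : ℝ → Pt 3 → Tensor4} {A : Pt 3 → Tensor4}
    (hC : ∀ ε, 0 < ε → IsBddTensor (volume.restrict Ω) (C ε))
    (hA : IsBddTensor (volume.restrict Ω) A) {κ : ℝ} (hκ0 : 0 < κ)
    (hκ : ∀ z ∈ zeroTraceJets Ω, κ * ‖z‖ ^ 2 ≤ elForm (volume.restrict Ω) A 1 z z)
    {u : ℝ → Field3 3} {Du : ℝ → Grad3 3}
    (hu : ∀ ε, 0 < ε → IsWeakSolution Ω (C ε) G g Dg (u ε) (Du ε)) {b : ℝ}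
    (hb : ∀ ε (hε : 0 < ε), ‖(hu ε hε).isH1.isL2Jet.toJet‖ ≤ b)
    {u₀ : Field3 3} {Du₀ : Grad3 3} (hu₀ : IsWeakSolution Ω A G g Dg u₀ Du₀)
    (hlim : ∀ ζ, IsTestFunction Ω ζ → ∀ i j, Tendsto (fun ε => ∫ x in Ω, ζ x *
      ((C ε x).app (strain (Du ε x)) i j - (A x).app (strain (Du ε x)) i j)) (𝓝[>] 0) (𝓝 0)) :
    WeakH1Tendsto Ω u Du u₀ Du₀ := by
  have hb0 : 0 ≤ b := (norm_nonneg _).trans (hb 1 one_pos)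
  set w := hu₀.isH1.isL2Jet.toJet with hw
  obtain ⟨_, hw2, _⟩ := (isWeakSolution_iff hG hΩ hA hg).1 hu₀
  set z : ℝ → Jet 3 (volume.restrict Ω) := fun ε =>
    if hε : 0 < ε then (hu ε hε).isH1.isL2Jet.toJet - w else 0 with hz
  have hzpos : ∀ ε (hε : 0 < ε), z ε = (hu ε hε).isH1.isL2Jet.toJet - w := fun ε hε => dif_pos hε
  refine weakH1Tendsto_of_toJet (fun ε hε => (hu ε hε).isH1.isL2Jet) hu₀.isH1.isL2Jet hzpos ?_
  refine tendsto_apply_of_form hκ0 hκ (b := b + ‖w‖) (fun ε => ?_) (fun ε => ?_) fun φ hφ => ?_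
  · by_cases hε : 0 < ε
    · obtain ⟨_, h2, _⟩ := (isWeakSolution_iff hG hΩ (hC ε hε) hg).1 (hu ε hε)
      have h3 := (zeroTraceJets Ω).sub_mem h2 hw2
      rw [sub_sub_sub_cancel_right] at h3
      rw [hzpos ε hε]
      exact h3
    · rw [hz]
      simp only [dif_neg hε]
      exact Submodule.zero_mem _
  · by_cases hε : 0 < ε
    · rw [hzpos ε hε]
      exact (norm_sub_le _ _).trans (add_le_add_left (hb ε hε) _)
    · rw [hz]
      simp only [dif_neg hε, norm_zero]
      positivity
  · have h := (tendsto_finsetSum Finset.univ fun i _ => tendsto_finsetSum Finset.univ fun j _ =>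
      hlim _ (isTestFunction_strain hφ i j) i j).neg
    simp only [Finset.sum_const_zero, neg_zero] at h
    refine h.congr' ?_
    filter_upwards [self_mem_nhdsWithin] with ε hε
    rw [hzpos ε hε]
    have h2 := elForm_sub_weakSolution hG hΩ hg (hC ε hε) hA (hu ε hε) hu₀ hφ
    rw [h2]

/-- Solutions of the microscopic problems converge weakly to the solution of the macroscopic
problem. -/
lemma weakH1Tendsto_plywood (hΩ : IsOpen Ω) (hΩb : Bornology.IsBounded Ω)
    {G g : Field3 3} {Dg : Grad3 3} (hG : ∀ k, MemLp (fun x => G x k) 2 (volume.restrict Ω))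
    (hg : IsH1 Ω g Dg) {γ : ℝ → ℝ} (hγ : Continuous γ) (hγr : ∀ t, γ t ∈ Icc 0 Real.pi) {r : ℝ}
    (hr0 : 0 < r) (hr1 : r < 1) {p : ℝ → ℤ → Pt 3}
    (hp : ∀ ε, 0 < ε → ∀ k, p ε k ∈ layer r ε k) {u : ℝ → Field3 3} {Du : ℝ → Grad3 3}
    (hu : ∀ ε, 0 < ε → IsWeakSolution Ω (plywoodTensor Ω a γ E₁ E₂ r ε (p ε)) G g Dg
      (u ε) (Du ε)) {u₀ : Field3 3} {Du₀ : Grad3 3}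
    (hu₀ : IsWeakSolution Ω (fun x => homA a hE₁ hE₂ (γ (x 2))) G g Dg u₀ Du₀) :
    WeakH1Tendsto Ω u Du u₀ Du₀ := by
  obtain ⟨c, hc0, hc⟩ := exists_coercive hE₁ hE₂
  have hC2 : ∀ ε, 0 < ε → ∀ x, plywoodTensor Ω a γ E₁ E₂ r ε (p ε) x = E₁ ∨
      plywoodTensor Ω a γ E₁ E₂ r ε (p ε) x = E₂ := fun ε hε => plywoodTensor_twoPhase hε
  have hC : ∀ ε, 0 < ε → IsBddTensor (volume.restrict Ω)
      (plywoodTensor Ω a γ E₁ E₂ r ε (p ε)) := fun ε hε => isBddTensor_plywoodTensor hΩ hε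
  have hA : IsBddTensor (volume.restrict Ω) fun x => homA a hE₁ hE₂ (γ (x 2)) :=
    isBddTensor_homA a hE₁ hE₂ hγ hγr
  obtain ⟨κ, hκ0, hκ⟩ := exists_le_elForm_zeroTrace hΩ hΩb hc0
  obtain ⟨b, hb⟩ := exists_norm_isWeakSolution_le hG hΩ hΩb hg hc0 (tensorBound E₁ E₂)
  have hub : ∀ ε (hε : 0 < ε), ‖(hu ε hε).isH1.isL2Jet.toJet‖ ≤ b := fun ε hε =>
    hb _ (hC ε hε) (fun x => abs_le_tensorBound (hC2 ε hε x))
      (fun x ξ hξ => hc _ (hC2 ε hε x) ξ hξ) _ _ (hu ε hε)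
  have hweak : ∀ ε, 0 < ε → ∀ ψ : Field3 3, (∀ k, IsTestFunction Ω fun x => ψ x k) →
      ∫ x in Ω, ddot ((plywoodTensor Ω a γ E₁ E₂ r ε (p ε) x).app (strain (Du ε x)))
        (strain (gradOf ψ x)) = ∫ x in Ω, ∑ k, G x k * ψ x k := fun ε hε ψ hψ =>
    (hu ε hε).weak ψ _ ((toJet_mem_zeroTraceJets_iff hΩ _).1 (toJet_test_mem hψ))
  have hD : ∀ ε, 0 < ε → ∫ x in Ω, absGrad (Du ε) x ^ 2 ≤ 3 * (3 : ℕ) * b ^ 2 := fun ε hε =>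
    (integral_absGrad_sq_le (hu ε hε).isH1.isL2Jet).trans (by
      have := hub ε hε
      gcongr)
  exact weakH1Tendsto_of_tendsto_stress hΩ hG hg hC hA hκ0
    (hκ _ hA fun x ξ hξ => homA_coercive a hE₁ hE₂ hc0 hc _ hξ) hu hub hu₀ fun ζ hζ i j =>
      tendsto_integral_plywood_sub a hE₁ hE₂ hΩ hΩb hG hγ hγr hr0 hr1 hζ i j hp
        (fun ε hε => (hu ε hε).isH1) hweak hD

end

theorem theorem4p2
    (Ω : Set (Pt 3)) (hΩ : IsOpen Ω) (hΩb : Bornology.IsBounded Ω)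
    (a : ℝ) (ha₀ : 0 < a) (ha : a < 1 / 2)
    (γ : ℝ → ℝ) (hγ : ContDiff ℝ 2 γ) (hγr : ∀ t, 0 ≤ γ t ∧ γ t ≤ Real.pi)
    (E₁ E₂ : Tensor4) (hE₁ : IsStiffness E₁) (hE₂ : IsStiffness E₂)
    (G : Field3 3) (hG : ∀ k, MemLp (fun x => G x k) 2 (volume.restrict Ω))
    (g : Field3 3) (Dg : Grad3 3) (hg : IsH1 Ω g Dg) :
    -- the cell problems are solvable
    (∀ (t : ℝ) (i j : Fin 3), ∃ (w : Field3 2) (Dw : Grad3 2),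
      IsCellSolution a E₁ E₂ (γ t) i j w Dw) ∧
    -- for any choice `W t i j` of the cell solutions at height `t`
    ∀ (W : ℝ → Fin 3 → Fin 3 → Field3 2) (DW : ℝ → Fin 3 → Fin 3 → Grad3 2),
      (∀ t i j, IsCellSolution a E₁ E₂ (γ t) i j (W t i j) (DW t i j)) →
      -- the macroscopic problem has a unique weak solution `u`
      ∃ (u : Field3 3) (Du : Grad3 3),
        IsWeakSolution Ω (fun x => homTensor a E₁ E₂ (γ (x 2)) (DW (x 2))) G g Dg u Du ∧
        (∀ (v : Field3 3) (Dv : Grad3 3),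
          IsWeakSolution Ω (fun x => homTensor a E₁ E₂ (γ (x 2)) (DW (x 2))) G g Dg v Dv →
            v =ᵐ[volume.restrict Ω] u) ∧
        -- for every layer exponent and every choice of points in the layers
        ∀ (r : ℝ), 0 < r → r < 1 → ∀ (p : ℝ → ℤ → Pt 3),
          (∀ ε, 0 < ε → ∀ k, p ε k ∈ layer r ε k) →
          -- the microscopic problems are solvable, and their solutions converge to `u`
          (∀ ε, 0 < ε → ∃ (w : Field3 3) (Dw : Grad3 3),
            IsWeakSolution Ω (plywoodTensor Ω a γ E₁ E₂ r ε (p ε)) G g Dg w Dw) ∧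
          ∀ (uε : ℝ → Field3 3) (Duε : ℝ → Grad3 3),
            (∀ ε, 0 < ε → IsWeakSolution Ω (plywoodTensor Ω a γ E₁ E₂ r ε (p ε)) G g Dg
              (uε ε) (Duε ε)) →
            WeakH1Tendsto Ω uε Duε u Du := by
  have hγc : Continuous γ := hγ.continuous
  have hγI : ∀ t, γ t ∈ Icc 0 Real.pi := hγr
  obtain ⟨c, hc0, hc⟩ := exists_coercive hE₁ hE₂
  have hA : IsBddTensor (volume.restrict Ω) fun x => homA a hE₁ hE₂ (γ (x 2)) :=
    isBddTensor_homA a hE₁ hE₂ hγc hγI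
  have hAc : ∀ (x : Pt 3) (ξ : Matrix (Fin 3) (Fin 3) ℝ), ξ.IsSymm →
      c * ddot ξ ξ ≤ ddot ((homA a hE₁ hE₂ (γ (x 2))).app ξ) ξ := fun x ξ hξ =>
    homA_coercive a hE₁ hE₂ hc0 hc _ hξ
  refine ⟨fun t i j => ⟨_, _, isCellSolution_cellJet a hE₁ hE₂ (γ t) i j⟩, fun W DW hW => ?_⟩
  have hhom : (fun x : Pt 3 => homTensor a E₁ E₂ (γ (x 2)) (DW (x 2))) =
      fun x => homA a hE₁ hE₂ (γ (x 2)) :=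
    funext fun x => homTensor_eq_homA a hE₁ hE₂ (hW (x 2))
  rw [hhom]
  obtain ⟨u, Du, hu⟩ := exists_isWeakSolution hG hΩ hΩb hg hA hc0 hAc
  refine ⟨u, Du, hu, fun v Dv hv => hu.ae_eq hG hΩ hΩb hg hA hc0 hAc hv,
    fun r hr0 hr1 p hp => ⟨fun ε hε => ?_, fun uε Duε huε => ?_⟩⟩
  · exact exists_isWeakSolution hG hΩ hΩb hg (isBddTensor_plywoodTensor hΩ hε) hc0
      fun x ξ hξ => hc _ (plywoodTensor_twoPhase hε x) ξ hξ
  · exact weakH1Tendsto_plywood a hE₁ hE₂ hΩ hΩb hG hg hγc hγI hr0 hr1 hp huε hu
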